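/- Let $m\ge 1$, $n\ge 0$ be integers, $\zeta$ a primitive $m$-th root of unity, $\Gamma=\langle s\rangle\cong\mathbb Z_m$ with $s$ acting on $\mathbb C$ by $\zeta$, and $G=\mathbb Z_m\wr S_n=S_n\ltimes\Gamma^n$ acting on $\mathfrak h=\mathbb C^n$ and (dually) on $\mathfrak h^*$. Put $\mathfrak h_{\rm reg}=\{x\in\mathbb C^n:\prod_i x_i\prod_{i<j}(x_i^m-x_j^m)\ne0\}$, and give $T^*\mathfrak h_{\rm reg}=\mathfrak h_{\rm reg}\times\mathfrak h^*$, with coordinates $(x,p)$, the bracket $\{x_i,p_j\}=\delta_{ij}$. For $c_{00},c_1,\dots,c_{m-1}\in\mathbb C$ let $$\lambda_i=-\delta_{i0}\,m c_{00}+\sum_{l=1}^{m-1}c_l\zeta^{-il}\quad(i\in\mathbb Z/m),\qquad |\lambda|=\sum_i\lambda_i,$$ and let $\kappa_l$ ($l\in\mathbb Z/m$) be determined by $\sum_{r=1}^{m-1}c_rs^r=\sum_l m(\kappa_l-\kappa_{l-1})\epsilon_l$ and $\kappa_{m-1}=\sum_{r=1}^{m-1}\frac{m-r}{m^2}\lambda_r$,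 where $\epsilon_l=\frac1m\sum_r\zeta^{-lr}s^r$. The Hamiltonians $L_j$ ($j\ge1$) of the rational Calogero–Moser system of $G$ are the images of $\mathbf e\,(D_1^{jm}+\dots+D_n^{jm})\,\mathbf e\in\mathbb C[\mathfrak h_{\rm reg}\times\mathfrak h^*]*G$ under $\sum_g B_g\,g\mapsto\sum_g B_g$, where $\mathbf e=\frac1{|G|}\sum_{g\in G} g$ and $$D_i=p_i-c_{00}\sum_{j\ne i}\sum_{r=0}^{m-1}\frac{1}{x_i-\zeta^rx_j}\,s_i^rs_{ij}s_i^{-r}-\frac1{x_i}\sum_{l}m\kappa_l(\epsilon_l)_i .$$ For $(\nu,\mu)\in\mathfrak h_{\rm reg}\times\mathfrak h^*$ and $i=0,\dots,m-1$ let $Y_i=Y_i(\nu,\mu)$ be the $n\times n$ matrix with $$(Y_i)_{jj}=\mu_j+\frac1{\nu_j}\Big(-\sum_{r=0}^{m-1}\tfrac{m-r}{m}\lambda_r+\sum_{r=0}^{i}\lambda_r\Big),\qquad (Y_i)_{jk}=|\lambda|\,\frac{\nu_j^{i}\nu_k^{m-i-1}}{\nu_j^m-\nu_k^m}\ (j\ne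 k),$$ regarded as a map $V_{i+1}\to V_i$ with $V_i=\mathbb C^n$, $i\in\mathbb Z/m$, and let $Y=Y(\nu,\mu)=\sum_iY_i$, an $mn\times mn$ matrix on $\bigoplus_iV_i$. **(1) Lax matrix.** For arbitrary $c$: on $\mathfrak h_{\rm reg}\times\mathfrak h^*$ one has $\operatorname{tr}Y^{mj}=m\,L_j(\nu,\mu)$ for $j\ge1$, and $\operatorname{tr}Y^k=0$ if $m\nmid k$. The $L_j$ ($j\ge 1$) are holomorphic and Poisson-commute, and the differentials of $L_1,\dots,L_n$ are linearly independent on a dense subset. Along every holomorphic integral curve (in complex time, on a connected open set) of the Hamiltonian flow of any $L_j$, $j\ge1$, the characteristic polynomial of $Y$ is constant. **(2) Completed phase space.** Let $\mathtt{Rep}$ be the space of all $(X_i,Y_i,v,w)_{i\in\mathbb Z/m}$, $X_i:V_i\to V_{i+1}$, $Y_i:V_{i+1}\to V_i$, $v:\mathbb C\to V_0$, $w:V_0\to\mathbb C$, with the symplectic form $\omega=\sum_i\operatorname{tr}(dY_i\wedge dX_i)+dw\wedge dv$, and put $X=\sum_i X_i$, $Y=\sum_i Y_i$. Suppose that $\lambda$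 is regular: $|\lambda|\ne0$ and $k|\lambda|\ne\lambda_i+\dots+\lambda_{j-1}$ for all $k\in\mathbb Z$, $1\le i<j\le m$. Let $\mathcal C_{n,\lambda}$ be the quotient, by $GL_n(\mathbb C)^m$, of the fibre $\{Y_iX_i-X_{i-1}Y_{i-1}-\delta_{i0}vw=\lambda_i1_{V_i}\ \forall i\}$ of the moment map. Then: * The action on the fibre is free and $\mathcal C_{n,\lambda}$ is Hausdorff. At each point of the fibre, the tangent space of the orbit lies in the kernel of the differential of the moment map, it is the radical of $\omega$ restricted to that kernel, and the quotient of the kernel by it has dimension $2n$. * For $j\ge1$ the flow $X\mapsto X+|\lambda|\,j\,t_{mj}Y^{mj-1}$ on $\mathtt{Rep}$ ($Y,v,w$ fixed) is the Hamiltonian flow of the $GL_n(\mathbb C)^m$-invariant function $\frac{|\lambda|}{m}\operatorname{tr}Y^{mj}$. For every finitely supported $t=(t_{mj})_{j\ge1}$ the map $X\mapsto X+|\lambda|\sum_{j\ge1}j\,t_{mj}Y^{mj-1}$ preserves the fibre and descends to a map $\Phi_t:\mathcal C_{n,\lambda}\to\mathcal C_{n,\lambda}$. One has $\Phi_0=\mathrm{id}$,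 $\Phi_{s+t}=\Phi_s\Phi_t$, and for each $j$ the one-parameter flow with only $t_{mj}\ne0$ is jointly continuous on $\mathbb C\times\mathcal C_{n,\lambda}$. * The map $X_i=\operatorname{diag}(\nu_1,\dots,\nu_n)$, $Y_i=Y_i(\nu,\mu)$, $v=(1,\dots,1)^{T}$, $w=-|\lambda|(1,\dots,1)$ sends $\mathfrak h_{\rm reg}\times\mathfrak h^*$ into the fibre, pulls $\omega$ back to $m\sum_id\mu_i\wedge d\nu_i$, and induces a continuous open map $\iota:\mathfrak h_{\rm reg}\times\mathfrak h^*\to\mathcal C_{n,\lambda}$ with dense image whose fibres are exactly the $G$-orbits. * The $\Phi_t$ extend the Calogero–Moser flows: if $\gamma$ is an integral curve of the Hamiltonian flow of $L_j$ in $\mathfrak h_{\rm reg}\times\mathfrak h^*$ on a connected open set $U\subseteq\mathbb C$, then $\iota(\gamma(t'))=\Phi_\tau(\iota(\gamma(t)))$ for all $t,t'\in U$, where $\tau$ has the single non-zero component $\tau_{mj}=\frac{m}{|\lambda|}(t'-t)$. -/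

import Mathlib

open Topology

attribute [local instance] Matrix.normedAddCommGroup Matrix.normedSpace

noncomputable section

namespace WreathCM

/-! ### The group `G = ℤ_m ≀ S_n` and the canonical phase space -/

/-- The phase space `𝔥 × 𝔥* = ℂⁿ × ℂⁿ`, with points `(x, p)`. -/
abbrev Phase (n : ℕ) : Type := (Fin n → ℂ) × (Fin n → ℂ)

/-- The wreath product `ℤ_m ≀ S_n = Γⁿ ⋊ S_n`, where `Γ` is the group of `m`-th roots of unity
and `S_n` permutes the factors. -/
abbrev WreathG (m n : ℕ) : Type :=
  (Fin n → rootsOfUnity m ℂ) ⋊[mulAutArrow] (Equiv.Perm (Fin n))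

instance wreathFintype (m n : ℕ) [NeZero m] : Fintype (WreathG m n) :=
  haveI : Finite (WreathG m n) := Finite.of_equiv _ SemidirectProduct.equivProd.symm
  Fintype.ofFinite _

/-- The action on `𝔥 × 𝔥*`: `S_n` permutes the coordinates `x_i`, `p_i`, and
`(a_1, …, a_n) ∈ Γⁿ` multiplies `x_i` by `a_i` and `p_i` by `a_i⁻¹`. -/
instance phaseAction (m n : ℕ) : MulAction (WreathG m n) (Phase n) where
  smul g z :=
    (fun i => (((g.left i : rootsOfUnity m ℂ) : ℂˣ) : ℂ) * z.1 (g.right⁻¹ i),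
     fun i => (((g.left i : rootsOfUnity m ℂ) : ℂˣ) : ℂ)⁻¹ * z.2 (g.right⁻¹ i))
  one_smul z := by
    refine Prod.ext (funext fun i => ?_) (funext fun i => ?_)
    · change (((1 : rootsOfUnity m ℂ) : ℂˣ) : ℂ) * z.1 ((1 : Equiv.Perm (Fin n))⁻¹ i) = z.1 i
      simp
    · change (((1 : rootsOfUnity m ℂ) : ℂˣ) : ℂ)⁻¹ * z.2 ((1 : Equiv.Perm (Fin n))⁻¹ i) = z.2 i
      simp
  mul_smul g h z := by
    refine Prod.ext (funext fun i => ?_) (funext fun i => ?_)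
    · change (((g.left i * h.left (g.right⁻¹ i) : rootsOfUnity m ℂ) : ℂˣ) : ℂ)
          * z.1 ((g.right * h.right)⁻¹ i)
        = (((g.left i : rootsOfUnity m ℂ) : ℂˣ) : ℂ)
          * ((((h.left (g.right⁻¹ i) : rootsOfUnity m ℂ) : ℂˣ) : ℂ)
            * z.1 (h.right⁻¹ (g.right⁻¹ i)))
      simp [mul_assoc]
    · change (((g.left i * h.left (g.right⁻¹ i) : rootsOfUnity m ℂ) : ℂˣ) : ℂ)⁻¹
          * z.2 ((g.right * h.right)⁻¹ i)
        = (((g.left i : rootsOfUnity m ℂ) : ℂˣ) : ℂ)⁻¹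
          * ((((h.left (g.right⁻¹ i) : rootsOfUnity m ℂ) : ℂˣ) : ℂ)⁻¹
            * z.2 (h.right⁻¹ (g.right⁻¹ i)))
      rw [Subgroup.coe_mul, Units.val_mul, mul_inv, mul_assoc, mul_inv_rev]
      rfl

/-- The induced action on functions: `(g F)(z) = F (g⁻¹ z)`. -/
instance functionAction (m n : ℕ) : MulSemiringAction (WreathG m n) (Phase n → ℂ) where
  smul g F := fun z => F (g⁻¹ • z)
  one_smul F := by
    funext z
    change F ((1 : WreathG m n)⁻¹ • z) = F z
    rw [inv_one, one_smul]
  mul_smul g h F := by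
    funext z
    change F ((g * h)⁻¹ • z) = F (h⁻¹ • g⁻¹ • z)
    rw [mul_inv_rev, mul_smul]
  smul_zero _ := rfl
  smul_add _ _ _ := rfl
  smul_one _ := rfl
  smul_mul _ _ _ := rfl

/-- `𝔥_reg × 𝔥*`, where `𝔥_reg = {x | ∏ x_i ∏_{i<j} (x_i^m - x_j^m) ≠ 0}`. -/
def regDomain (m n : ℕ) : Set (Phase n) :=
  {z | (∀ i, z.1 i ≠ 0) ∧ ∀ i j, i ≠ j → z.1 i ^ m ≠ z.1 j ^ m}

/-- `∂f/∂x_i`. -/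
def dX {n : ℕ} (f : Phase n → ℂ) (i : Fin n) (z : Phase n) : ℂ :=
  fderiv ℂ f z (Pi.single i 1, 0)

/-- `∂f/∂p_i`. -/
def dP {n : ℕ} (f : Phase n → ℂ) (i : Fin n) (z : Phase n) : ℂ :=
  fderiv ℂ f z (0, Pi.single i 1)

/-- The canonical Poisson bracket, `{x_i, p_j} = δ_ij`. -/
def bracket {n : ℕ} (f g : Phase n → ℂ) (z : Phase n) : ℂ :=
  ∑ i, (dX f i z * dP g i z - dP f i z * dX g i z)

/-- The Hamiltonian vector field of `f`: `ẋ_i = ∂f/∂p_i`, `ṗ_i = -∂f/∂x_i`. -/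
def hamField {n : ℕ} (f : Phase n → ℂ) (z : Phase n) : Phase n :=
  (fun i => dP f i z, fun i => -dX f i z)

/-- `γ` is an integral curve on `U ⊆ ℂ` (complex time), inside `𝔥_reg × 𝔥*`, of the Hamiltonian
flow of `f`. -/
def IsHamiltonianCurve (m : ℕ) {n : ℕ} (f : Phase n → ℂ) (U : Set ℂ) (γ : ℂ → Phase n) : Prop :=
  ∀ t ∈ U, γ t ∈ regDomain m n ∧ HasDerivAt γ (hamField f (γ t)) t

/-! ### Parameters -/

/-- A root of unity as a complex number. -/
abbrev rootVal {m : ℕ} (ζ : rootsOfUnity m ℂ) : ℂ := ((ζ : ℂˣ) : ℂ)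

/-- `λ_i = ∑_{l=1}^{m-1} c_l ζ^{-il} - δ_{i0} m c₀₀`.  The value `c 0` is not used. -/
def lamOf {m : ℕ} [NeZero m] (ζ : rootsOfUnity m ℂ) (c₀₀ : ℂ) (c : Fin m → ℂ) (i : Fin m) : ℂ :=
  (if i = 0 then -(m : ℂ) * c₀₀ else 0)
    + ∑ l ∈ Finset.univ.filter (fun l : Fin m => l ≠ 0),
        c l * (rootVal ζ)⁻¹ ^ ((i : ℕ) * (l : ℕ))

/-- `|λ| = ∑ λ_i`. -/
def absLam {m : ℕ} (lam : Fin m → ℂ) : ℂ := ∑ i, lam i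

/-- The idempotent `ε_l = (1/m) ∑_r ζ^{-lr} s^r` of the group algebra `ℂΓ`, where `s = ζ`. -/
def idem {m : ℕ} (ζ : rootsOfUnity m ℂ) (l : Fin m) : MonoidAlgebra ℂ (rootsOfUnity m ℂ) :=
  ∑ r : Fin m,
    MonoidAlgebra.single (ζ ^ (r : ℕ)) ((m : ℂ)⁻¹ * (rootVal ζ)⁻¹ ^ ((l : ℕ) * (r : ℕ)))

/-- The parameters `κ_l` (indices modulo `m`) belonging to `c`:
`∑_{r=1}^{m-1} c_r s^r = ∑_l m (κ_l - κ_{l-1}) ε_l`, and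
`κ_{m-1} = ∑_{r=1}^{m-1} (m - r) λ_r / m²`. -/
def IsKappa {m : ℕ} [NeZero m] (ζ : rootsOfUnity m ℂ) (c₀₀ : ℂ) (c κ : Fin m → ℂ) : Prop :=
  (∑ r ∈ Finset.univ.filter (fun r : Fin m => r ≠ 0), MonoidAlgebra.single (ζ ^ (r : ℕ)) (c r)
      = ∑ l : Fin m, ((m : ℂ) * (κ l - κ (l - 1))) • idem ζ l) ∧
  κ (-1) = ∑ r ∈ Finset.univ.filter (fun r : Fin m => r ≠ 0),
      ((m : ℂ) - ((r : ℕ) : ℂ)) / (m : ℂ) ^ 2 * lamOf ζ c₀₀ c r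

/-- Regularity of `λ`, i.e. `λ · α ≠ 0` for every root `α` of the cyclic quiver with `m` vertices:
the roots are `k δ` (`k ≠ 0`) and `k δ ± (ε_i + ⋯ + ε_{j-1})` with `1 ≤ i < j ≤ m`. -/
def IsRegular {m : ℕ} (lam : Fin m → ℂ) : Prop :=
  absLam lam ≠ 0 ∧ ∀ (k : ℤ) (i j : ℕ), 1 ≤ i → i < j → j ≤ m →
    (k : ℂ) * absLam lam
      ≠ ∑ r ∈ Finset.univ.filter (fun r : Fin m => i ≤ (r : ℕ) ∧ (r : ℕ) < j), lam r

/-! ### Dunkl operators and the Calogero–Moser Hamiltonians -/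

/-- The crossed product of functions on `𝔥 × 𝔥*` with `G`; `single g B` is the element `B g`, and
`(A g)(B h) = A g(B) gh`.  Denominators are inverted pointwise; only values on the `G`-invariant
set `𝔥_reg × 𝔥*`, where no denominator vanishes, are ever used. -/
abbrev Crossed (m n : ℕ) : Type := SkewMonoidAlgebra (Phase n → ℂ) (WreathG m n)

/-- The generator `s = ζ` of `Γ` placed in the `i`-th factor of `Γⁿ`. -/
def sGen {m n : ℕ} (ζ : rootsOfUnity m ℂ) (i : Fin n) : WreathG m n :=
  SemidirectProduct.inl (Pi.mulSingle i ζ)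

/-- The transposition `s_ij`. -/
def sSwap {m n : ℕ} (i j : Fin n) : WreathG m n :=
  SemidirectProduct.inr (Equiv.swap i j)

/-- The idempotent `ε_l` placed in the `i`-th factor. -/
def idemAt {m n : ℕ} (ζ : rootsOfUnity m ℂ) (l : Fin m) (i : Fin n) : Crossed m n :=
  ∑ r : Fin m, SkewMonoidAlgebra.single (sGen ζ i ^ (r : ℕ))
    (fun _ => (m : ℂ)⁻¹ * (rootVal ζ)⁻¹ ^ ((l : ℕ) * (r : ℕ)))

/-- The classical Dunkl operator
`D_i = p_i - c₀₀ ∑_{j≠i} ∑_r (x_i - ζ^r x_j)⁻¹ s_i^r s_ij s_i^{-r} - x_i⁻¹ ∑_l m κ_l (ε_l)_i`. -/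
def dunkl {m n : ℕ} (ζ : rootsOfUnity m ℂ) (c₀₀ : ℂ) (κ : Fin m → ℂ) (i : Fin n) :
    Crossed m n :=
  SkewMonoidAlgebra.single 1 (fun z => z.2 i)
    - ∑ j ∈ Finset.univ.filter (fun j : Fin n => j ≠ i), ∑ r : Fin m,
        SkewMonoidAlgebra.single (sGen ζ i ^ (r : ℕ) * sSwap i j * (sGen ζ i ^ (r : ℕ))⁻¹)
          (fun z => c₀₀ * (z.1 i - rootVal ζ ^ (r : ℕ) * z.1 j)⁻¹)
    - ∑ l : Fin m,
        SkewMonoidAlgebra.single 1 (fun z => (z.1 i)⁻¹ * ((m : ℂ) * κ l)) * idemAt ζ l i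

/-- The symmetrising idempotent `e = |G|⁻¹ ∑ g`. -/
def symIdem (m n : ℕ) [NeZero m] : Crossed m n :=
  ∑ g : WreathG m n, SkewMonoidAlgebra.single g (fun _ => (Fintype.card (WreathG m n) : ℂ)⁻¹)

/-- The linear map `∑ B_g g ↦ ∑ B_g`. -/
def forgetGroup {m n : ℕ} [NeZero m] (A : Crossed m n) : Phase n → ℂ :=
  ∑ g : WreathG m n, A.coeff g

/-- The Hamiltonian `L_j` of the classical rational Calogero–Moser system of `ℤ_m ≀ S_n`: the
image of `e (D_1^{jm} + ⋯ + D_n^{jm}) e` under `∑ B_g g ↦ ∑ B_g`. -/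
def calogeroHam {m : ℕ} (n : ℕ) [NeZero m] (ζ : rootsOfUnity m ℂ) (c₀₀ : ℂ) (κ : Fin m → ℂ)
    (j : ℕ) : Phase n → ℂ :=
  forgetGroup (symIdem m n * (∑ i : Fin n, dunkl ζ c₀₀ κ i ^ (j * m)) * symIdem m n)

/-! ### Representations of the framed cyclic quiver, and their symplectic quotient -/

/-- Data `(X_i, Y_i, v, w)`, `X_i : V_i → V_{i+1}`, `Y_i : V_{i+1} → V_i`, `v : ℂ → V_0`,
`w : V_0 → ℂ`, with `V_i = ℂⁿ` for `i ∈ ℤ/m`. -/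
abbrev Rep (m n : ℕ) : Type :=
  (Fin m → Matrix (Fin n) (Fin n) ℂ) × (Fin m → Matrix (Fin n) (Fin n) ℂ) ×
    (Fin n → ℂ) × (Fin n → ℂ)

/-- `X_i`. -/
abbrev rX {m n : ℕ} (q : Rep m n) : Fin m → Matrix (Fin n) (Fin n) ℂ := q.1
/-- `Y_i`. -/
abbrev rY {m n : ℕ} (q : Rep m n) : Fin m → Matrix (Fin n) (Fin n) ℂ := q.2.1
/-- `v`. -/
abbrev rv {m n : ℕ} (q : Rep m n) : Fin n → ℂ := q.2.2.1
/-- `w`. -/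
abbrev rw {m n : ℕ} (q : Rep m n) : Fin n → ℂ := q.2.2.2

/-- `X = ∑ X_i` as an `mn × mn` matrix on `⊕ V_i`. -/
def bigX {m n : ℕ} [NeZero m] (X : Fin m → Matrix (Fin n) (Fin n) ℂ) :
    Matrix (Fin m × Fin n) (Fin m × Fin n) ℂ :=
  Matrix.of fun a b => if a.1 = b.1 + 1 then X b.1 a.2 b.2 else 0

/-- `Y = ∑ Y_i` as an `mn × mn` matrix on `⊕ V_i`. -/
def bigY {m n : ℕ} [NeZero m] (Y : Fin m → Matrix (Fin n) (Fin n) ℂ) :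
    Matrix (Fin m × Fin n) (Fin m × Fin n) ℂ :=
  Matrix.of fun a b => if b.1 = a.1 + 1 then Y a.1 a.2 b.2 else 0

/-- The symplectic form `∑ tr (dY_i ∧ dX_i) + dw ∧ dv`. -/
def sympForm {m n : ℕ} (ξ η : Rep m n) : ℂ :=
  ∑ i, ((rY ξ i * rX η i).trace - (rY η i * rX ξ i).trace)
    + (dotProduct (rw ξ) (rv η) - dotProduct (rw η) (rv ξ))

/-- The moment map `(Y_i X_i - X_{i-1} Y_{i-1} - δ_{i0} v w)_i`. -/
def momentMap {m n : ℕ} [NeZero m] (q : Rep m n) : Fin m → Matrix (Fin n) (Fin n) ℂ :=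
  fun i => rY q i * rX q i - rX q (i - 1) * rY q (i - 1)
    - (if i = 0 then Matrix.vecMulVec (rv q) (rw q) else 0)

/-- The fibre of the moment map over `(λ_i 1_{V_i})_i`.  (The relation `w v = -n |λ|` at the
framing vertex follows by taking traces.) -/
def Fibre {m : ℕ} (n : ℕ) [NeZero m] (lam : Fin m → ℂ) : Type :=
  {q : Rep m n // ∀ i, momentMap q i = lam i • (1 : Matrix (Fin n) (Fin n) ℂ)}

instance fibreTopology {m : ℕ} (n : ℕ) [NeZero m] (lam : Fin m → ℂ) :
    TopologicalSpace (Fibre n lam) :=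
  instTopologicalSpaceSubtype

/-- The action of `∏_i GL(V_i)`. -/
def glAct {m n : ℕ} [NeZero m] (g : Fin m → GL (Fin n) ℂ) (q : Rep m n) : Rep m n :=
  (fun i => (g (i + 1)).val * rX q i * (g i)⁻¹.val,
   fun i => (g i).val * rY q i * (g (i + 1))⁻¹.val,
   (g 0).val.mulVec (rv q),
   Matrix.vecMul (rw q) (g 0)⁻¹.val)

theorem glAct_one {m n : ℕ} [NeZero m] (q : Rep m n) : glAct 1 q = q := by
  refine Prod.ext ?_ (Prod.ext ?_ (Prod.ext ?_ ?_)) <;> simp [glAct]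

theorem glAct_mul {m n : ℕ} [NeZero m] (g h : Fin m → GL (Fin n) ℂ) (q : Rep m n) :
    glAct (g * h) q = glAct g (glAct h q) := by
  refine Prod.ext ?_ (Prod.ext ?_ (Prod.ext ?_ ?_)) <;>
    simp [glAct, rX, rY, rv, rw, mul_assoc]

/-- Two points of the fibre are equivalent if they lie in one `∏ GL(V_i)`-orbit. -/
def orbitSetoid {m : ℕ} (n : ℕ) [NeZero m] (lam : Fin m → ℂ) : Setoid (Fibre n lam) where
  r q q' := ∃ g, glAct g q.1 = q'.1
  iseqv :=
    { refl := fun q => ⟨1, glAct_one q.1⟩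
      symm := by
        rintro q q' ⟨g, hg⟩
        exact ⟨g⁻¹, by rw [← hg, ← glAct_mul, inv_mul_cancel, glAct_one]⟩
      trans := by
        rintro q q' q'' ⟨g, hg⟩ ⟨h, hh⟩
        exact ⟨h * g, by rw [glAct_mul, hg, hh]⟩ }

/-- The Calogero–Moser space `𝒞_{n,λ}` (for regular `λ`): the space of `∏ GL(V_i)`-orbits in the
fibre of the moment map, with the quotient topology. -/
def CMSpace {m : ℕ} (n : ℕ) [NeZero m] (lam : Fin m → ℂ) : Type := Quotient (orbitSetoid n lam)

instance cmTopology {m : ℕ} (n : ℕ) [NeZero m] (lam : Fin m → ℂ) :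
    TopologicalSpace (CMSpace n lam) :=
  instTopologicalSpaceQuotient

/-- The point of `𝒞_{n,λ}` represented by a point of the fibre. -/
def toCM {m n : ℕ} [NeZero m] {lam : Fin m → ℂ} (q : Fibre n lam) : CMSpace n lam :=
  Quotient.mk (orbitSetoid n lam) q

/-- The infinitesimal action of `∏ 𝔤𝔩(V_i)`. -/
def glInf {m n : ℕ} [NeZero m] (q : Rep m n) (a : Fin m → Matrix (Fin n) (Fin n) ℂ) : Rep m n :=
  (fun i => a (i + 1) * rX q i - rX q i * a i,
   fun i => a i * rY q i - rY q i * a (i + 1),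
   (a 0).mulVec (rv q),
   -Matrix.vecMul (rw q) (a 0))

/-- The tangent space of the orbit of `q`. -/
def orbitTangent {m n : ℕ} [NeZero m] (q : Rep m n) : Submodule ℂ (Rep m n) :=
  Submodule.span ℂ (Set.range (glInf q))

/-- The kernel of the differential of the moment map at `q`. -/
def fibreTangent {m n : ℕ} [NeZero m] (q : Rep m n) : Submodule ℂ (Rep m n) :=
  LinearMap.ker (fderiv ℂ (momentMap (m := m) (n := n)) q).toLinearMap

/-! ### The Lax matrix and the linear flows -/

/-- The matrices `Y_i(ν, μ)`, at the point `z = (ν, μ)`. -/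
def laxBlock {m n : ℕ} (lam : Fin m → ℂ) (z : Phase n) (i : Fin m) :
    Matrix (Fin n) (Fin n) ℂ :=
  Matrix.of fun j k =>
    if j = k then
      z.2 j + (z.1 j)⁻¹ *
        (-(∑ r : Fin m, ((m : ℂ) - ((r : ℕ) : ℂ)) / (m : ℂ) * lam r)
          + ∑ r ∈ Finset.Iic i, lam r)
    else absLam lam * (z.1 j ^ (i : ℕ) * z.1 k ^ (m - 1 - (i : ℕ))) / (z.1 j ^ m - z.1 k ^ m)

/-- The `mn × mn` matrix `Y(ν, μ) = ∑ Y_i(ν, μ)`. -/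
def laxMatrix {m n : ℕ} [NeZero m] (lam : Fin m → ℂ) (z : Phase n) :
    Matrix (Fin m × Fin n) (Fin m × Fin n) ℂ :=
  bigY (laxBlock lam z)

/-- The slice `𝔥_reg × 𝔥* → Rep`: `X_i = diag ν`, `Y_i = Y_i(ν, μ)`, `v = (1, …, 1)`,
`w = -|λ| (1, …, 1)`. -/
def slice {m n : ℕ} (lam : Fin m → ℂ) (z : Phase n) : Rep m n :=
  (fun _ => Matrix.diagonal z.1, laxBlock lam z, fun _ => 1, fun _ => -absLam lam)

/-- The velocity `|λ| ∑_j j t_{mj} Y^{mj-1}` of the linear flows. -/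
def flowIncrement {m n : ℕ} [NeZero m] (lam : Fin m → ℂ) (t : ℕ+ →₀ ℂ) (q : Rep m n) :
    Matrix (Fin m × Fin n) (Fin m × Fin n) ℂ :=
  absLam lam • t.sum fun j τ => (((j : ℕ) : ℂ) * τ) • bigY (rY q) ^ (m * (j : ℕ) - 1)

/-- The linear flow `X ↦ X + |λ| ∑_j j t_{mj} Y^{mj-1}`, with `Y`, `v`, `w` fixed; `t j` is the
time `t_{mj}`.  Componentwise, `X_i` is the `V_i → V_{i+1}` block of `X`; the matrix
`Y^{mj-1}` has no blocks other than these. -/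
def linearFlow {m n : ℕ} [NeZero m] (lam : Fin m → ℂ) (t : ℕ+ →₀ ℂ) (q : Rep m n) : Rep m n :=
  (fun i => rX q i + Matrix.of fun a b => flowIncrement lam t q (i + 1, a) (i, b),
   rY q, rv q, rw q)

/-- The Hamiltonian `(|λ|/m) tr Y^{mj}` of the `t_{mj}`-flow. -/
def flowHam {m n : ℕ} [NeZero m] (lam : Fin m → ℂ) (j : ℕ+) (q : Rep m n) : ℂ :=
  absLam lam / (m : ℂ) * (bigY (rY q) ^ (m * (j : ℕ))).trace

end WreathCM

end

/-!
Write `Λ = (Y_i(z))` for the Lax matrix at `z = (ν, μ)`, and `q(z) ∈ Rep` for the point of the slice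
over `z`.

*The traces.*  Partial fractions over the `m`-th roots of unity show that the Dunkl operators,
applied to the function `1`, act through products of consecutive blocks of `Λ` (`dunkl_pow_apply`),
so that `L_j = ∑_a (Λ^{mj} 1)_a`, summed over the zeroth block (`calogeroHam_eq_sum_laxVec`).
The moment map equation at `q(z)`, multiplied by `Y^{mj}` and traced, turns this sum into
`(1/m) tr Λ^{mj}` (`trace_laxMatrix_pow`); when `|λ| = 0` the blocks of `Λ` are diagonal.

*The Lax pair.*  The group acts infinitesimally freely at `q(z)`, for every `λ` with no regularity
assumption, and the kernel of the differential of the moment map at `q(z)` is the sum of the tangent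
spaces of the slice and of the orbit (`exists_of_mem_fibreTangent_slice`).  On `Rep` the Hamiltonian
field of `tr Y^{mj}` is a multiple of `X ↦ Y^{mj-1}`.  It lies in that kernel, hence coincides with
the field of `L_j` on the slice up to an infinitesimal gauge transformation (`exists_lax_pair`).
This yields at once the involution of the `L_j` and the isospectrality of `Λ`.  The differentials
are independent on a dense set because the leading coefficient of their Jacobian for large momenta
is a Vandermonde determinant (`regDomain_subset_closure`).

*Regular parameters.*  Regularity of `λ` says that the partial sums of the cyclically extended
sequence `λ` are pairwise distinct.  On a graded subspace on which the `v w` term is invisible, `XY`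
would therefore have infinitely many eigenvalues; so such a subspace vanishes
(`graded_subspace_eq_bot`).  Hence a nonzero intertwiner of two points of the fibre, compatible with
`v` and `w` up to a common scalar, is an isomorphism.  This gives freeness, and it exhibits the
orbit relation as the projection of a closed set along a compact sphere (`exists_glAct_iff`), so that
the quotient is Hausdorff.  The tangent space of an orbit is the `ω`-orthogonal of the kernel of the
differential of the moment map, which gives the radical and the dimension.

*The flows.*  The increment of `X` along a linear flow is a polynomial in `Y`, so it commutes with
`Y` and is equivariant; everything about `Φ_t` follows from this.  The invariants `tr X^{mk}` and
`tr Y X^{mk+1}` separate the orbits of the wreath product on the slice, and the implicit function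
theorem brings points of the fibre near `q(z)` back into the slice (`exists_local_gauge`), so that
`ι` is open.  Undoing the linear flow along an integral curve of `L_j` leaves these invariants
constant; hence the two flows agree locally, and by connectedness globally (`cmPoint_eq_cmFlow`).

*Density of the slice.*  A rank argument shows that the points with all `X_i` invertible are dense
(`dense_det_ne_zero`).  Such a point can be moved to one with `X_i = 1` for `i ≠ -1`, and then
`P = X_{-1}`, `Q = Y_{-1}` satisfy `[Q, P] = |λ| + v w`.  Adding `y Q + t Q²` to `P` stays in the
fibre.  The polynomial `τ = det (x - P - y Q - t Q²)` satisfies a bilinear differential equation,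
under which a multiple factor of `τ` would have to divide its own `x`-derivative
(`dvd_derivation_of_sq_dvd_det`); so the eigenvalues of the deformed matrix are generically distinct
(`exists_separable_charpoly`), and a point with distinct eigenvalues is brought into the slice by
diagonalisation (`toCM_mem_range_cmPoint`).
-/

noncomputable section

namespace WreathCM

variable {m n : ℕ} [NeZero m]

/-! ### Block matrices on `⊕ V_i` -/

/-- The block diagonal matrix `⊕ a_i` on `⊕ V_i`. -/
def blockD (a : Fin m → Matrix (Fin n) (Fin n) ℂ) :
    Matrix (Fin m × Fin n) (Fin m × Fin n) ℂ :=
  Matrix.of fun x y => if x.1 = y.1 then a x.1 x.2 y.2 else 0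

/-- The extension by zero of a vector of `V_0` to `⊕ V_i`. -/
def vec0 (v : Fin n → ℂ) : Fin m × Fin n → ℂ := fun x => if x.1 = 0 then v x.2 else 0

theorem bigY_mul_apply (Y : Fin m → Matrix (Fin n) (Fin n) ℂ)
    {ι : Type*} (M : Matrix (Fin m × Fin n) ι ℂ) (i : Fin m) (a : Fin n) (y : ι) :
    (bigY Y * M) (i, a) y = ∑ c, Y i a c * M (i + 1, c) y := by
  simp [Matrix.mul_apply, Fintype.sum_prod_type, bigY, ite_mul]

theorem mul_bigY_apply (Y : Fin m → Matrix (Fin n) (Fin n) ℂ)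
    {ι : Type*} (M : Matrix ι (Fin m × Fin n) ℂ) (i : Fin m) (a : Fin n) (x : ι) :
    (M * bigY Y) x (i, a) = ∑ c, M x (i - 1, c) * Y (i - 1) c a := by
  have h : ∀ j : Fin m, i = j + 1 ↔ i - 1 = j := fun j => by
    constructor
    · rintro rfl; simp
    · rintro rfl; simp
  simp [Matrix.mul_apply, Fintype.sum_prod_type, bigY, h]

theorem bigX_mul_apply (X : Fin m → Matrix (Fin n) (Fin n) ℂ)
    {ι : Type*} (M : Matrix (Fin m × Fin n) ι ℂ) (i : Fin m) (a : Fin n) (y : ι) :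
    (bigX X * M) (i, a) y = ∑ c, X (i - 1) a c * M (i - 1, c) y := by
  have h : ∀ j : Fin m, i = j + 1 ↔ i - 1 = j := fun j => by
    constructor
    · rintro rfl; simp
    · rintro rfl; simp
  simp [Matrix.mul_apply, Fintype.sum_prod_type, bigX, h]

theorem blockD_mul_apply (D : Fin m → Matrix (Fin n) (Fin n) ℂ)
    {ι : Type*} (M : Matrix (Fin m × Fin n) ι ℂ) (i : Fin m) (a : Fin n) (y : ι) :
    (blockD D * M) (i, a) y = ∑ c, D i a c * M (i, c) y := by
  simp [Matrix.mul_apply, Fintype.sum_prod_type, blockD]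

theorem mul_blockD_apply (D : Fin m → Matrix (Fin n) (Fin n) ℂ)
    {ι : Type*} (M : Matrix ι (Fin m × Fin n) ℂ) (i : Fin m) (a : Fin n) (x : ι) :
    (M * blockD D) x (i, a) = ∑ c, M x (i, c) * D i c a := by
  simp [Matrix.mul_apply, Fintype.sum_prod_type, blockD]

theorem blockD_apply (D : Fin m → Matrix (Fin n) (Fin n) ℂ) (i j : Fin m) (a b : Fin n) :
    blockD D (i, a) (j, b) = if i = j then D i a b else 0 := rfl

theorem bigX_apply (X : Fin m → Matrix (Fin n) (Fin n) ℂ) (i j : Fin m) (a b : Fin n) :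
    bigX X (i, a) (j, b) = if i = j + 1 then X j a b else 0 := rfl

theorem bigY_apply (Y : Fin m → Matrix (Fin n) (Fin n) ℂ) (i j : Fin m) (a b : Fin n) :
    bigY Y (i, a) (j, b) = if j = i + 1 then Y i a b else 0 := rfl

theorem blockD_injective :
    Function.Injective (blockD : (Fin m → Matrix (Fin n) (Fin n) ℂ) → _) := by
  intro a b h
  ext i x y
  simpa [blockD_apply] using congrFun (congrFun h (i, x)) (i, y)

theorem bigX_injective :
    Function.Injective (bigX : (Fin m → Matrix (Fin n) (Fin n) ℂ) → _) := by
  intro a b h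
  ext i x y
  simpa [bigX_apply] using congrFun (congrFun h (i + 1, x)) (i, y)

theorem blockD_mul (a b : Fin m → Matrix (Fin n) (Fin n) ℂ) :
    blockD a * blockD b = blockD fun i => a i * b i := by
  ext ⟨i, x⟩ ⟨j, y⟩
  rw [blockD_mul_apply, blockD_apply]
  by_cases h : i = j <;> simp [blockD_apply, h, Matrix.mul_apply]

theorem blockD_one : blockD (fun _ => 1 : Fin m → Matrix (Fin n) (Fin n) ℂ) = 1 := by
  ext ⟨i, x⟩ ⟨j, y⟩
  by_cases h : i = j <;> simp [blockD_apply, h, Matrix.one_apply]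

theorem blockD_sub (a b : Fin m → Matrix (Fin n) (Fin n) ℂ) :
    blockD a - blockD b = blockD fun i => a i - b i := by
  ext ⟨i, x⟩ ⟨j, y⟩
  by_cases h : i = j <;> simp [blockD_apply, h]

theorem bigX_add (a b : Fin m → Matrix (Fin n) (Fin n) ℂ) :
    bigX (fun i => a i + b i) = bigX a + bigX b := by
  ext ⟨i, x⟩ ⟨j, y⟩
  by_cases h : i = j + 1 <;> simp [bigX_apply, h]

theorem bigX_sub (a b : Fin m → Matrix (Fin n) (Fin n) ℂ) :
    bigX (fun i => a i - b i) = bigX a - bigX b := by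
  ext ⟨i, x⟩ ⟨j, y⟩
  by_cases h : i = j + 1 <;> simp [bigX_apply, h]

theorem bigY_add (a b : Fin m → Matrix (Fin n) (Fin n) ℂ) :
    bigY (fun i => a i + b i) = bigY a + bigY b := by
  ext ⟨i, x⟩ ⟨j, y⟩
  by_cases h : j = i + 1 <;> simp [bigY_apply, h]

theorem bigY_sub (a b : Fin m → Matrix (Fin n) (Fin n) ℂ) :
    bigY (fun i => a i - b i) = bigY a - bigY b := by
  ext ⟨i, x⟩ ⟨j, y⟩
  by_cases h : j = i + 1 <;> simp [bigY_apply, h]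

theorem bigY_smul (c : ℂ) (a : Fin m → Matrix (Fin n) (Fin n) ℂ) :
    bigY (fun i => c • a i) = c • bigY a := by
  ext ⟨i, x⟩ ⟨j, y⟩
  by_cases h : j = i + 1 <;> simp [bigY_apply, h]

theorem bigY_mul_bigX (Y X : Fin m → Matrix (Fin n) (Fin n) ℂ) :
    bigY Y * bigX X = blockD fun i => Y i * X i := by
  ext ⟨i, x⟩ ⟨j, y⟩
  rw [bigY_mul_apply, blockD_apply]
  by_cases h : i = j <;> simp [bigX_apply, h, Matrix.mul_apply]

theorem bigX_mul_bigY (Y X : Fin m → Matrix (Fin n) (Fin n) ℂ) :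
    bigX X * bigY Y = blockD fun i => X (i - 1) * Y (i - 1) := by
  ext ⟨i, x⟩ ⟨j, y⟩
  rw [bigX_mul_apply, blockD_apply]
  by_cases h : i = j
  · simp [bigY_apply, h, Matrix.mul_apply]
  · have h' : ¬ j = i := fun e => h e.symm
    simp [bigY_apply, h, h']

theorem blockD_mul_bigX (a X : Fin m → Matrix (Fin n) (Fin n) ℂ) :
    blockD a * bigX X = bigX fun i => a (i + 1) * X i := by
  ext ⟨i, x⟩ ⟨j, y⟩
  rw [blockD_mul_apply, bigX_apply]
  by_cases h : i = j + 1 <;> simp [bigX_apply, h, Matrix.mul_apply]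

theorem bigX_mul_blockD (a X : Fin m → Matrix (Fin n) (Fin n) ℂ) :
    bigX X * blockD a = bigX fun i => X i * a i := by
  ext ⟨i, x⟩ ⟨j, y⟩
  rw [mul_blockD_apply, bigX_apply]
  by_cases h : i = j + 1 <;> simp [bigX_apply, h, Matrix.mul_apply]

theorem blockD_mul_bigY (a Y : Fin m → Matrix (Fin n) (Fin n) ℂ) :
    blockD a * bigY Y = bigY fun i => a i * Y i := by
  ext ⟨i, x⟩ ⟨j, y⟩
  rw [blockD_mul_apply, bigY_apply]
  by_cases h : j = i + 1 <;> simp [bigY_apply, h, Matrix.mul_apply]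

theorem bigY_mul_blockD (a Y : Fin m → Matrix (Fin n) (Fin n) ℂ) :
    bigY Y * blockD a = bigY fun i => Y i * a (i + 1) := by
  ext ⟨i, x⟩ ⟨j, y⟩
  rw [mul_blockD_apply, bigY_apply]
  by_cases h : j = i + 1 <;> simp [bigY_apply, h, Matrix.mul_apply]

theorem vecMulVec_vec0 (v w : Fin n → ℂ) :
    Matrix.vecMulVec (vec0 (m := m) v) (vec0 w)
      = blockD fun i => if i = 0 then Matrix.vecMulVec v w else 0 := by
  ext ⟨i, x⟩ ⟨j, y⟩
  by_cases h : i = j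
  · subst h
    by_cases h0 : i = 0 <;> simp [blockD_apply, vec0, Matrix.vecMulVec_apply, h0]
  · by_cases h0 : i = 0
    · have : ¬ j = 0 := fun e => h (h0.trans e.symm)
      simp [blockD_apply, vec0, Matrix.vecMulVec_apply, h, this]
    · simp [blockD_apply, vec0, Matrix.vecMulVec_apply, h, h0]

theorem trace_blockD (a : Fin m → Matrix (Fin n) (Fin n) ℂ) :
    (blockD a).trace = ∑ i, (a i).trace := by
  simp [Matrix.trace, Fintype.sum_prod_type, blockD_apply]

theorem bigY_mulVec (a : Fin m → Matrix (Fin n) (Fin n) ℂ) (u : Fin m × Fin n → ℂ)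
    (i : Fin m) (x : Fin n) :
    (bigY a).mulVec u (i, x) = (a i).mulVec (fun c => u (i + 1, c)) x := by
  simp [Matrix.mulVec, dotProduct, Fintype.sum_prod_type, bigY_apply]

/-- `Y^k` has only blocks `V_{i+k} → V_i`. -/
theorem bigY_pow_apply_eq_zero (Y : Fin m → Matrix (Fin n) (Fin n) ℂ) (k : ℕ)
    (i j : Fin m) (a b : Fin n) (h : j ≠ i + k • (1 : Fin m)) :
    (bigY Y ^ k) (i, a) (j, b) = 0 := by
  induction k generalizing i a with
  | zero =>
    have : i ≠ j := fun e => h (by simp [e])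
    simp [this]
  | succ k ih =>
    rw [pow_succ', bigY_mul_apply]
    refine Finset.sum_eq_zero fun c _ => ?_
    rw [ih (i + 1) c (fun e => h (by rw [e, succ_nsmul']; abel)), mul_zero]

theorem card_nsmul_one_fin : m • (1 : Fin m) = 0 := by
  simpa using card_nsmul_eq_zero' (G := Fin m) (x := 1)

theorem nsmul_one_eq_zero_iff (k : ℕ) : k • (1 : Fin m) = 0 ↔ m ∣ k := by
  constructor
  · intro h
    have h1 : ∀ k : ℕ, ((k • (1 : Fin m) : Fin m) : ℕ) = k % m := by
      intro k
      induction k with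
      | zero => simp
      | succ k ih =>
        rw [succ_nsmul, Fin.val_add, ih, Fin.val_one', ← Nat.add_mod]
    have := h1 k
    rw [h] at this
    exact Nat.dvd_of_mod_eq_zero (by simpa using this.symm)
  · rintro ⟨l, rfl⟩
    rw [mul_nsmul, card_nsmul_one_fin, nsmul_zero]

theorem val_nsmul_one (k : ℕ) : ((k • (1 : Fin m) : Fin m) : ℕ) = k % m := by
  induction k with
  | zero => simp
  | succ k ih =>
    rw [succ_nsmul, Fin.val_add, ih, Fin.val_one', ← Nat.add_mod]

theorem trace_bigY_pow_eq_zero (Y : Fin m → Matrix (Fin n) (Fin n) ℂ) (k : ℕ) (h : ¬ m ∣ k) :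
    (bigY Y ^ k).trace = 0 := by
  refine Finset.sum_eq_zero fun x _ => ?_
  refine bigY_pow_apply_eq_zero Y k x.1 x.1 x.2 x.2 fun e => h ?_
  rw [← nsmul_one_eq_zero_iff]
  simpa using e.symm

/-- The block `V_i → V_{i+1}` of a matrix. -/
def blockX (M : Matrix (Fin m × Fin n) (Fin m × Fin n) ℂ) (i : Fin m) :
    Matrix (Fin n) (Fin n) ℂ :=
  Matrix.of fun a b => M (i + 1, a) (i, b)

/-- `Y^{mj-1}` consists of its blocks `V_i → V_{i+1}`. -/
theorem bigX_blockX_bigY_pow (Y : Fin m → Matrix (Fin n) (Fin n) ℂ) (j : ℕ) (hj : 1 ≤ j) :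
    bigX (blockX (bigY Y ^ (m * j - 1))) = bigY Y ^ (m * j - 1) := by
  ext ⟨i, x⟩ ⟨l, y⟩
  rw [bigX_apply]
  split_ifs with h
  · simp [blockX, h]
  · rw [bigY_pow_apply_eq_zero]
    intro e
    apply h
    have hm : 1 ≤ m * j := Nat.mul_pos (NeZero.pos m) hj
    have h1 : (m * j - 1) • (1 : Fin m) + 1 = 0 := by
      rw [← succ_nsmul, Nat.sub_add_cancel hm, nsmul_one_eq_zero_iff]
      exact dvd_mul_right m j
    rw [e, add_assoc, h1, add_zero]

theorem trace_mul_vecMulVec {ι : Type*} [Fintype ι] (A : Matrix ι ι ℂ) (v w : ι → ℂ) :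
    (A * Matrix.vecMulVec v w).trace = dotProduct w (A.mulVec v) := by
  simp [Matrix.trace, Matrix.mul_apply, Matrix.vecMulVec_apply, dotProduct, Matrix.mulVec,
    Finset.mul_sum, mul_comm, mul_left_comm]

/-- The moment map in terms of the big matrices: `YX - XY - vw`. -/
theorem blockD_momentMap (q : Rep m n) :
    blockD (momentMap q) = bigY (rY q) * bigX (rX q) - bigX (rX q) * bigY (rY q)
      - Matrix.vecMulVec (vec0 (rv q)) (vec0 (rw q)) := by
  rw [bigY_mul_bigX, bigX_mul_bigY, vecMulVec_vec0, blockD_sub, blockD_sub]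
  rfl

/-- The moment map equation in terms of the big matrices. -/
theorem moment_iff (q : Rep m n) (lam : Fin m → ℂ) :
    (∀ i, momentMap q i = lam i • (1 : Matrix (Fin n) (Fin n) ℂ)) ↔
      bigY (rY q) * bigX (rX q) - bigX (rX q) * bigY (rY q)
        = blockD (fun i => lam i • 1) + Matrix.vecMulVec (vec0 (rv q)) (vec0 (rw q)) := by
  rw [← sub_eq_iff_eq_add, ← blockD_momentMap, blockD_injective.eq_iff, funext_iff]

/-! ### The parameters -/

theorem rootVal_pow {m : ℕ} (ξ : rootsOfUnity m ℂ) : rootVal ξ ^ m = 1 := by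
  have := (mem_rootsOfUnity m _).1 ξ.2
  rw [rootVal, ← Units.val_pow_eq_pow_val, this, Units.val_one]

theorem rootVal_ne_zero {m : ℕ} (ξ : rootsOfUnity m ℂ) : rootVal ξ ≠ 0 := Units.ne_zero _

theorem isPrimitiveRoot_rootVal {ζ : rootsOfUnity m ℂ} (hζ : IsPrimitiveRoot ζ m) :
    IsPrimitiveRoot (rootVal ζ) m := by
  have h1 : IsPrimitiveRoot (ζ : ℂˣ) m := by
    rw [IsPrimitiveRoot.coe_submonoidClass_iff]; exact hζ
  exact (IsPrimitiveRoot.coe_units_iff).2 h1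

/-- Orthogonality of the characters of `ℤ/m`. -/
theorem sum_zpow_primitiveRoot {z : ℂ} (hz : IsPrimitiveRoot z m) (e : ℤ) :
    ∑ r : Fin m, z ^ (((r : ℕ) : ℤ) * e) = if (m : ℤ) ∣ e then (m : ℂ) else 0 := by
  have hz0 : z ≠ 0 := hz.ne_zero (NeZero.ne m)
  have h1 : ∀ r : Fin m, z ^ (((r : ℕ) : ℤ) * e) = (z ^ e) ^ (r : ℕ) := fun r => by
    rw [mul_comm, zpow_mul, zpow_natCast]
  simp_rw [h1]
  rw [Fin.sum_univ_eq_sum_range (fun r => (z ^ e) ^ r) m]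
  split_ifs with h
  · rw [(hz.zpow_eq_one_iff_dvd e).2 h]; simp
  · have hne : z ^ e ≠ 1 := fun h' => h ((hz.zpow_eq_one_iff_dvd e).1 h')
    have h2 : (z ^ e) ^ m = 1 := by
      rw [← zpow_natCast, ← zpow_mul, mul_comm, zpow_mul, zpow_natCast, hz.pow_eq_one, one_zpow]
    have := geom_sum_eq hne m
    rw [this, h2]; simp

theorem fin_dvd_sub_iff (a b : Fin m) :
    (m : ℤ) ∣ ((a : ℕ) : ℤ) - ((b : ℕ) : ℤ) ↔ a = b := by
  constructor
  · intro h
    have ha := a.2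
    have hb := b.2
    have := Int.eq_zero_of_abs_lt_dvd h (by rw [abs_lt]; constructor <;> omega)
    exact Fin.ext (by omega)
  · rintro rfl; simp

theorem fin_dvd_neg_add (a : Fin m) : (m : ℤ) ∣ (((-a : Fin m) : ℕ) : ℤ) + ((a : ℕ) : ℤ) := by
  have h : ((-a + a : Fin m) : ℕ) = 0 := by simp
  rw [Fin.val_add] at h
  exact_mod_cast Nat.dvd_of_mod_eq_zero h

theorem zpow_eq_of_dvd {z : ℂ} (hz : z ^ m = 1) {e f : ℤ} (h : (m : ℤ) ∣ e - f) :
    z ^ e = z ^ f := by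
  have hz0 : z ≠ 0 := by
    rintro rfl; rw [zero_pow (NeZero.ne m)] at hz; exact zero_ne_one hz
  obtain ⟨k, hk⟩ := h
  rw [show e = f + m * k by omega, zpow_add₀ hz0, zpow_mul, zpow_natCast, hz, one_zpow, mul_one]

theorem sum_lamOf {ζ : rootsOfUnity m ℂ} (hζ : IsPrimitiveRoot ζ m) (c₀₀ : ℂ) (c : Fin m → ℂ) :
    absLam (lamOf ζ c₀₀ c) = -(m : ℂ) * c₀₀ := by
  have hz := isPrimitiveRoot_rootVal hζ
  simp only [absLam, lamOf, Finset.sum_add_distrib]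
  rw [Finset.sum_comm]
  have : ∑ l ∈ Finset.univ.filter (fun l : Fin m => l ≠ 0), ∑ i : Fin m,
      c l * (rootVal ζ)⁻¹ ^ ((i : ℕ) * (l : ℕ)) = 0 := by
    refine Finset.sum_eq_zero fun l hl => ?_
    rw [← Finset.mul_sum]
    have h1 : ∀ i : Fin m, (rootVal ζ)⁻¹ ^ ((i : ℕ) * (l : ℕ))
        = rootVal ζ ^ (((i : ℕ) : ℤ) * (-((l : ℕ) : ℤ))) := fun i => by
      rw [mul_neg, zpow_neg, inv_pow]
      norm_cast
    simp_rw [h1]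
    rw [sum_zpow_primitiveRoot hz, if_neg, mul_zero]
    intro h
    rw [dvd_neg] at h
    have hl0 : l ≠ 0 := by simpa using hl
    apply hl0
    rw [← fin_dvd_sub_iff]
    simpa using h
  rw [this]
  simp

theorem idem_char {ζ : rootsOfUnity m ℂ} (hζ : IsPrimitiveRoot ζ m) (k l : Fin m)
    (χ : MonoidAlgebra ℂ (rootsOfUnity m ℂ) →ₐ[ℂ] ℂ)
    (hχ : ∀ ξ a, χ (MonoidAlgebra.single ξ a) = a * rootVal ξ ^ (l : ℕ)) :
    χ (idem ζ k) = if k = l then 1 else 0 := by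
  have hz := isPrimitiveRoot_rootVal hζ
  have hm : (m : ℂ) ≠ 0 := Nat.cast_ne_zero.2 (NeZero.ne m)
  simp only [idem, map_sum, hχ]
  have h1 : ∀ r : Fin m, (m : ℂ)⁻¹ * (rootVal ζ)⁻¹ ^ ((k : ℕ) * (r : ℕ))
        * rootVal (ζ ^ (r : ℕ)) ^ (l : ℕ)
      = (m : ℂ)⁻¹ * rootVal ζ ^ (((r : ℕ) : ℤ) * (((l : ℕ) : ℤ) - ((k : ℕ) : ℤ))) := fun r => by
    have : rootVal (ζ ^ (r : ℕ)) = rootVal ζ ^ (r : ℕ) := by simp [rootVal]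
    rw [this, mul_assoc, ← pow_mul, inv_pow, ← zpow_natCast, ← zpow_natCast, ← zpow_neg,
      ← zpow_add₀ (rootVal_ne_zero ζ)]
    congr 2
    push_cast
    ring
  simp_rw [h1]
  rw [← Finset.mul_sum, sum_zpow_primitiveRoot hz]
  simp only [fin_dvd_sub_iff]
  by_cases h : k = l
  · simp [h, hm]
  · have h' : ¬ l = k := fun e => h e.symm
    simp [h, h']

/-- The defining relation of the `κ_l`, evaluated at the character `s ↦ ζ^l`. -/
theorem kappa_step {ζ : rootsOfUnity m ℂ} (hζ : IsPrimitiveRoot ζ m) {c₀₀ : ℂ} {c κ : Fin m → ℂ}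
    (hκ : IsKappa ζ c₀₀ c κ) (l : Fin m) (hl : l ≠ 0) :
    (m : ℂ) * (κ l - κ (l - 1)) = lamOf ζ c₀₀ c (-l) := by
  let χ : MonoidAlgebra ℂ (rootsOfUnity m ℂ) →ₐ[ℂ] ℂ := MonoidAlgebra.lift ℂ ℂ _
    { toFun := fun ξ => rootVal ξ ^ (l : ℕ)
      map_one' := by simp [rootVal]
      map_mul' := by intro x y; simp [rootVal, mul_pow] }
  have hχ : ∀ ξ a, χ (MonoidAlgebra.single ξ a) = a * rootVal ξ ^ (l : ℕ) := by
    intro ξ a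
    simp [χ, MonoidAlgebra.lift_single]
  have h := congrArg χ hκ.1
  simp only [map_sum, map_smul, hχ, idem_char hζ _ l χ hχ, smul_eq_mul, mul_ite, mul_one, mul_zero,
    Finset.sum_ite_eq', Finset.mem_univ, if_true] at h
  rw [← h, lamOf, if_neg (by simpa using hl), zero_add]
  refine Finset.sum_congr rfl fun r _ => ?_
  have h2 : rootVal (ζ ^ (r : ℕ)) = rootVal ζ ^ (r : ℕ) := by simp [rootVal]
  rw [h2, ← pow_mul, inv_pow, ← zpow_natCast, ← zpow_natCast, ← zpow_neg]
  congr 1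
  apply zpow_eq_of_dvd (rootVal_pow ζ)
  have := fin_dvd_neg_add l
  obtain ⟨k, hk⟩ := this
  refine ⟨k * r, ?_⟩
  push_cast
  rw [← mul_assoc, ← hk]
  ring

/-- The diagonal entries of the Lax matrix in terms of the `κ_l`. -/
theorem kappa_eq {ζ : rootsOfUnity m ℂ} (hζ : IsPrimitiveRoot ζ m) {c₀₀ : ℂ} {c κ : Fin m → ℂ}
    (hκ : IsKappa ζ c₀₀ c κ) (i : Fin m) :
    -((m : ℂ) * κ (-1 - i))
      = -(∑ r : Fin m, ((m : ℂ) - ((r : ℕ) : ℂ)) / (m : ℂ) * lamOf ζ c₀₀ c r)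
          + ∑ r ∈ Finset.Iic i, lamOf ζ c₀₀ c r := by
  have hm : (m : ℂ) ≠ 0 := Nat.cast_ne_zero.2 (NeZero.ne m)
  have key : ∀ t : ℕ, ∀ ht : t < m, -((m : ℂ) * κ (-1 - ⟨t, ht⟩))
      = -(∑ r : Fin m, ((m : ℂ) - ((r : ℕ) : ℂ)) / (m : ℂ) * lamOf ζ c₀₀ c r)
          + ∑ r ∈ Finset.Iic (⟨t, ht⟩ : Fin m), lamOf ζ c₀₀ c r := by
    intro t
    induction t with
    | zero =>
      intro ht
      have h0 : (⟨0, ht⟩ : Fin m) = 0 := rfl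
      have h1 : Finset.Iic (0 : Fin m) = {0} := by
        ext r; simp
      rw [h0, sub_zero, hκ.2, h1, Finset.sum_singleton,
        ← Finset.sum_filter_add_sum_filter_not Finset.univ (fun r : Fin m => r ≠ 0)
          (fun r : Fin m => ((m : ℂ) - ((r : ℕ) : ℂ)) / (m : ℂ) * lamOf ζ c₀₀ c r)]
      have h2 : Finset.univ.filter (fun r : Fin m => ¬ r ≠ 0) = {0} := by
        ext r; simp
      rw [h2, Finset.sum_singleton, Finset.mul_sum]
      have h3 : ∀ r : Fin m, (m : ℂ) * (((m : ℂ) - ((r : ℕ) : ℂ)) / (m : ℂ) ^ 2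
          * lamOf ζ c₀₀ c r) = ((m : ℂ) - ((r : ℕ) : ℂ)) / (m : ℂ) * lamOf ζ c₀₀ c r := by
        intro r; field_simp
      simp_rw [h3]
      simp [hm]
    | succ t ih =>
      intro ht
      have ih' := ih (by omega)
      set s : Fin m := ⟨t, by omega⟩ with hs
      have e1 : (⟨t + 1, ht⟩ : Fin m) = s + 1 := by
        apply Fin.ext
        rw [Fin.val_add, Fin.val_one', hs]
        simp [Nat.mod_eq_of_lt ht]
      have hne : -1 - s ≠ 0 := by
        intro h
        have : s + 1 = 0 := by
          have h' : -(s + 1) = 0 := by rw [← h]; abel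
          exact neg_eq_zero.1 h'
        rw [← e1] at this
        have := congrArg Fin.val this
        simp at this
      have hk := kappa_step hζ hκ (-1 - s) hne
      have e2 : -1 - s - 1 = -1 - (s + 1) := by abel
      have e3 : -(-1 - s) = s + 1 := by abel
      rw [e2, e3] at hk
      have e4 : Finset.Iic (s + 1) = insert (s + 1) (Finset.Iic s) := by
        ext r
        rw [← e1]
        simp only [Finset.mem_Iic, Finset.mem_insert, Fin.le_def, Fin.ext_iff, hs]
        omega
      have e5 : s + 1 ∉ Finset.Iic s := by
        rw [← e1]
        simp only [Finset.mem_Iic, Fin.le_def, hs]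
        omega
      rw [e1, e4, Finset.sum_insert e5]
      linear_combination ih' + hk
  exact key i i.2

/-! ### The action of the crossed product on functions -/

theorem smul_fst (g : WreathG m n) (z : Phase n) (i : Fin n) :
    (g • z).1 i = rootVal (g.left i) * z.1 (g.right⁻¹ i) := rfl

theorem smul_snd (g : WreathG m n) (z : Phase n) (i : Fin n) :
    (g • z).2 i = (rootVal (g.left i))⁻¹ * z.2 (g.right⁻¹ i) := rfl

theorem smul_fun_apply (g : WreathG m n) (F : Phase n → ℂ) (z : Phase n) :
    (g • F) z = F (g⁻¹ • z) := rfl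

theorem smul_mem_regDomain (g : WreathG m n) {z : Phase n} (hz : z ∈ regDomain m n) :
    g • z ∈ regDomain m n := by
  refine ⟨fun i => mul_ne_zero (rootVal_ne_zero _) (hz.1 _), fun i j hij => ?_⟩
  rw [smul_fst, smul_fst, mul_pow, mul_pow, rootVal_pow, rootVal_pow, one_mul, one_mul]
  exact hz.2 _ _ fun h => hij (g.right⁻¹.injective h)

/-- The action of the crossed product on functions, `(∑ B_g g) f = ∑ B_g g(f)`, as an additive
map in the first argument. -/
def crossedAct (f : Phase n → ℂ) : Crossed m n →+ (Phase n → ℂ) where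
  toFun A := ∑ g : WreathG m n, A.coeff g * g • f
  map_zero' := by simp
  map_add' A B := by
    simp [add_mul, Finset.sum_add_distrib]

theorem crossedAct_single (f : Phase n → ℂ) (g : WreathG m n) (B : Phase n → ℂ) :
    crossedAct f (SkewMonoidAlgebra.single g B) = B * g • f := by
  classical
  change ∑ h : WreathG m n, (SkewMonoidAlgebra.single g B).coeff h * h • f = _
  rw [Finset.sum_eq_single g]
  · rw [SkewMonoidAlgebra.coeff_single, Finsupp.single_eq_same]
  · intro h _ hne
    rw [SkewMonoidAlgebra.coeff_single, Finsupp.single_eq_of_ne hne, zero_mul]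
  · simp

theorem crossedAct_add_right (f f' : Phase n → ℂ) (A : Crossed m n) :
    crossedAct (f + f') A = crossedAct f A + crossedAct f' A := by
  change ∑ h : WreathG m n, A.coeff h * h • (f + f') = _
  simp only [smul_add, mul_add, Finset.sum_add_distrib]
  rfl

theorem crossedAct_mul (f : Phase n → ℂ) (A B : Crossed m n) :
    crossedAct f (A * B) = crossedAct (crossedAct f B) A := by
  induction A using SkewMonoidAlgebra.induction_on with
  | zero => simp
  | add A A' hA hA' => rw [add_mul, map_add, map_add, hA, hA']
  | single g a =>
    induction B using SkewMonoidAlgebra.induction_on with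
    | zero =>
      rw [mul_zero, map_zero, crossedAct_single, smul_zero, mul_zero]
    | add B B' hB hB' => rw [mul_add, map_add, map_add, hB, hB', crossedAct_add_right]
    | single h b =>
      rw [SkewMonoidAlgebra.single_mul_single, crossedAct_single, crossedAct_single,
        crossedAct_single, smul_mul', mul_smul, mul_assoc]

theorem forgetGroup_eq (A : Crossed m n) : forgetGroup A = crossedAct 1 A := by
  change _ = ∑ g : WreathG m n, A.coeff g * g • (1 : Phase n → ℂ)
  simp [forgetGroup, smul_one]

theorem crossedAct_symIdem (f : Phase n → ℂ) (z : Phase n) :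
    crossedAct f (symIdem m n) z
      = (Fintype.card (WreathG m n) : ℂ)⁻¹ * ∑ g : WreathG m n, f (g⁻¹ • z) := by
  rw [symIdem, map_sum, Finset.sum_apply, Finset.mul_sum]
  refine Finset.sum_congr rfl fun g _ => ?_
  rw [crossedAct_single]; rfl

theorem crossedAct_one_symIdem : crossedAct 1 (symIdem m n) = 1 := by
  funext z
  rw [crossedAct_symIdem]
  have : (Fintype.card (WreathG m n) : ℂ) ≠ 0 := Nat.cast_ne_zero.2 Fintype.card_ne_zero
  simp [this]

theorem calogeroHam_apply (ζ : rootsOfUnity m ℂ) (c₀₀ : ℂ) (κ : Fin m → ℂ) (j : ℕ) (z : Phase n) :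
    calogeroHam n ζ c₀₀ κ j z = (Fintype.card (WreathG m n) : ℂ)⁻¹ *
      ∑ g : WreathG m n, ∑ i, crossedAct 1 (dunkl ζ c₀₀ κ i ^ (j * m)) (g⁻¹ • z) := by
  rw [calogeroHam, forgetGroup_eq, crossedAct_mul, crossedAct_one_symIdem, crossedAct_mul,
    crossedAct_symIdem, map_sum]
  simp only [Finset.sum_apply]

/-! ### Dunkl operators and the Lax matrix -/

/-- Equivariance of the Lax matrix under `ℤ_m ≀ S_n`. -/
theorem laxBlock_smul (lam : Fin m → ℂ) (g : WreathG m n) (z : Phase n) (i : Fin m)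
    (j k : Fin n) :
    laxBlock lam (g • z) i j k = rootVal (g.left j) ^ (i : ℕ)
      * laxBlock lam z i (g.right⁻¹ j) (g.right⁻¹ k) * (rootVal (g.left k))⁻¹ ^ ((i : ℕ) + 1) := by
  have ha : ∀ j, rootVal (g.left j) ≠ 0 := fun j => rootVal_ne_zero _
  have ham : ∀ j, rootVal (g.left j) ^ m = 1 := fun j => rootVal_pow _
  simp only [laxBlock, Matrix.of_apply, smul_fst, smul_snd]
  by_cases h : j = k
  · subst h
    simp only [if_true]
    rw [mul_inv, pow_succ, inv_pow]
    field_simp [ha j]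
  · have h' : ¬ g.right⁻¹ j = g.right⁻¹ k := fun e => h (g.right⁻¹.injective e)
    rw [if_neg h, if_neg h']
    simp only [mul_pow, ham, one_mul]
    have e1 : rootVal (g.left k) ^ (m - 1 - (i : ℕ)) = (rootVal (g.left k))⁻¹ ^ ((i : ℕ) + 1) := by
      have := i.2
      rw [inv_pow]
      refine eq_inv_of_mul_eq_one_left ?_
      rw [← pow_add, show m - 1 - (i : ℕ) + ((i : ℕ) + 1) = m by omega, ham]
    rw [e1]
    ring

/-- The vectors `Y_{-k} ⋯ Y_{-2} Y_{-1} (1, …, 1)`. -/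
def laxVec (lam : Fin m → ℂ) (z : Phase n) : ℕ → Fin n → ℂ
  | 0 => fun _ => 1
  | k + 1 => (laxBlock lam z (-((k + 1) • (1 : Fin m)))).mulVec (laxVec lam z k)

theorem val_neg_succ (k : ℕ) :
    ((-((k + 1) • (1 : Fin m)) : Fin m) : ℕ) = m - 1 - k % m := by
  have hk : k % m < m := Nat.mod_lt _ (NeZero.pos m)
  have h : (⟨m - 1 - k % m, by omega⟩ : Fin m) = -((k + 1) • (1 : Fin m)) := by
    rw [eq_neg_iff_add_eq_zero]
    apply Fin.ext
    rw [Fin.val_add, val_nsmul_one]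
    simp only [Nat.add_mod_mod, Fin.val_zero]
    rw [Nat.add_mod, ← Nat.mod_mod k m, ← Nat.add_mod, Nat.mod_mod]
    have h2 : (m - 1 - k % m + (k % m + 1)) = m := by omega
    have h3 : (m - 1 - k % m + (k + 1)) % m = (m - 1 - k % m + (k % m + 1)) % m := by
      rw [← add_assoc, ← add_assoc]
      exact ((Nat.mod_modEq k m).symm.add_left _).add_right _
    rw [h3, h2, Nat.mod_self]
  rw [← h]

theorem laxVec_smul (lam : Fin m → ℂ) (g : WreathG m n) (z : Phase n) (k : ℕ) (j : Fin n) :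
    laxVec lam (g • z) k j = (rootVal (g.left j))⁻¹ ^ k * laxVec lam z k (g.right⁻¹ j) := by
  have ha : ∀ j, rootVal (g.left j) ≠ 0 := fun j => rootVal_ne_zero _
  have ham : ∀ j, rootVal (g.left j) ^ m = 1 := fun j => rootVal_pow _
  induction k generalizing j with
  | zero => simp [laxVec]
  | succ k ih =>
    have hk : k % m < m := Nat.mod_lt _ (NeZero.pos m)
    have hkk := Nat.mod_add_div k m
    simp only [laxVec, Matrix.mulVec, dotProduct]
    rw [Finset.mul_sum]
    refine Eq.trans (Finset.sum_congr rfl fun l _ => ?_) (Equiv.sum_comp g.right⁻¹ _)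
    rw [laxBlock_smul, ih, val_neg_succ]
    have e1 : rootVal (g.left j) ^ (m - 1 - k % m) = (rootVal (g.left j))⁻¹ ^ (k + 1) := by
      rw [inv_pow]
      refine eq_inv_of_mul_eq_one_left ?_
      rw [← pow_add, show m - 1 - k % m + (k + 1) = m * (k / m + 1) by rw [mul_add]; omega, pow_mul, ham,
        one_pow]
    have e2 : (rootVal (g.left l))⁻¹ ^ (m - 1 - k % m + 1) * (rootVal (g.left l))⁻¹ ^ k = 1 := by
      rw [← pow_add, show m - 1 - k % m + 1 + k = m * (k / m + 1) by rw [mul_add]; omega, pow_mul,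
        inv_pow, ham, inv_one, one_pow]
    rw [e1]
    linear_combination ((rootVal (g.left j))⁻¹ ^ (k + 1) *
      laxBlock lam z (-((k + 1) • 1)) (g.right⁻¹ j) (g.right⁻¹ l)
        * laxVec lam z k (g.right⁻¹ l)) * e2

/-- Partial fractions: `∑_r ζ^{-rk} / (x - ζ^r y) = m x^{m-1-k} y^k / (x^m - y^m)` for
`0 ≤ k < m`. -/
theorem sum_partial_fractions {ζ : ℂ} (hζ : IsPrimitiveRoot ζ m) {x y : ℂ} (h : x ^ m ≠ y ^ m)
    (k : ℕ) :
    ∑ r : Fin m, (x - ζ ^ (r : ℕ) * y)⁻¹ * ζ ^ (-(((r : ℕ) : ℤ) * (k : ℤ)))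
      = (m : ℂ) * (x ^ (m - 1 - k % m) * y ^ (k % m)) / (x ^ m - y ^ m) := by
  have hk : k % m < m := Nat.mod_lt _ (NeZero.pos m)
  have hz0 : ζ ≠ 0 := hζ.ne_zero (NeZero.ne m)
  have hxy : x ^ m - y ^ m ≠ 0 := sub_ne_zero.2 h
  have h1 : ∀ r : Fin m, (x - ζ ^ (r : ℕ) * y)⁻¹
      = (∑ s : Fin m, (ζ ^ (r : ℕ) * y) ^ (s : ℕ) * x ^ (m - 1 - (s : ℕ))) / (x ^ m - y ^ m) := by
    intro r
    have e : (ζ ^ (r : ℕ) * y) ^ m = y ^ m := by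
      rw [mul_pow, ← pow_mul, mul_comm (r : ℕ), pow_mul, hζ.pow_eq_one, one_pow, one_mul]
    have hne : x - ζ ^ (r : ℕ) * y ≠ 0 := by
      intro h0
      apply h
      rw [sub_eq_zero.1 h0, e]
    rw [Fin.sum_univ_eq_sum_range (fun s => (ζ ^ (r : ℕ) * y) ^ s * x ^ (m - 1 - s)) m,
      inv_eq_one_div, div_eq_div_iff hne hxy]
    have := geom_sum₂_mul (ζ ^ (r : ℕ) * y) x m
    rw [e] at this
    linear_combination this
  simp_rw [h1, div_mul_eq_mul_div]
  rw [← Finset.sum_div]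
  congr 1
  simp_rw [Finset.sum_mul]
  rw [Finset.sum_comm]
  have h2 : ∀ s r : Fin m, (ζ ^ (r : ℕ) * y) ^ (s : ℕ) * x ^ (m - 1 - (s : ℕ))
        * ζ ^ (-(((r : ℕ) : ℤ) * (k : ℤ)))
      = y ^ (s : ℕ) * x ^ (m - 1 - (s : ℕ)) * ζ ^ (((r : ℕ) : ℤ) * (((s : ℕ) : ℤ) - (k : ℤ))) := by
    intro s r
    rw [mul_pow, ← pow_mul, ← zpow_natCast ζ]
    rw [show ((r : ℕ) : ℤ) * (((s : ℕ) : ℤ) - (k : ℤ))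
      = (((r : ℕ) * (s : ℕ) : ℕ) : ℤ) + (-(((r : ℕ) : ℤ) * (k : ℤ))) by push_cast; ring,
      zpow_add₀ hz0]
    ring
  simp_rw [h2, ← Finset.mul_sum, sum_zpow_primitiveRoot hζ]
  have h3 : ∀ s : Fin m, (m : ℤ) ∣ ((s : ℕ) : ℤ) - (k : ℤ) ↔ s = ⟨k % m, hk⟩ := by
    intro s
    rw [← fin_dvd_sub_iff]
    have : ((k % m : ℕ) : ℤ) = (k : ℤ) - m * ((k / m : ℕ) : ℤ) := by
      have := Nat.mod_add_div k m
      rw [eq_sub_iff_add_eq]; exact_mod_cast this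
    simp only [this]
    rw [show ((s : ℕ) : ℤ) - ((k : ℤ) - m * ((k / m : ℕ) : ℤ))
      = (((s : ℕ) : ℤ) - (k : ℤ)) + m * ((k / m : ℕ) : ℤ) by ring]
    exact (Int.dvd_add_left (dvd_mul_right _ _)).symm
  simp only [h3, mul_ite, mul_zero, Finset.sum_ite_eq', Finset.mem_univ, if_true]
  ring

theorem sGen_pow_left (ζ : rootsOfUnity m ℂ) (i : Fin n) (r : ℕ) :
    (sGen (m := m) ζ i ^ r : WreathG m n) = SemidirectProduct.inl (Pi.mulSingle i (ζ ^ r)) := by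
  rw [sGen, ← map_pow, Pi.mulSingle_pow]

theorem dunkl_apply (ζ : rootsOfUnity m ℂ) (c₀₀ : ℂ) (κ : Fin m → ℂ) (i : Fin n)
    (f : Phase n → ℂ) (z : Phase n) :
    crossedAct f (dunkl ζ c₀₀ κ i) z = z.2 i * f z
      - ∑ j ∈ Finset.univ.filter (fun j : Fin n => j ≠ i), ∑ r : Fin m,
          c₀₀ * (z.1 i - rootVal ζ ^ (r : ℕ) * z.1 j)⁻¹
            * f ((sGen ζ i ^ (r : ℕ) * sSwap i j * (sGen ζ i ^ (r : ℕ))⁻¹)⁻¹ • z)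
      - ∑ l : Fin m, ∑ r : Fin m, (z.1 i)⁻¹ * ((m : ℂ) * κ l)
          * ((m : ℂ)⁻¹ * (rootVal ζ)⁻¹ ^ ((l : ℕ) * (r : ℕ))) * f ((sGen ζ i ^ (r : ℕ))⁻¹ • z) := by
  rw [dunkl, map_sub, map_sub, map_sum, map_sum, crossedAct_single]
  simp only [map_sum, crossedAct_single, idemAt, Finset.mul_sum,
    SkewMonoidAlgebra.single_mul_single, Pi.sub_apply, Pi.mul_apply, Finset.sum_apply,
    smul_fun_apply, one_smul, one_mul]

/-- The Dunkl operators, applied repeatedly to the function `1`, are products of the blocks of the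
Lax matrix. -/
theorem dunkl_pow_apply {ζ : rootsOfUnity m ℂ} (hζ : IsPrimitiveRoot ζ m) {c₀₀ : ℂ}
    {c κ : Fin m → ℂ} (hκ : IsKappa ζ c₀₀ c κ) (k : ℕ) (i : Fin n) {z : Phase n}
    (hz : z ∈ regDomain m n) :
    crossedAct 1 (dunkl ζ c₀₀ κ i ^ k) z = laxVec (lamOf ζ c₀₀ c) z k i := by
  have hm : (m : ℂ) ≠ 0 := Nat.cast_ne_zero.2 (NeZero.ne m)
  have hz1 := isPrimitiveRoot_rootVal hζ
  have hζ0 := rootVal_ne_zero ζ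
  induction k generalizing i z with
  | zero =>
    rw [pow_zero, SkewMonoidAlgebra.one_def, crossedAct_single, one_smul, mul_one]
    rfl
  | succ k ih =>
    have hk : k % m < m := Nat.mod_lt _ (NeZero.pos m)
    rw [pow_succ', crossedAct_mul, dunkl_apply, ih i hz]
    -- the values of the previous function at the translated points
    have hA : ∀ r : Fin m, crossedAct 1 (dunkl ζ c₀₀ κ i ^ k) ((sGen ζ i ^ (r : ℕ))⁻¹ • z)
        = rootVal ζ ^ (((r : ℕ) : ℤ) * (k : ℤ)) * laxVec (lamOf ζ c₀₀ c) z k i := by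
      intro r
      rw [ih i (smul_mem_regDomain _ hz), laxVec_smul, sGen_pow_left, ← map_inv]
      have e1 : rootVal ((SemidirectProduct.inl (Pi.mulSingle i (ζ ^ (r : ℕ)))⁻¹ : WreathG m n).left i) = (rootVal ζ ^ (r : ℕ))⁻¹ := by
        simp [rootVal]
      rw [e1, inv_inv, ← pow_mul]
      norm_cast
    have hB : ∀ j, j ≠ i → ∀ r : Fin m, crossedAct 1 (dunkl ζ c₀₀ κ i ^ k)
          ((sGen ζ i ^ (r : ℕ) * sSwap i j * (sGen ζ i ^ (r : ℕ))⁻¹)⁻¹ • z)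
        = rootVal ζ ^ (-(((r : ℕ) : ℤ) * (k : ℤ))) * laxVec (lamOf ζ c₀₀ c) z k j := by
      intro j hj r
      rw [ih i (smul_mem_regDomain _ hz), laxVec_smul, sGen_pow_left, ← map_inv]
      have e0 : (SemidirectProduct.inl (Pi.mulSingle i (ζ ^ (r : ℕ))) * sSwap i j
          * SemidirectProduct.inl (Pi.mulSingle i (ζ ^ (r : ℕ)))⁻¹ : WreathG m n)⁻¹
          = SemidirectProduct.inl (Pi.mulSingle i (ζ ^ (r : ℕ))) * sSwap i j
            * SemidirectProduct.inl (Pi.mulSingle i (ζ ^ (r : ℕ)))⁻¹ := by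
        have : (sSwap i j : WreathG m n)⁻¹ = sSwap i j := by
          rw [sSwap, ← map_inv, Equiv.swap_inv]
        rw [mul_inv_rev, mul_inv_rev, this, map_inv, inv_inv, mul_assoc]
      have e1 : rootVal ((SemidirectProduct.inl (Pi.mulSingle i (ζ ^ (r : ℕ))) * sSwap i j
            * SemidirectProduct.inl (Pi.mulSingle i (ζ ^ (r : ℕ)))⁻¹ : WreathG m n).left i)
          = rootVal ζ ^ (r : ℕ) := by
        have e3 : ((SemidirectProduct.inl (Pi.mulSingle i (ζ ^ (r : ℕ))) * sSwap i j
            * SemidirectProduct.inl (Pi.mulSingle i (ζ ^ (r : ℕ)))⁻¹ : WreathG m n).left i)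
            = Pi.mulSingle (M := fun _ : Fin n => rootsOfUnity m ℂ) i (ζ ^ (r : ℕ)) i * 1
              * (Pi.mulSingle (M := fun _ : Fin n => rootsOfUnity m ℂ) i (ζ ^ (r : ℕ)))⁻¹
                ((1 * Equiv.swap i j : Equiv.Perm (Fin n))⁻¹ i) := rfl
        rw [e3]
        simp [rootVal, hj]
      have e2 : (SemidirectProduct.inl (Pi.mulSingle i (ζ ^ (r : ℕ))) * sSwap i j
            * SemidirectProduct.inl (Pi.mulSingle i (ζ ^ (r : ℕ)))⁻¹ : WreathG m n).right⁻¹ i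
          = j := by
        simp [sSwap]
      rw [e0, e1, e2, inv_pow, ← pow_mul, zpow_neg]
      norm_cast
    have hC : ∑ j ∈ Finset.univ.filter (fun j : Fin n => j ≠ i), ∑ r : Fin m,
          c₀₀ * (z.1 i - rootVal ζ ^ (r : ℕ) * z.1 j)⁻¹
            * crossedAct 1 (dunkl ζ c₀₀ κ i ^ k)
              ((sGen ζ i ^ (r : ℕ) * sSwap i j * (sGen ζ i ^ (r : ℕ))⁻¹)⁻¹ • z)
        = ∑ j ∈ Finset.univ.filter (fun j : Fin n => j ≠ i),
            c₀₀ * ((m : ℂ) * (z.1 i ^ (m - 1 - k % m) * z.1 j ^ (k % m))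
              / (z.1 i ^ m - z.1 j ^ m)) * laxVec (lamOf ζ c₀₀ c) z k j := by
      refine Finset.sum_congr rfl fun j hj => ?_
      have hj' : j ≠ i := (Finset.mem_filter.1 hj).2
      rw [← sum_partial_fractions hz1 (hz.2 i j hj'.symm) k, Finset.mul_sum, Finset.sum_mul]
      refine Finset.sum_congr rfl fun r _ => ?_
      rw [hB j hj']
      ring
    have hD : ∑ l : Fin m, ∑ r : Fin m, (z.1 i)⁻¹ * ((m : ℂ) * κ l)
          * ((m : ℂ)⁻¹ * (rootVal ζ)⁻¹ ^ ((l : ℕ) * (r : ℕ)))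
          * crossedAct 1 (dunkl ζ c₀₀ κ i ^ k) ((sGen ζ i ^ (r : ℕ))⁻¹ • z)
        = (z.1 i)⁻¹ * ((m : ℂ) * κ (k • 1)) * laxVec (lamOf ζ c₀₀ c) z k i := by
      have h1 : ∀ l r : Fin m, (z.1 i)⁻¹ * ((m : ℂ) * κ l)
          * ((m : ℂ)⁻¹ * (rootVal ζ)⁻¹ ^ ((l : ℕ) * (r : ℕ)))
          * crossedAct 1 (dunkl ζ c₀₀ κ i ^ k) ((sGen ζ i ^ (r : ℕ))⁻¹ • z)
          = ((z.1 i)⁻¹ * κ l * laxVec (lamOf ζ c₀₀ c) z k i)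
            * rootVal ζ ^ (((r : ℕ) : ℤ) * ((k : ℤ) - ((l : ℕ) : ℤ))) := by
        intro l r
        rw [hA, inv_pow, ← zpow_natCast, ← zpow_neg,
          show ((r : ℕ) : ℤ) * ((k : ℤ) - ((l : ℕ) : ℤ))
            = -(((l : ℕ) * (r : ℕ) : ℕ) : ℤ) + ((r : ℕ) : ℤ) * (k : ℤ) by push_cast; ring,
          zpow_add₀ hζ0]
        field_simp
      simp_rw [h1, ← Finset.mul_sum, sum_zpow_primitiveRoot hz1]
      have h3 : ∀ l : Fin m, (m : ℤ) ∣ (k : ℤ) - ((l : ℕ) : ℤ) ↔ l = k • 1 := by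
        intro l
        rw [eq_comm, ← fin_dvd_sub_iff, val_nsmul_one]
        have : ((k % m : ℕ) : ℤ) = (k : ℤ) - m * ((k / m : ℕ) : ℤ) := by
          have := Nat.mod_add_div k m
          rw [eq_sub_iff_add_eq]; exact_mod_cast this
        rw [this, show (k : ℤ) - m * ((k / m : ℕ) : ℤ) - ((l : ℕ) : ℤ)
          = ((k : ℤ) - ((l : ℕ) : ℤ)) + m * (-((k / m : ℕ) : ℤ)) by ring]
        exact (Int.dvd_add_left (dvd_mul_right _ _)).symm
      simp only [h3, mul_ite, mul_zero, Finset.sum_ite_eq', Finset.mem_univ, if_true]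
      ring
    rw [hC, hD]
    simp only [laxVec, Matrix.mulVec, dotProduct]
    rw [← Finset.add_sum_erase Finset.univ _ (Finset.mem_univ i)]
    have hkap := kappa_eq hζ hκ (-((k + 1) • (1 : Fin m)))
    rw [show (-1 - -((k + 1) • (1 : Fin m))) = k • 1 by rw [succ_nsmul]; abel] at hkap
    have hdiag : laxBlock (lamOf ζ c₀₀ c) z (-((k + 1) • 1)) i i
        = z.2 i + (z.1 i)⁻¹ * (-((m : ℂ) * κ (k • 1))) := by
      rw [hkap]; simp [laxBlock]
    have hoff : ∑ j ∈ Finset.univ.erase i,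
          laxBlock (lamOf ζ c₀₀ c) z (-((k + 1) • 1)) i j * laxVec (lamOf ζ c₀₀ c) z k j
        = -∑ j ∈ Finset.univ.filter (fun j : Fin n => j ≠ i),
            c₀₀ * ((m : ℂ) * (z.1 i ^ (m - 1 - k % m) * z.1 j ^ (k % m))
              / (z.1 i ^ m - z.1 j ^ m)) * laxVec (lamOf ζ c₀₀ c) z k j := by
      rw [← Finset.sum_neg_distrib]
      refine Finset.sum_congr (by ext; simp) fun j hj => ?_
      have hj' : j ≠ i := by simpa using hj
      simp only [laxBlock, Matrix.of_apply, if_neg hj'.symm, val_neg_succ, sum_lamOf hζ]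
      rw [show m - 1 - (m - 1 - k % m) = k % m by omega]
      ring
    rw [hdiag, hoff]
    ring

/-- The Hamiltonians as matrix elements of products of the blocks of the Lax matrix. -/
theorem calogeroHam_eq_sum_laxVec {ζ : rootsOfUnity m ℂ} (hζ : IsPrimitiveRoot ζ m) {c₀₀ : ℂ}
    {c κ : Fin m → ℂ} (hκ : IsKappa ζ c₀₀ c κ) (j : ℕ) {z : Phase n} (hz : z ∈ regDomain m n) :
    calogeroHam n ζ c₀₀ κ j z = ∑ i, laxVec (lamOf ζ c₀₀ c) z (j * m) i := by
  rw [calogeroHam_apply]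
  have h1 : ∀ g : WreathG m n, ∑ i, crossedAct 1 (dunkl ζ c₀₀ κ i ^ (j * m)) (g⁻¹ • z)
      = ∑ i, laxVec (lamOf ζ c₀₀ c) z (j * m) i := by
    intro g
    refine Eq.trans (Finset.sum_congr rfl fun i _ => ?_)
      (Equiv.sum_comp ((g⁻¹).right⁻¹ : Equiv.Perm (Fin n)) _)
    rw [dunkl_pow_apply hζ hκ _ _ (smul_mem_regDomain _ hz), laxVec_smul, mul_comm j m, pow_mul,
      inv_pow, rootVal_pow, inv_one, one_pow, one_mul]
  have : (Fintype.card (WreathG m n) : ℂ) ≠ 0 := Nat.cast_ne_zero.2 Fintype.card_ne_zero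
  simp [h1, this]

/-! ### Differentiation of matrix-valued functions -/

section MatrixCalculus

variable {ι : Type*} [Fintype ι] [DecidableEq ι]

theorem differentiableAt_matrix_mul {E : Type*} [NormedAddCommGroup E] [NormedSpace ℂ E]
    {f g : E → Matrix ι ι ℂ} {x : E} (hf : DifferentiableAt ℂ f x) (hg : DifferentiableAt ℂ g x) :
    DifferentiableAt ℂ (fun y => f y * g y) x := by
  have h := ((LinearMap.mul ℂ
    (Matrix ι ι ℂ)).toContinuousBilinearMap.isBoundedBilinearMap.differentiableAt
    (f x, g x)).comp x (hf.prodMk hg)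
  exact h

theorem differentiableAt_matrix_pow {E : Type*} [NormedAddCommGroup E] [NormedSpace ℂ E]
    {f : E → Matrix ι ι ℂ} {x : E} (hf : DifferentiableAt ℂ f x) (k : ℕ) :
    DifferentiableAt ℂ (fun y => f y ^ k) x := by
  induction k with
  | zero => simp only [pow_zero]; exact differentiableAt_const _
  | succ k ih =>
    simp only [pow_succ]
    exact differentiableAt_matrix_mul ih hf

theorem hasDerivAt_linear {E F : Type*} [NormedAddCommGroup E] [NormedSpace ℂ E]
    [FiniteDimensional ℂ E] [NormedAddCommGroup F] [NormedSpace ℂ F] (l : E →ₗ[ℂ] F)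
    {f : ℂ → E} {f' : E} {t : ℂ} (hf : HasDerivAt f f' t) :
    HasDerivAt (fun s => l (f s)) (l f') t :=
  (LinearMap.toContinuousLinearMap l).hasFDerivAt.comp_hasDerivAt t hf

theorem differentiableAt_linear {D E F : Type*} [NormedAddCommGroup D] [NormedSpace ℂ D]
    [NormedAddCommGroup E] [NormedSpace ℂ E]
    [FiniteDimensional ℂ E] [NormedAddCommGroup F] [NormedSpace ℂ F] (l : E →ₗ[ℂ] F)
    {f : D → E} {t : D} (hf : DifferentiableAt ℂ f t) :
    DifferentiableAt ℂ (fun s => l (f s)) t :=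
  (LinearMap.toContinuousLinearMap l).differentiableAt.comp t hf

theorem hasDerivAt_matrix_mul {f g : ℂ → Matrix ι ι ℂ} {f' g' : Matrix ι ι ℂ} {t : ℂ}
    (hf : HasDerivAt f f' t) (hg : HasDerivAt g g' t) :
    HasDerivAt (fun s => f s * g s) (f t * g' + f' * g t) t := by
  have h := ((LinearMap.mul ℂ
    (Matrix ι ι ℂ)).toContinuousBilinearMap.isBoundedBilinearMap.hasFDerivAt
    (f t, g t)).comp_hasDerivAt t (hf.prodMk hg)
  exact h

theorem hasDerivAt_matrix_pow {f : ℂ → Matrix ι ι ℂ} {f' : Matrix ι ι ℂ} {t : ℂ}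
    (hf : HasDerivAt f f' t) (k : ℕ) :
    HasDerivAt (fun s => f s ^ k)
      (∑ i ∈ Finset.range k, f t ^ i * f' * f t ^ (k - 1 - i)) t := by
  induction k with
  | zero =>
    simp only [pow_zero, Finset.range_zero, Finset.sum_empty]
    exact hasDerivAt_const t (1 : Matrix ι ι ℂ)
  | succ k ih =>
    simp only [pow_succ]
    refine (hasDerivAt_matrix_mul ih hf).congr_deriv ?_
    rw [Finset.sum_range_succ, Finset.sum_mul, add_comm]
    congr 1
    · refine Finset.sum_congr rfl fun i hi => ?_
      have := Finset.mem_range.1 hi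
      rw [mul_assoc, ← pow_succ]
      congr 2
      omega
    · simp

theorem hasDerivAt_trace_pow {f : ℂ → Matrix ι ι ℂ} {f' : Matrix ι ι ℂ} {t : ℂ}
    (hf : HasDerivAt f f' t) (k : ℕ) :
    HasDerivAt (fun s => (f s ^ k).trace) ((k : ℂ) * (f t ^ (k - 1) * f').trace) t := by
  refine (hasDerivAt_linear (Matrix.traceLinearMap ι ℂ ℂ)
    (hasDerivAt_matrix_pow hf k)).congr_deriv ?_
  rw [map_sum]
  have : ∀ i ∈ Finset.range k, Matrix.traceLinearMap ι ℂ ℂ (f t ^ i * f' * f t ^ (k - 1 - i))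
      = (f t ^ (k - 1) * f').trace := by
    intro i hi
    have hi' := Finset.mem_range.1 hi
    rw [Matrix.traceLinearMap_apply, Matrix.trace_mul_comm, ← mul_assoc, ← pow_add]
    congr 3
    omega
  rw [Finset.sum_congr rfl this, Finset.sum_const, Finset.card_range, nsmul_eq_mul]

/-- The combinatorial form of Jacobi's formula for the derivative of a determinant. -/
theorem sum_perm_eq_trace_adjugate {R : Type*} [CommRing R] (M N : Matrix ι ι R) :
    ∑ σ : Equiv.Perm ι, ((Equiv.Perm.sign σ : ℤ) : R) *
        ∑ i, (∏ j ∈ Finset.univ.erase i, M (σ j) j) * N (σ i) i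
      = (M.adjugate * N).trace := by
  have h1 : ∀ i, (M.adjugate * N) i i = (M.updateCol i (fun k => N k i)).det := by
    intro i
    rw [← Matrix.cramer_apply, Matrix.cramer_eq_adjugate_mulVec]
    rfl
  simp only [Matrix.trace, Matrix.diag_apply, h1, Matrix.det_apply']
  rw [Finset.sum_comm]
  refine Finset.sum_congr rfl fun σ _ => ?_
  rw [Finset.mul_sum]
  refine Finset.sum_congr rfl fun i _ => ?_
  congr 1
  rw [← Finset.mul_prod_erase Finset.univ _ (Finset.mem_univ i), mul_comm]
  congr 1
  · simp
  · refine Finset.prod_congr rfl fun j hj => ?_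
    rw [Matrix.updateCol_ne (Finset.ne_of_mem_erase hj)]

theorem hasDerivAt_entry {κ κ' : Type*} [Fintype κ] [Fintype κ'] {f : ℂ → Matrix κ κ' ℂ}
    {f' : Matrix κ κ' ℂ} {t : ℂ} (hf : HasDerivAt f f' t) (a : κ) (b : κ') :
    HasDerivAt (fun s => f s a b) (f' a b) t :=
  hasDerivAt_linear (Matrix.entryLinearMap ℂ ℂ a b) hf

theorem hasDerivAt_det {f : ℂ → Matrix ι ι ℂ} {f' : Matrix ι ι ℂ} {t : ℂ}
    (hf : HasDerivAt f f' t) :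
    HasDerivAt (fun s => (f s).det) ((f t).adjugate * f').trace t := by
  rw [← sum_perm_eq_trace_adjugate]
  simp only [Matrix.det_apply']
  refine HasDerivAt.fun_sum fun σ _ => ?_
  refine HasDerivAt.const_mul _ ?_
  simpa [smul_eq_mul] using HasDerivAt.fun_finsetProd (u := Finset.univ)
    (f := fun i s => f s (σ i) i) (f' := fun i => f' (σ i) i)
    fun i _ => hasDerivAt_entry hf (σ i) i

/-- Isospectrality: the characteristic polynomial is stationary along `M' = [A, M]`. -/
theorem hasDerivAt_eval_charpoly {f : ℂ → Matrix ι ι ℂ} {A : Matrix ι ι ℂ} {t : ℂ}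
    (hf : HasDerivAt f (A * f t - f t * A) t) (x : ℂ) :
    HasDerivAt (fun s => (f s).charpoly.eval x) 0 t := by
  simp only [Matrix.eval_charpoly]
  have h1 : HasDerivAt (fun s => Matrix.scalar ι x - f s) (0 - (A * f t - f t * A)) t :=
    (hasDerivAt_const t (Matrix.scalar ι x)).sub hf
  refine (hasDerivAt_det h1).congr_deriv ?_
  set S := Matrix.scalar ι x - f t with hS
  have h2 : 0 - (A * f t - f t * A) = A * S - S * A := by
    rw [hS, mul_sub, sub_mul, (Matrix.scalar_commute x (fun r => mul_comm _ _) A).eq]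
    abel
  rw [h2, mul_sub, Matrix.trace_sub, ← mul_assoc, ← mul_assoc, Matrix.adjugate_mul,
    Matrix.trace_mul_comm (S.adjugate * A) S, ← mul_assoc, Matrix.mul_adjugate, sub_self]

theorem hasDerivAt_matrix_pow_commutator {f : ℂ → Matrix ι ι ℂ} {A : Matrix ι ι ℂ} {t : ℂ}
    (hf : HasDerivAt f (A * f t - f t * A) t) (k : ℕ) :
    HasDerivAt (fun s => f s ^ k) (A * f t ^ k - f t ^ k * A) t := by
  induction k with
  | zero =>
    simp only [pow_zero, mul_one, one_mul, sub_self]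
    exact hasDerivAt_const t (1 : Matrix ι ι ℂ)
  | succ k ih =>
    simp only [pow_succ]
    refine (hasDerivAt_matrix_mul ih hf).congr_deriv ?_
    noncomm_ring

theorem hasDerivAt_trace_mul_pow {f g : ℂ → Matrix ι ι ℂ} {A : Matrix ι ι ℂ} {t : ℂ}
    (hf : HasDerivAt f (A * f t - f t * A) t) (hg : HasDerivAt g (A * g t - g t * A) t) (k : ℕ) :
    HasDerivAt (fun s => (g s * f s ^ k).trace) 0 t := by
  refine (hasDerivAt_linear (Matrix.traceLinearMap ι ℂ ℂ)
    (hasDerivAt_matrix_mul hg (hasDerivAt_matrix_pow_commutator hf k))).congr_deriv ?_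
  rw [Matrix.traceLinearMap_apply]
  have : g t * (A * f t ^ k - f t ^ k * A) + (A * g t - g t * A) * f t ^ k
      = A * (g t * f t ^ k) - g t * f t ^ k * A := by noncomm_ring
  rw [this, Matrix.trace_sub, Matrix.trace_mul_comm, sub_self]

theorem hasStrictFDerivAt_quadratic {E F : Type*} [NormedAddCommGroup E] [NormedSpace ℂ E]
    [FiniteDimensional ℂ E] [NormedAddCommGroup F] [NormedSpace ℂ F]
    (B : E →ₗ[ℂ] E →ₗ[ℂ] F) (x : E) :
    HasStrictFDerivAt (fun y => B y y) (LinearMap.toContinuousLinearMap (B x + B.flip x)) x := by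
  have h := HasStrictFDerivAt.comp (g := fun p : E × E => B.toContinuousBilinearMap p.1 p.2)
    (f := fun y : E => (y, y)) x
    (B.toContinuousBilinearMap.isBoundedBilinearMap.hasStrictFDerivAt (x, x))
    ((hasStrictFDerivAt_id x).prodMk (hasStrictFDerivAt_id x))
  refine HasStrictFDerivAt.congr_fderiv (f := fun y => B y y) h ?_
  ext y
  simp [LinearMap.toContinuousBilinearMap]

end MatrixCalculus

/-! ### The slice and the traces of powers of the Lax matrix -/

theorem val_sub_one_of_ne {i : Fin m} (hi : i ≠ 0) : ((i - 1 : Fin m) : ℕ) + 1 = (i : ℕ) := by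
  have h0 : (i : ℕ) ≠ 0 := fun h => hi (Fin.ext (by simpa using h))
  have hlt := i.2
  have h : (⟨(i : ℕ) - 1, by omega⟩ : Fin m) = i - 1 := by
    rw [eq_sub_iff_add_eq]
    apply Fin.ext
    rw [Fin.val_add, Fin.val_one', Nat.add_mod_mod]
    simp only
    rw [Nat.sub_add_cancel (Nat.one_le_iff_ne_zero.2 h0), Nat.mod_eq_of_lt hlt]
  rw [← h]
  simp only
  omega

theorem val_neg_one : ((-1 : Fin m) : ℕ) = m - 1 := by
  have := val_neg_succ (m := m) 0
  simpa using this

theorem sum_Iic_of_ne {lam : Fin m → ℂ} {i : Fin m} (hi : i ≠ 0) :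
    ∑ r ∈ Finset.Iic i, lam r = lam i + ∑ r ∈ Finset.Iic (i - 1), lam r := by
  have h := val_sub_one_of_ne hi
  have e : Finset.Iic i = insert i (Finset.Iic (i - 1)) := by
    ext r
    simp only [Finset.mem_Iic, Finset.mem_insert, Fin.le_def, Fin.ext_iff]
    omega
  rw [e, Finset.sum_insert]
  simp only [Finset.mem_Iic, Fin.le_def]
  omega

theorem Iic_zero_fin : Finset.Iic (0 : Fin m) = {0} := by ext r; simp

theorem Iic_neg_one_fin : Finset.Iic (-1 : Fin m) = Finset.univ := by
  ext r
  simp only [Finset.mem_Iic, Fin.le_def, val_neg_one, Finset.mem_univ, iff_true]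
  have := r.2
  omega

/-- The constant term `-∑_r (m - r) λ_r / m + ∑_{r ≤ i} λ_r` of the diagonal entries of `Y_i`. -/
def diagShift (lam : Fin m → ℂ) (i : Fin m) : ℂ :=
  -(∑ r : Fin m, ((m : ℂ) - ((r : ℕ) : ℂ)) / (m : ℂ) * lam r) + ∑ r ∈ Finset.Iic i, lam r

theorem laxBlock_diag (lam : Fin m → ℂ) (z : Phase n) (i : Fin m) (j : Fin n) :
    laxBlock lam z i j j = z.2 j + (z.1 j)⁻¹ * diagShift lam i := by
  simp [laxBlock, diagShift]

theorem laxBlock_offdiag (lam : Fin m → ℂ) (z : Phase n) (i : Fin m) {j k : Fin n} (h : j ≠ k) :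
    laxBlock lam z i j k = absLam lam * (z.1 j ^ (i : ℕ) * z.1 k ^ (m - 1 - (i : ℕ)))
      / (z.1 j ^ m - z.1 k ^ m) := by
  simp [laxBlock, h]

theorem diagShift_sub {lam : Fin m → ℂ} (i : Fin m) :
    diagShift lam i - diagShift lam (i - 1) = lam i - if i = 0 then absLam lam else 0 := by
  simp only [diagShift]
  by_cases h : i = 0
  · subst h
    rw [zero_sub, Iic_zero_fin, Iic_neg_one_fin, Finset.sum_singleton, if_pos rfl, absLam]
    ring
  · rw [sum_Iic_of_ne h, if_neg h]; ring

/-- The slice lies in the fibre of the moment map. -/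
theorem momentMap_slice (lam : Fin m → ℂ) {z : Phase n} (hz : z ∈ regDomain m n) (i : Fin m) :
    momentMap (slice lam z) i = lam i • (1 : Matrix (Fin n) (Fin n) ℂ) := by
  have hvw : ∀ j k, (if i = 0 then Matrix.vecMulVec (rv (slice (m := m) lam z)) (rw (slice lam z))
      else 0 : Matrix (Fin n) (Fin n) ℂ) j k = -(if i = 0 then absLam lam else 0) := by
    intro j k
    split_ifs
    · simp [slice, rv, rw, Matrix.vecMulVec_apply]
    · simp
  ext j k
  rw [momentMap, Matrix.sub_apply, Matrix.sub_apply, hvw]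
  simp only [slice, rX, rY, Matrix.mul_diagonal, Matrix.diagonal_mul, Matrix.smul_apply,
    smul_eq_mul]
  by_cases hjk : j = k
  · subst hjk
    have := diagShift_sub (lam := lam) i
    have h0 := hz.1 j
    rw [laxBlock_diag, laxBlock_diag, Matrix.one_apply_eq]
    field_simp
    linear_combination this
  · have hne : z.1 j ^ m - z.1 k ^ m ≠ 0 := sub_ne_zero.2 (hz.2 j k hjk)
    rw [laxBlock_offdiag _ _ _ hjk, laxBlock_offdiag _ _ _ hjk, Matrix.one_apply_ne hjk, mul_zero]
    by_cases h : i = 0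
    · subst h
      rw [zero_sub, val_neg_one, if_pos rfl]
      have hm : m - 1 + 1 = m := Nat.sub_add_cancel (NeZero.pos m)
      have e1 : z.1 j ^ m = z.1 j ^ (m - 1) * z.1 j := by rw [← pow_succ, hm]
      have e2 : z.1 k ^ m = z.1 k ^ (m - 1) * z.1 k := by rw [← pow_succ, hm]
      simp only [Fin.val_zero, pow_zero, one_mul, Nat.sub_zero, Nat.sub_self, mul_one]
      field_simp
      rw [e1, e2]
      ring
    · have h1 := val_sub_one_of_ne h
      have h2 := i.2
      rw [if_neg h, show m - 1 - ((i - 1 : Fin m) : ℕ) = m - 1 - (i : ℕ) + 1 by omega, ← h1,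
        pow_succ, pow_succ]
      ring

theorem laxMatrix_mulVec (lam : Fin m → ℂ) (z : Phase n) (k : ℕ) (a : Fin n) :
    (laxMatrix lam z ^ k).mulVec (vec0 fun _ => 1) (-(k • (1 : Fin m)), a) = laxVec lam z k a := by
  induction k generalizing a with
  | zero => simp [laxVec, vec0]
  | succ k ih =>
    rw [pow_succ', ← Matrix.mulVec_mulVec, laxMatrix, bigY_mulVec]
    have e : -((k + 1) • (1 : Fin m)) + 1 = -(k • 1) := by rw [succ_nsmul]; abel
    rw [e]
    have : (fun c => ((bigY (laxBlock lam z)) ^ k).mulVec (vec0 fun _ => 1) (-(k • 1), c))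
        = laxVec lam z k := funext fun c => ih c
    rw [this]
    rfl

theorem sum_laxVec (lam : Fin m → ℂ) (z : Phase n) (j : ℕ) :
    ∑ i, laxVec lam z (j * m) i = dotProduct (vec0 (fun _ => 1))
      ((laxMatrix lam z ^ (m * j)).mulVec (vec0 fun _ => 1)) := by
  have h0 : (j * m) • (1 : Fin m) = 0 := by
    rw [nsmul_one_eq_zero_iff]; exact dvd_mul_left m j
  simp_rw [← laxMatrix_mulVec]
  rw [h0, neg_zero, mul_comm j m]
  simp [dotProduct, Fintype.sum_prod_type_right, vec0]

/-- The traces of the diagonal blocks of a power of `Y` coincide. -/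
theorem sum_bigY_pow_diag (Y : Fin m → Matrix (Fin n) (Fin n) ℂ) (k : ℕ) (i : Fin m) :
    ∑ a, (bigY Y ^ k) (i, a) (i, a) = ∑ a, (bigY Y ^ k) (0, a) (0, a) := by
  have step : ∀ i, ∑ a, (bigY Y ^ k) (i + 1, a) (i + 1, a) = ∑ a, (bigY Y ^ k) (i, a) (i, a) := by
    intro i
    cases k with
    | zero => simp
    | succ k =>
      have h1 : ∀ a, (bigY Y ^ (k + 1)) (i, a) (i, a)
          = ∑ c, Y i a c * (bigY Y ^ k) (i + 1, c) (i, a) := fun a => by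
        rw [pow_succ', bigY_mul_apply]
      have h2 : ∀ c, (bigY Y ^ (k + 1)) (i + 1, c) (i + 1, c)
          = ∑ a, (bigY Y ^ k) (i + 1, c) (i, a) * Y i a c := fun c => by
        rw [pow_succ, mul_bigY_apply, add_sub_cancel_right]
      simp_rw [h1, h2]
      rw [Finset.sum_comm]
      simp_rw [mul_comm]
  have all : ∀ t : ℕ, ∑ a, (bigY Y ^ k) (t • (1 : Fin m), a) (t • (1 : Fin m), a)
      = ∑ a, (bigY Y ^ k) (0, a) (0, a) := by
    intro t
    induction t with
    | zero => simp
    | succ t ih => rw [succ_nsmul, step, ih]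
  have hi : (i : ℕ) • (1 : Fin m) = i := by
    apply Fin.ext; rw [val_nsmul_one, Nat.mod_eq_of_lt i.2]
  rw [← hi]; exact all i

/-- `tr Y^{mj} = m (1, …, 1)(Y_0 ⋯ Y_{m-1})^j (1, …, 1)ᵀ`: for `|λ| ≠ 0` take the trace of the
product of the moment map equation with `Y^{mj}`; for `|λ| = 0` the `Y_i` are diagonal. -/
theorem trace_laxMatrix_pow (lam : Fin m → ℂ) {z : Phase n} (hz : z ∈ regDomain m n) (k : ℕ) :
    (laxMatrix lam z ^ k).trace = (m : ℂ) * dotProduct (vec0 (fun _ => 1))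
      ((laxMatrix lam z ^ k).mulVec (vec0 fun _ => 1)) := by
  set t0 := ∑ a, (laxMatrix lam z ^ k) (0, a) (0, a) with ht0
  have hdiag : ∀ i, ∑ a, (laxMatrix lam z ^ k) (i, a) (i, a) = t0 := fun i =>
    sum_bigY_pow_diag _ k i
  have htr : (laxMatrix lam z ^ k).trace = (m : ℂ) * t0 := by
    simp only [Matrix.trace, Matrix.diag_apply, Fintype.sum_prod_type, hdiag]
    simp
  rw [htr]
  congr 1
  by_cases h0 : absLam lam = 0
  · have hoff : ∀ k : ℕ, ∀ i j : Fin m, ∀ a b : Fin n, a ≠ b →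
        (laxMatrix lam z ^ k) (i, a) (j, b) = 0 := by
      intro k
      induction k with
      | zero => intro i j a b hab; simp [hab]
      | succ k ih =>
        intro i j a b hab
        rw [pow_succ', laxMatrix, bigY_mul_apply]
        refine Finset.sum_eq_zero fun c _ => ?_
        by_cases hac : a = c
        · subst hac
          have := ih (i + 1) j a b hab
          rw [laxMatrix] at this
          rw [this, mul_zero]
        · rw [laxBlock_offdiag _ _ _ hac, h0]; simp
    rw [ht0]
    simp only [dotProduct, Matrix.mulVec, Fintype.sum_prod_type, vec0]
    simp only [ite_mul, one_mul, zero_mul, mul_ite, mul_one, mul_zero, Finset.sum_ite_irrel,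
      Finset.sum_const_zero, Finset.sum_ite_eq', Finset.mem_univ, if_true]
    refine Finset.sum_congr rfl fun a _ => ?_
    rw [Finset.sum_eq_single a]
    · intro b _ hb; exact hoff k 0 0 a b hb.symm
    · simp
  · have hmom := (moment_iff (slice lam z) lam).1 (momentMap_slice lam hz)
    have h1 := congrArg (fun M => (laxMatrix lam z ^ k * M).trace) hmom
    simp only [mul_add, mul_sub, Matrix.trace_add, Matrix.trace_sub] at h1
    have e1 : (laxMatrix lam z ^ k * (bigY (rY (slice lam z)) * bigX (rX (slice lam z)))).trace
        = (laxMatrix lam z ^ k * (bigX (rX (slice lam z)) * bigY (rY (slice lam z)))).trace := by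
      have : bigY (rY (slice lam z)) = laxMatrix lam z := rfl
      rw [this, ← mul_assoc, ← pow_succ, pow_succ', mul_assoc, Matrix.trace_mul_comm, mul_assoc]
    rw [e1, sub_self, trace_mul_vecMulVec] at h1
    have e2 : (laxMatrix lam z ^ k * blockD (fun i => lam i • 1)).trace = absLam lam * t0 := by
      simp only [Matrix.trace, Matrix.diag_apply, Fintype.sum_prod_type, mul_blockD_apply,
        Matrix.smul_apply, Matrix.one_apply, smul_eq_mul, mul_ite, mul_one, mul_zero,
        Finset.sum_ite_eq', Finset.mem_univ, if_true]
      simp_rw [← Finset.sum_mul, hdiag]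
      rw [← Finset.mul_sum, mul_comm, absLam]
    have e3 : vec0 (m := m) (rw (slice (m := m) lam z)) = (-absLam lam) • vec0 (fun _ : Fin n => 1) := by
      funext x
      simp only [vec0, slice, rw, Pi.smul_apply, smul_eq_mul]
      split_ifs <;> simp
    have e4 : rv (slice (m := m) lam z) = fun _ => 1 := rfl
    rw [e2, e3, e4, smul_dotProduct, smul_eq_mul] at h1
    apply mul_left_cancel₀ h0
    linear_combination -h1

/-! ### Symplectic linear algebra at a point of `Rep` -/

/-- The polarisation of the moment map. -/
def momentBilin : Rep m n →ₗ[ℂ] Rep m n →ₗ[ℂ] (Fin m → Matrix (Fin n) (Fin n) ℂ) :=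
  LinearMap.mk₂ ℂ (fun ξ η i => rY ξ i * rX η i - rX ξ (i - 1) * rY η (i - 1)
      - (if i = 0 then Matrix.vecMulVec (rv ξ) (rw η) else 0))
    (by
      intro a b c; funext i
      by_cases h : i = 0 <;>
        simp [h, rX, rY, rv, rw, add_mul, Matrix.add_vecMulVec] <;> abel)
    (by
      intro a b c; funext i
      by_cases h : i = 0 <;>
        simp [h, rX, rY, rv, rw, Matrix.smul_vecMulVec, smul_sub])
    (by
      intro a b c; funext i
      by_cases h : i = 0 <;>
        simp [h, rX, rY, rv, rw, mul_add, Matrix.vecMulVec_add] <;> abel)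
    (by
      intro a b c; funext i
      by_cases h : i = 0 <;>
        simp [h, rX, rY, rv, rw, Matrix.vecMulVec_smul, smul_sub])

theorem momentMap_eq : (momentMap : Rep m n → _) = fun q => momentBilin q q := rfl

/-- The differential of the moment map at `q`. -/
def momentDeriv (q : Rep m n) : Rep m n →ₗ[ℂ] (Fin m → Matrix (Fin n) (Fin n) ℂ) :=
  momentBilin q + momentBilin.flip q

theorem hasStrictFDerivAt_momentMap (q : Rep m n) :
    HasStrictFDerivAt (momentMap : Rep m n → _) (LinearMap.toContinuousLinearMap (momentDeriv q))
      q := by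
  rw [momentMap_eq]
  exact hasStrictFDerivAt_quadratic momentBilin q

theorem mem_fibreTangent {q ξ : Rep m n} : ξ ∈ fibreTangent q ↔ momentDeriv q ξ = 0 := by
  rw [fibreTangent, (hasStrictFDerivAt_momentMap q).hasFDerivAt.fderiv]
  rfl

theorem momentDeriv_apply (q ξ : Rep m n) (i : Fin m) :
    momentDeriv q ξ i = (rY q i * rX ξ i - rX q (i - 1) * rY ξ (i - 1)
        - (if i = 0 then Matrix.vecMulVec (rv q) (rw ξ) else 0))
      + (rY ξ i * rX q i - rX ξ (i - 1) * rY q (i - 1)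
        - (if i = 0 then Matrix.vecMulVec (rv ξ) (rw q) else 0)) := rfl

/-- The symplectic form as a bilinear form. -/
def sympBilin : LinearMap.BilinForm ℂ (Rep m n) :=
  LinearMap.mk₂ ℂ sympForm
    (by
      intro a b c
      simp [sympForm, rX, rY, rv, rw, add_mul, mul_add, Finset.sum_add_distrib,
        Finset.sum_sub_distrib, add_dotProduct, dotProduct_add]; ring)
    (by
      intro a b c
      simp [sympForm, rX, rY, rv, rw, Finset.mul_sum, mul_add, mul_sub])
    (by
      intro a b c
      simp [sympForm, rX, rY, rv, rw, add_mul, mul_add, Finset.sum_add_distrib,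
        Finset.sum_sub_distrib, add_dotProduct, dotProduct_add]; ring)
    (by
      intro a b c
      simp [sympForm, rX, rY, rv, rw, Finset.mul_sum, mul_add, mul_sub])

theorem sympBilin_apply (ξ η : Rep m n) : sympBilin ξ η = sympForm ξ η := rfl

theorem sympForm_swap (ξ η : Rep m n) : sympForm ξ η = -sympForm η ξ := by
  simp only [sympForm, Finset.sum_sub_distrib]
  ring

theorem sympBilin_isRefl : (sympBilin : LinearMap.BilinForm ℂ (Rep m n)).IsRefl := by
  intro ξ η h
  rw [sympBilin_apply] at *
  rw [sympForm_swap, h, neg_zero]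

theorem trace_mul_single' (A : Matrix (Fin n) (Fin n) ℂ) (a b : Fin n) :
    (A * Matrix.single a b 1).trace = A b a := by
  simp [Matrix.trace, Matrix.mul_apply, Matrix.single_apply, Finset.sum_ite_eq,
    ite_and]

theorem sympBilin_nondegenerate : (sympBilin : LinearMap.BilinForm ℂ (Rep m n)).Nondegenerate := by
  have hl : ∀ ξ : Rep m n, (∀ η, sympForm ξ η = 0) → ξ = 0 := by
    intro ξ h
    refine Prod.ext ?_ (Prod.ext ?_ (Prod.ext ?_ ?_))
    · funext i; ext b a
      have := h (0, Pi.single i (Matrix.single a b 1), 0, 0)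
      simp only [sympForm, rX, rY, rv, rw, Pi.zero_apply, mul_zero, Matrix.trace_zero, zero_sub,
        dotProduct_zero, zero_dotProduct, sub_self, add_zero] at this
      rw [Finset.sum_eq_single i] at this
      · rw [Pi.single_eq_same, Matrix.trace_mul_comm, trace_mul_single'] at this
        simpa using this
      · intro k _ hk; rw [Pi.single_eq_of_ne hk]; simp
      · simp
    · funext i; ext b a
      have := h (Pi.single i (Matrix.single a b 1), 0, 0, 0)
      simp only [sympForm, rX, rY, rv, rw, Pi.zero_apply, zero_mul, Matrix.trace_zero, sub_zero,
        dotProduct_zero, zero_dotProduct, sub_self, add_zero] at this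
      rw [Finset.sum_eq_single i] at this
      · rw [Pi.single_eq_same, trace_mul_single'] at this
        simpa using this
      · intro k _ hk; rw [Pi.single_eq_of_ne hk]; simp
      · simp
    · funext a
      have := h (0, 0, 0, Pi.single a 1)
      simpa [sympForm, rX, rY, rv, rw] using this
    · funext a
      have := h (0, 0, Pi.single a 1, 0)
      simpa [sympForm, rX, rY, rv, rw] using this
  constructor
  · intro ξ h; exact hl ξ h
  · intro ξ h
    refine hl ξ fun η => ?_
    rw [sympForm_swap, ← sympBilin_apply, h, neg_zero]

/-- The infinitesimal action as a linear map. -/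
def glInfLin (q : Rep m n) : (Fin m → Matrix (Fin n) (Fin n) ℂ) →ₗ[ℂ] Rep m n where
  toFun := glInf q
  map_add' a b := by
    refine Prod.ext ?_ (Prod.ext ?_ (Prod.ext ?_ ?_))
    · funext i; simp [glInf, add_mul, mul_add]; abel
    · funext i; simp [glInf, add_mul, mul_add]; abel
    · simp [glInf, Matrix.add_mulVec]
    · simp [glInf, Matrix.vecMul_add]; abel
  map_smul' c a := by
    refine Prod.ext ?_ (Prod.ext ?_ (Prod.ext ?_ ?_))
    · funext i; simp [glInf, smul_sub]
    · funext i; simp [glInf, smul_sub]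
    · simp [glInf, Matrix.smul_mulVec]
    · simp [glInf, Matrix.vecMul_smul]

theorem orbitTangent_eq_range (q : Rep m n) : orbitTangent q = LinearMap.range (glInfLin q) := by
  have : Set.range (glInf q) = (LinearMap.range (glInfLin q) : Set (Rep m n)) := rfl
  rw [orbitTangent, this, Submodule.span_eq]

theorem mem_orbitTangent {q ξ : Rep m n} : ξ ∈ orbitTangent q ↔ ∃ a, glInf q a = ξ := by
  rw [orbitTangent_eq_range]; rfl

/-- The moment map property: `ω(ξ, a·q) = -tr (a dμ(ξ))`. -/
theorem sympForm_glInf (q ξ : Rep m n) (a : Fin m → Matrix (Fin n) (Fin n) ℂ) :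
    sympForm ξ (glInf q a) = -∑ i, (a i * momentDeriv q ξ i).trace := by
  have hsum : ∀ f : Fin m → ℂ, ∑ i, f (i - 1) = ∑ i, f i := fun f =>
    Equiv.sum_comp (Equiv.subRight (1 : Fin m)) f
  have h1 : ∑ i, (a i * (rX q (i - 1) * rY ξ (i - 1))).trace
      = ∑ i, (rY ξ i * (a (i + 1) * rX q i)).trace := by
    rw [← hsum (fun i => (rY ξ i * (a (i + 1) * rX q i)).trace)]
    refine Finset.sum_congr rfl fun i _ => ?_
    rw [sub_add_cancel, ← mul_assoc, Matrix.trace_mul_comm]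
  have h2 : ∑ i, (a i * (rX ξ (i - 1) * rY q (i - 1))).trace
      = ∑ i, (rY q i * a (i + 1) * rX ξ i).trace := by
    rw [← hsum (fun i => (rY q i * a (i + 1) * rX ξ i).trace)]
    refine Finset.sum_congr rfl fun i _ => ?_
    rw [sub_add_cancel, ← mul_assoc, Matrix.trace_mul_comm, mul_assoc]
  have h3 : ∀ i, (rY ξ i * (rX q i * a i)).trace = (a i * (rY ξ i * rX q i)).trace := fun i => by
    rw [← mul_assoc, Matrix.trace_mul_comm]
  have h4 : ∀ u w : Fin n → ℂ, ∑ i : Fin m, (a i * (if i = 0 then Matrix.vecMulVec u w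
      else 0)).trace = dotProduct w ((a 0).mulVec u) := by
    intro u w
    rw [Finset.sum_eq_single 0]
    · rw [if_pos rfl, trace_mul_vecMulVec]
    · intro i _ hi; simp [hi]
    · simp
  simp only [momentDeriv_apply, mul_add, mul_sub, Matrix.trace_add, Matrix.trace_sub,
    Finset.sum_add_distrib, Finset.sum_sub_distrib, h1, h2, h4]
  simp only [sympForm, glInf, rX, rY, rv, rw] at *
  simp only [mul_sub, sub_mul, Matrix.trace_sub, Finset.sum_sub_distrib, h3, neg_dotProduct,
    ← Matrix.dotProduct_mulVec]
  simp only [mul_assoc]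
  ring

theorem mem_fibreTangent_iff {q ξ : Rep m n} :
    ξ ∈ fibreTangent q ↔ ∀ a, sympForm ξ (glInf q a) = 0 := by
  rw [mem_fibreTangent]
  constructor
  · intro h a; rw [sympForm_glInf, h]; simp
  · intro h
    funext i; ext b c
    have := h (Pi.single i (Matrix.single c b 1))
    rw [sympForm_glInf, neg_eq_zero, Finset.sum_eq_single i] at this
    · rw [Pi.single_eq_same, Matrix.trace_mul_comm, trace_mul_single'] at this
      simpa using this
    · intro k _ hk; rw [Pi.single_eq_of_ne hk]; simp
    · simp

theorem fibreTangent_eq_orthogonal (q : Rep m n) :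
    fibreTangent q = sympBilin.orthogonal (orbitTangent q) := by
  ext ξ
  rw [mem_fibreTangent_iff, LinearMap.BilinForm.mem_orthogonal_iff]
  constructor
  · intro h η hη
    obtain ⟨a, rfl⟩ := mem_orbitTangent.1 hη
    change sympForm (glInf q a) ξ = 0
    rw [sympForm_swap, h, neg_zero]
  · intro h a
    have := h _ (mem_orbitTangent.2 ⟨a, rfl⟩)
    change sympForm (glInf q a) ξ = 0 at this
    rw [sympForm_swap, this, neg_zero]

/-- The tangent space of the orbit is the `ω`-orthogonal of the kernel of the differential of the
moment map. -/
theorem mem_orbitTangent_iff {q ξ : Rep m n} :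
    ξ ∈ orbitTangent q ↔ ∀ η ∈ fibreTangent q, sympForm ξ η = 0 := by
  rw [← LinearMap.BilinForm.orthogonal_orthogonal sympBilin_nondegenerate sympBilin_isRefl
    (orbitTangent q), ← fibreTangent_eq_orthogonal, LinearMap.BilinForm.mem_orthogonal_iff]
  refine forall₂_congr fun η _ => ?_
  change sympForm η ξ = 0 ↔ _
  rw [sympForm_swap, neg_eq_zero]

theorem finrank_orbitTangent {q : Rep m n} (hq : Function.Injective (glInf q)) :
    Module.finrank ℂ (orbitTangent q) = m * (n * n) := by
  rw [orbitTangent_eq_range, LinearMap.finrank_range_of_inj hq]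
  simp [Module.finrank_pi_fintype, Module.finrank_matrix]

theorem finrank_fibreTangent {q : Rep m n} (hq : Function.Injective (glInf q)) :
    Module.finrank ℂ (fibreTangent q) = Module.finrank ℂ (orbitTangent q) + 2 * n := by
  rw [fibreTangent_eq_orthogonal, LinearMap.BilinForm.finrank_orthogonal sympBilin_nondegenerate,
    finrank_orbitTangent hq]
  simp [Module.finrank_pi_fintype, Module.finrank_matrix]
  omega

/-- At a point of the fibre the orbit is tangent to the fibre. -/
theorem orbitTangent_le_fibreTangent {q : Rep m n} {lam : Fin m → ℂ}
    (hq : ∀ i, momentMap q i = lam i • (1 : Matrix (Fin n) (Fin n) ℂ)) :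
    orbitTangent q ≤ fibreTangent q := by
  intro ξ hξ
  obtain ⟨a, rfl⟩ := mem_orbitTangent.1 hξ
  rw [mem_fibreTangent]
  funext i
  have key : momentDeriv q (glInf q a) i = a i * momentMap q i - momentMap q i * a i := by
    rw [momentDeriv_apply]
    by_cases h : i = 0
    · subst h
      simp only [glInf, rX, rY, rv, rw, momentMap, if_true, sub_add_cancel, mul_sub, sub_mul,
        Matrix.vecMulVec_neg, Matrix.mul_vecMulVec, Matrix.vecMulVec_mul, mul_assoc]
      abel
    · simp only [glInf, rX, rY, rv, rw, momentMap, if_neg h, sub_add_cancel, mul_sub, sub_mul,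
        mul_assoc, mul_zero, zero_mul]
      abel
  rw [key, hq]
  simp

/-! ### The differential of the slice -/

theorem isOpen_regDomain (m n : ℕ) : IsOpen (regDomain m n) := by
  have h : regDomain m n = (⋂ i, {z : Phase n | z.1 i ≠ 0}) ∩
      ⋂ i, ⋂ j, ⋂ (_ : i ≠ j), {z : Phase n | z.1 i ^ m ≠ z.1 j ^ m} := by
    ext z; simp [regDomain]
  rw [h]
  refine (isOpen_iInter_of_finite fun i => ?_).inter
    (isOpen_iInter_of_finite fun i => isOpen_iInter_of_finite fun j =>
      isOpen_iInter_of_finite fun _ => ?_)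
  · exact isOpen_ne_fun (by fun_prop) continuous_const
  · exact isOpen_ne_fun (by fun_prop) (by fun_prop)

theorem differentiableAt_laxBlock (lam : Fin m → ℂ) {z : Phase n} (hz : z ∈ regDomain m n)
    (i : Fin m) : DifferentiableAt ℂ (fun z : Phase n => laxBlock lam z i) z := by
  have hx : ∀ j : Fin n, DifferentiableAt ℂ (fun z : Phase n => z.1 j) z := fun j => by fun_prop
  have hp : ∀ j : Fin n, DifferentiableAt ℂ (fun z : Phase n => z.2 j) z := fun j => by fun_prop
  refine differentiableAt_pi.2 fun j => differentiableAt_pi.2 fun k => ?_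
  by_cases hjk : j = k
  · subst hjk
    simp only [laxBlock_diag]
    exact (hp j).add (((hx j).inv (hz.1 j)).mul_const _)
  · simp only [laxBlock_offdiag _ _ _ hjk]
    have hd : DifferentiableAt ℂ (fun z : Phase n => z.1 j ^ m - z.1 k ^ m) z :=
      ((hx j).fun_pow m).fun_sub ((hx k).fun_pow m)
    simp only [div_eq_mul_inv]
    exact ((((hx j).fun_pow _).fun_mul ((hx k).fun_pow _)).const_mul _).fun_mul
      (hd.fun_inv (sub_ne_zero.2 (hz.2 j k hjk)))

theorem differentiableAt_slice (lam : Fin m → ℂ) {z : Phase n} (hz : z ∈ regDomain m n) :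
    DifferentiableAt ℂ (slice (m := m) (n := n) lam) z := by
  refine DifferentiableAt.prodMk ?_ (DifferentiableAt.prodMk ?_
    (DifferentiableAt.prodMk (differentiableAt_const _) (differentiableAt_const _)))
  · refine differentiableAt_pi.2 fun i => ?_
    exact differentiableAt_linear (Matrix.diagonalLinearMap (Fin n) ℂ ℂ) differentiableAt_fst
  · exact differentiableAt_pi.2 fun i => differentiableAt_laxBlock lam hz i

/-- The component `X_i`, as a linear map. -/
def rXLin (i : Fin m) : Rep m n →ₗ[ℂ] Matrix (Fin n) (Fin n) ℂ :=
  LinearMap.proj i ∘ₗ LinearMap.fst ℂ _ _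

/-- The component `Y_i`, as a linear map. -/
def rYLin (i : Fin m) : Rep m n →ₗ[ℂ] Matrix (Fin n) (Fin n) ℂ :=
  LinearMap.proj i ∘ₗ LinearMap.fst ℂ _ _ ∘ₗ LinearMap.snd ℂ _ _

/-- The component `v`, as a linear map. -/
def rvLin : Rep m n →ₗ[ℂ] (Fin n → ℂ) :=
  LinearMap.fst ℂ _ _ ∘ₗ LinearMap.snd ℂ _ _ ∘ₗ LinearMap.snd ℂ _ _

theorem hasDerivAt_slice_line (lam : Fin m → ℂ) {z : Phase n} (hz : z ∈ regDomain m n)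
    (u : Phase n) :
    HasDerivAt (fun s : ℂ => slice (m := m) lam (z + s • u)) (fderiv ℂ (slice (m := m) lam) z u)
      0 := by
  have h1 : HasDerivAt (fun s : ℂ => z + s • u) u 0 := by
    simpa using ((hasDerivAt_id (0 : ℂ)).smul_const u).const_add z
  have h2 : HasFDerivAt (slice (m := m) lam) (fderiv ℂ (slice (m := m) lam) z)
      (z + (0 : ℂ) • u) := by
    simpa using (differentiableAt_slice lam hz).hasFDerivAt
  exact h2.comp_hasDerivAt (0 : ℂ) h1

theorem rX_fderiv_slice (lam : Fin m → ℂ) {z : Phase n} (hz : z ∈ regDomain m n)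
    (u : Phase n) (i : Fin m) :
    rX (fderiv ℂ (slice (m := m) lam) z u) i = Matrix.diagonal u.1 := by
  have h1 := hasDerivAt_linear (rXLin i) (hasDerivAt_slice_line lam hz u)
  have h0 : HasDerivAt (fun s : ℂ => (z + s • u).1) u.1 0 := by
    simpa using ((hasDerivAt_id (0 : ℂ)).smul_const u.1).const_add z.1
  exact h1.unique (hasDerivAt_linear (Matrix.diagonalLinearMap (Fin n) ℂ ℂ) h0)

theorem rv_fderiv_slice (lam : Fin m → ℂ) {z : Phase n} (hz : z ∈ regDomain m n)
    (u : Phase n) : rv (fderiv ℂ (slice (m := m) lam) z u) = 0 :=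
  (hasDerivAt_linear rvLin (hasDerivAt_slice_line lam hz u)).unique (hasDerivAt_const _ _)

theorem rY_fderiv_slice_diag (lam : Fin m → ℂ) {z : Phase n} (hz : z ∈ regDomain m n)
    (u : Phase n) (i : Fin m) (j : Fin n) :
    rY (fderiv ℂ (slice (m := m) lam) z u) i j j
      = u.2 j - diagShift lam i / z.1 j ^ 2 * u.1 j := by
  have h1 := hasDerivAt_entry (hasDerivAt_linear (rYLin i) (hasDerivAt_slice_line lam hz u)) j j
  refine h1.unique ?_
  have h2 : HasDerivAt (fun s : ℂ => z.1 j + s * u.1 j) (u.1 j) 0 := by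
    simpa using ((hasDerivAt_id (0 : ℂ)).mul_const (u.1 j)).const_add (z.1 j)
  have h3 : HasDerivAt (fun s : ℂ => z.2 j + s * u.2 j) (u.2 j) 0 := by
    simpa using ((hasDerivAt_id (0 : ℂ)).mul_const (u.2 j)).const_add (z.2 j)
  have h4 := h3.add ((h2.fun_inv (by simpa using hz.1 j)).mul_const (diagShift lam i))
  have e : (fun s : ℂ => rYLin i (slice lam (z + s • u)) j j) = fun s : ℂ =>
      (z.2 j + s * u.2 j) + (z.1 j + s * u.1 j)⁻¹ * diagShift lam i := by
    funext s
    exact laxBlock_diag lam (z + s • u) i j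
  rw [e]
  refine h4.congr_deriv ?_
  simp only [zero_mul, add_zero]
  ring

/-- The slice pulls the symplectic form back to `m ∑ dμ_i ∧ dν_i`. -/
theorem sympForm_fderiv_slice (lam : Fin m → ℂ) {z : Phase n} (hz : z ∈ regDomain m n)
    (u u' : Phase n) :
    sympForm (fderiv ℂ (slice (m := m) lam) z u) (fderiv ℂ (slice (m := m) lam) z u')
      = (m : ℂ) * ∑ i, (u.2 i * u'.1 i - u'.2 i * u.1 i) := by
  simp only [sympForm, rX_fderiv_slice lam hz, rv_fderiv_slice lam hz, Matrix.trace,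
    Matrix.diag_apply, Matrix.mul_diagonal, rY_fderiv_slice_diag lam hz, dotProduct_zero, sub_zero,
    add_zero]
  rw [← nsmul_eq_mul]
  conv_rhs => rw [← Fintype.card_fin m, ← Finset.card_univ, ← Finset.sum_const]
  refine Finset.sum_congr rfl fun i _ => ?_
  rw [← Finset.sum_sub_distrib]
  exact Finset.sum_congr rfl fun j _ => by ring

/-- Rigidity of the slice: no infinitesimal gauge transformation fixing `v = (1, …, 1)` moves `X`
within the diagonal matrices. -/
theorem slice_rigid {z : Phase n} (hz : z ∈ regDomain m n) {u : Fin n → ℂ}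
    {a : Fin m → Matrix (Fin n) (Fin n) ℂ}
    (h : ∀ i, a (i + 1) * Matrix.diagonal z.1 - Matrix.diagonal z.1 * a i = Matrix.diagonal u)
    (h0 : (a 0).mulVec (fun _ => 1) = 0) : a = 0 ∧ u = 0 := by
  have hent : ∀ i j k, a (i + 1) j k * z.1 k - z.1 j * a i j k = Matrix.diagonal u j k :=
    fun i j k => by
      have := congrFun (congrFun (h i) j) k
      simpa only [Matrix.sub_apply, Matrix.mul_diagonal, Matrix.diagonal_mul] using this
  have hoff : ∀ i j k, j ≠ k → a i j k = 0 := by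
    intro i j k hjk
    have iter : ∀ t : ℕ, a (i + t • (1 : Fin m)) j k * z.1 k ^ t = z.1 j ^ t * a i j k := by
      intro t
      induction t with
      | zero => simp
      | succ t ih =>
        have := hent (i + t • 1) j k
        rw [Matrix.diagonal_apply_ne _ hjk, sub_eq_zero] at this
        rw [succ_nsmul, ← add_assoc, pow_succ']
        rw [← mul_assoc, this, mul_assoc, ih, pow_succ']
        ring
    have := iter m
    rw [card_nsmul_one_fin, add_zero] at this
    have h2 : a i j k * (z.1 k ^ m - z.1 j ^ m) = 0 := by linear_combination this
    exact (mul_eq_zero.1 h2).resolve_right (sub_ne_zero.2 (hz.2 k j (Ne.symm hjk)))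
  have hdiag : ∀ (i : Fin m) (j : Fin n) (t : ℕ),
      a (i + t • (1 : Fin m)) j j = a i j j + t * (u j / z.1 j) := by
    intro i j t
    induction t with
    | zero => simp
    | succ t ih =>
      have := hent (i + t • 1) j j
      rw [Matrix.diagonal_apply_eq, ih] at this
      have hne := hz.1 j
      rw [succ_nsmul, ← add_assoc]
      push_cast
      field_simp
      field_simp at this
      linear_combination this
  have hu : u = 0 := by
    funext j
    have := hdiag 0 j m
    rw [card_nsmul_one_fin, add_zero, left_eq_add] at this
    have hm : (m : ℂ) ≠ 0 := Nat.cast_ne_zero.2 (NeZero.ne m)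
    have h2 := (div_eq_zero_iff.1 ((mul_eq_zero.1 this).resolve_left hm)).resolve_right (hz.1 j)
    exact h2
  refine ⟨?_, hu⟩
  have ha0 : ∀ j, a 0 j j = 0 := by
    intro j
    have := congrFun h0 j
    simp only [Matrix.mulVec, dotProduct, mul_one, Pi.zero_apply] at this
    rwa [Finset.sum_eq_single j (fun k _ hk => hoff 0 j k hk.symm) (by simp)] at this
  funext i; ext j k
  by_cases hjk : j = k
  · subst hjk
    have := hdiag 0 j (i : ℕ)
    have hi : (i : ℕ) • (1 : Fin m) = i := by
      apply Fin.ext; rw [val_nsmul_one, Nat.mod_eq_of_lt i.2]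
    rw [zero_add, hi, ha0, hu] at this
    simpa using this
  · exact hoff i j k hjk

theorem glInf_slice_injective (lam : Fin m → ℂ) {z : Phase n} (hz : z ∈ regDomain m n) :
    Function.Injective (glInf (slice (m := m) lam z)) := by
  refine (injective_iff_map_eq_zero (glInfLin (slice (m := m) lam z))).2 fun a ha => ?_
  refine (slice_rigid (u := 0) hz (a := a) (fun i => ?_) ?_).1
  · rw [show Matrix.diagonal (0 : Fin n → ℂ) = 0 from Matrix.diagonal_zero]
    exact congrFun (congrArg Prod.fst ha) i
  · exact congrArg (fun ξ => ξ.2.2.1) ha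

theorem fderiv_slice_mem_fibreTangent (lam : Fin m → ℂ) {z : Phase n} (hz : z ∈ regDomain m n)
    (u : Phase n) : fderiv ℂ (slice (m := m) lam) z u ∈ fibreTangent (slice lam z) := by
  rw [mem_fibreTangent]
  have h1 := (hasStrictFDerivAt_momentMap (slice (m := m) lam z)).hasFDerivAt.comp z
    (differentiableAt_slice lam hz).hasFDerivAt
  have h2 : HasFDerivAt (momentMap ∘ slice (m := m) (n := n) lam) (0 : Phase n →L[ℂ] _) z := by
    refine (hasFDerivAt_const (fun i => lam i • (1 : Matrix (Fin n) (Fin n) ℂ)) z).congr_of_eventuallyEq ?_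
    filter_upwards [(isOpen_regDomain m n).mem_nhds hz] with y hy
    exact funext fun i => momentMap_slice lam hy i
  have := congrArg (fun l => l u) (h1.unique h2)
  exact this

/-- At a point of the slice the kernel of the differential of the moment map is spanned by the
tangent spaces of the slice and of the orbit.  This needs no assumption on `λ`. -/
theorem exists_of_mem_fibreTangent_slice (lam : Fin m → ℂ) {z : Phase n}
    (hz : z ∈ regDomain m n) {ξ : Rep m n} (hξ : ξ ∈ fibreTangent (slice lam z)) :
    ∃ u a, ξ = fderiv ℂ (slice (m := m) lam) z u + glInf (slice lam z) a := by
  set D := (fderiv ℂ (slice (m := m) lam) z).toLinearMap with hD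
  have hle : LinearMap.range D ⊔ orbitTangent (slice lam z) ≤ fibreTangent (slice lam z) := by
    refine sup_le ?_ (orbitTangent_le_fibreTangent (momentMap_slice lam hz))
    rintro _ ⟨u, rfl⟩
    exact fderiv_slice_mem_fibreTangent lam hz u
  have key : ∀ u a, D u = glInf (slice lam z) a → u = 0 := by
    intro u a h
    have hX : ∀ i, a (i + 1) * Matrix.diagonal z.1 - Matrix.diagonal z.1 * a i
        = Matrix.diagonal u.1 := fun i => by
      rw [← rX_fderiv_slice lam hz u i]
      exact (congrFun (congrArg Prod.fst h) i).symm
    have hv : (a 0).mulVec (fun _ => 1) = 0 := by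
      rw [← rv_fderiv_slice lam hz u]
      exact (congrArg (fun ξ => ξ.2.2.1) h).symm
    obtain ⟨ha, hu⟩ := slice_rigid hz hX hv
    refine Prod.ext hu (funext fun j => ?_)
    have h3 := rY_fderiv_slice_diag lam hz u 0 j
    have h4 : rY (D u) 0 j j = 0 := by
      rw [h, ha]; simp [glInf, rY]
    rw [hu] at h3
    change rY (D u) 0 j j = _ at h3
    rw [h4] at h3
    simpa using h3.symm
  have hinj : Function.Injective D := by
    refine (injective_iff_map_eq_zero D).2 fun u hu => key u 0 ?_
    rw [hu]; exact ((glInfLin (slice lam z)).map_zero).symm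
  have hinf : LinearMap.range D ⊓ orbitTangent (slice lam z) = ⊥ := by
    rw [eq_bot_iff]
    rintro ξ ⟨⟨u, rfl⟩, h2⟩
    obtain ⟨a, ha⟩ := mem_orbitTangent.1 h2
    rw [key u a ha.symm, map_zero]
    exact Submodule.zero_mem _
  have heq : LinearMap.range D ⊔ orbitTangent (slice lam z) = fibreTangent (slice lam z) := by
    apply Submodule.eq_of_le_of_finrank_eq hle
    have h5 := Submodule.finrank_sup_add_finrank_inf_eq (LinearMap.range D)
      (orbitTangent (slice lam z))
    rw [hinf, finrank_bot, add_zero, LinearMap.finrank_range_of_inj hinj] at h5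
    rw [h5, finrank_fibreTangent (glInf_slice_injective lam hz)]
    simp
    ring
  rw [← heq] at hξ
  obtain ⟨_, ⟨u, rfl⟩, η, hη, rfl⟩ := Submodule.mem_sup.1 hξ
  obtain ⟨a, rfl⟩ := mem_orbitTangent.1 hη
  exact ⟨u, a, rfl⟩

/-! ### The Lax pair -/

/-- The Hamiltonian vector field of `m⁻¹ tr Y^{mj}` on `Rep`. -/
def powField (j : ℕ) (q : Rep m n) : Rep m n :=
  ((j : ℂ) • blockX (bigY (rY q) ^ (m * j - 1)), 0, 0, 0)

theorem bigX_smul (c : ℂ) (a : Fin m → Matrix (Fin n) (Fin n) ℂ) :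
    bigX (c • a) = c • bigX a := by
  ext ⟨i, x⟩ ⟨j, y⟩
  by_cases h : i = j + 1 <;> simp [bigX_apply, h]

theorem bigX_powField {j : ℕ} (hj : 1 ≤ j) (q : Rep m n) :
    bigX (rX (powField j q)) = (j : ℂ) • bigY (rY q) ^ (m * j - 1) := by
  rw [powField, rX, bigX_smul, bigX_blockX_bigY_pow _ _ hj]

theorem sympForm_powField {j : ℕ} (hj : 1 ≤ j) (q ξ : Rep m n) :
    sympForm ξ (powField j q) = (j : ℂ) * (bigY (rY q) ^ (m * j - 1) * bigY (rY ξ)).trace := by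
  have h1 : sympForm ξ (powField j q)
      = (bigY (rY ξ) * bigX (rX (powField j q))).trace := by
    rw [bigY_mul_bigX, trace_blockD]
    simp [sympForm, powField, rX, rY, rv, rw]
  rw [h1, bigX_powField hj, mul_smul_comm, Matrix.trace_smul, Matrix.trace_mul_comm, smul_eq_mul]

theorem powField_mem_fibreTangent {j : ℕ} (hj : 1 ≤ j) (q : Rep m n) :
    powField j q ∈ fibreTangent q := by
  rw [mem_fibreTangent]
  apply blockD_injective
  have h : blockD (momentDeriv q (powField j q)) = bigY (rY q) * bigX (rX (powField j q))
      - bigX (rX (powField j q)) * bigY (rY q) := by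
    rw [bigY_mul_bigX, bigX_mul_bigY, blockD_sub]
    congr 1
    funext i
    rw [momentDeriv_apply]
    simp [powField, rX, rY, rv, rw, sub_eq_add_neg]
  rw [h, bigX_powField hj, mul_smul_comm, smul_mul_assoc, ← pow_succ, ← pow_succ', sub_self]
  ext ⟨i, x⟩ ⟨k, y⟩
  simp [blockD_apply]

/-- The `mn × mn` matrix `Y = ∑ Y_i`, as a linear function on `Rep`. -/
def bigYLin : Rep m n →ₗ[ℂ] Matrix (Fin m × Fin n) (Fin m × Fin n) ℂ where
  toFun q := bigY (rY q)
  map_add' a b := bigY_add (rY a) (rY b)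
  map_smul' c a := bigY_smul c (rY a)

/-- The `mn × mn` matrix `X = ∑ X_i`, as a linear function on `Rep`. -/
def bigXLin : Rep m n →ₗ[ℂ] Matrix (Fin m × Fin n) (Fin m × Fin n) ℂ where
  toFun q := bigX (rX q)
  map_add' a b := bigX_add (rX a) (rX b)
  map_smul' c a := bigX_smul c (rX a)

theorem differentiableAt_of_trace {lam : Fin m → ℂ} {j : ℕ} {f : Phase n → ℂ}
    (hf : ∀ z ∈ regDomain m n, (laxMatrix lam z ^ (m * j)).trace = (m : ℂ) * f z)
    {z : Phase n} (hz : z ∈ regDomain m n) :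
    DifferentiableAt ℂ f z := by
  have h1 : DifferentiableAt ℂ (fun z => (m : ℂ)⁻¹ * (laxMatrix lam z ^ (m * j)).trace) z := by
    refine DifferentiableAt.const_mul ?_ _
    exact differentiableAt_linear (Matrix.traceLinearMap (Fin m × Fin n) ℂ ℂ)
      (differentiableAt_matrix_pow (differentiableAt_linear bigYLin
        (differentiableAt_slice lam hz)) (m * j))
  refine h1.congr_of_eventuallyEq ?_
  filter_upwards [(isOpen_regDomain m n).mem_nhds hz] with y hy
  rw [hf y hy, inv_mul_cancel_left₀ (Nat.cast_ne_zero.2 (NeZero.ne m))]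

theorem fderiv_of_trace {lam : Fin m → ℂ} {j : ℕ} {f : Phase n → ℂ}
    (hf : ∀ z ∈ regDomain m n, (laxMatrix lam z ^ (m * j)).trace = (m : ℂ) * f z)
    (hj : 1 ≤ j) {z : Phase n} (hz : z ∈ regDomain m n) (u : Phase n) :
    fderiv ℂ f z u
      = sympForm (fderiv ℂ (slice (m := m) lam) z u) (powField j (slice lam z)) := by
  have h1 : HasDerivAt (fun s : ℂ => f (z + s • u)) (fderiv ℂ f z u) 0 := by
    have h1 : HasDerivAt (fun s : ℂ => z + s • u) u 0 := by
      simpa using ((hasDerivAt_id (0 : ℂ)).smul_const u).const_add z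
    have h2 : HasFDerivAt f (fderiv ℂ f z) (z + (0 : ℂ) • u) := by
      simpa using (differentiableAt_of_trace hf hz).hasFDerivAt
    exact h2.comp_hasDerivAt (0 : ℂ) h1
  refine h1.unique ?_
  have h2 := (hasDerivAt_trace_pow (hasDerivAt_linear bigYLin
    (hasDerivAt_slice_line lam hz u)) (m * j)).const_mul ((m : ℂ)⁻¹)
  have hm : (m : ℂ) ≠ 0 := Nat.cast_ne_zero.2 (NeZero.ne m)
  refine (h2.congr_of_eventuallyEq ?_).congr_deriv ?_
  · have hc : ContinuousAt (fun s : ℂ => z + s • u) 0 := by fun_prop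
    have : regDomain m n ∈ 𝓝 (z + (0 : ℂ) • u) := by
      rw [zero_smul, add_zero]; exact (isOpen_regDomain m n).mem_nhds hz
    filter_upwards [hc.preimage_mem_nhds this] with s hs
    have := hf _ hs
    change _ = (m : ℂ)⁻¹ * (laxMatrix lam (z + s • u) ^ (m * j)).trace
    rw [this, inv_mul_cancel_left₀ hm]
  · rw [sympForm_powField hj, zero_smul, add_zero]
    push_cast
    rw [← mul_assoc, ← mul_assoc, inv_mul_cancel₀ hm, one_mul]
    rfl

theorem fderiv_eq_sum (f : Phase n → ℂ) (z u : Phase n) :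
    fderiv ℂ f z u = ∑ i, (u.1 i * dX f i z + u.2 i * dP f i z) := by
  have h : u = ∑ i, (u.1 i • ((Pi.single i 1, 0) : Phase n) + u.2 i • (0, Pi.single i 1)) := by
    refine Prod.ext (funext fun k => ?_) (funext fun k => ?_)
    · simp [Prod.fst_sum, Finset.sum_apply, Pi.single_apply]
    · simp [Prod.snd_sum, Finset.sum_apply, Pi.single_apply]
  conv_lhs => rw [h]
  simp only [map_sum, map_add, map_smul, dX, dP, smul_eq_mul]

/-- The Lax pair: up to an infinitesimal gauge transformation, the Hamiltonian vector field of
`L_j` is the vector field `Ẋ = mj Y^{mj-1}` on `Rep`. -/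
theorem exists_lax_pair {lam : Fin m → ℂ} {j : ℕ} {f : Phase n → ℂ}
    (hf : ∀ z ∈ regDomain m n, (laxMatrix lam z ^ (m * j)).trace = (m : ℂ) * f z)
    (hj : 1 ≤ j) {z : Phase n} (hz : z ∈ regDomain m n) :
    ∃ a, (m : ℂ) • powField j (slice lam z)
      = fderiv ℂ (slice (m := m) lam) z (hamField f z) + glInf (slice lam z) a := by
  obtain ⟨w, a, h⟩ := exists_of_mem_fibreTangent_slice lam hz
    (powField_mem_fibreTangent hj (slice lam z))
  have key : ∀ u, fderiv ℂ f z u = (m : ℂ) * ∑ i, (u.2 i * w.1 i - w.2 i * u.1 i) := by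
    intro u
    have h1 := mem_fibreTangent_iff.1 (fderiv_slice_mem_fibreTangent lam hz u) a
    rw [← sympForm_fderiv_slice lam hz, fderiv_of_trace hf hj hz, h]
    rw [← sympBilin_apply, map_add, sympBilin_apply, sympBilin_apply, h1, add_zero]
  have hham : hamField f z = (m : ℂ) • w := by
    refine Prod.ext (funext fun i => ?_) (funext fun i => ?_)
    · simp [hamField, dP, key, Pi.single_apply]
    · simp [hamField, dX, key, Pi.single_apply]
  refine ⟨(m : ℂ) • a, ?_⟩
  rw [hham, map_smul, h, smul_add]
  congr 1
  exact ((glInfLin (slice lam z)).map_smul _ _).symm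

/-- The two components of the Lax pair that are used, in terms of the big matrices. -/
theorem exists_lax_pair_big {lam : Fin m → ℂ} {j : ℕ} {f : Phase n → ℂ}
    (hf : ∀ z ∈ regDomain m n, (laxMatrix lam z ^ (m * j)).trace = (m : ℂ) * f z)
    (hj : 1 ≤ j) {z : Phase n} (hz : z ∈ regDomain m n) :
    ∃ A, bigY (rY (fderiv ℂ (slice (m := m) lam) z (hamField f z)))
        = A * laxMatrix lam z - laxMatrix lam z * A ∧
      bigX (rX (fderiv ℂ (slice (m := m) lam) z (hamField f z)))
        = ((m : ℂ) * j) • laxMatrix lam z ^ (m * j - 1)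
          + (A * bigX (rX (slice lam z)) - bigX (rX (slice lam z)) * A) := by
  obtain ⟨a, h⟩ := exists_lax_pair hf hj hz
  refine ⟨-blockD a, ?_, ?_⟩
  · have h1 := congrArg bigYLin h
    rw [map_smul, map_add] at h1
    have h2 : bigYLin (powField j (slice lam z)) = 0 := by
      ext ⟨i, x⟩ ⟨k, y⟩; simp [bigYLin, powField, bigY_apply, rY]
    have h3 : bigYLin (glInf (slice lam z) a)
        = blockD a * laxMatrix lam z - laxMatrix lam z * blockD a := by
      rw [laxMatrix, blockD_mul_bigY, bigY_mul_blockD, ← bigY_sub]; rfl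
    rw [h2, h3, smul_zero] at h1
    change bigYLin _ = _
    rw [eq_neg_of_add_eq_zero_left h1.symm]
    noncomm_ring
  · have h1 := congrArg bigXLin h
    rw [map_smul, map_add] at h1
    have h2 : bigXLin (powField j (slice lam z)) = (j : ℂ) • laxMatrix lam z ^ (m * j - 1) :=
      bigX_powField hj _
    have h3 : bigXLin (glInf (slice lam z) a)
        = blockD a * bigX (rX (slice lam z)) - bigX (rX (slice lam z)) * blockD a := by
      rw [blockD_mul_bigX, bigX_mul_blockD, ← bigX_sub]; rfl
    rw [h2, h3, smul_smul] at h1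
    change bigXLin _ = _
    rw [h1]
    noncomm_ring

theorem bracket_eq_zero_of_trace {lam : Fin m → ℂ} {i j : ℕ} {f g : Phase n → ℂ}
    (hf : ∀ z ∈ regDomain m n, (laxMatrix lam z ^ (m * i)).trace = (m : ℂ) * f z)
    (hg : ∀ z ∈ regDomain m n, (laxMatrix lam z ^ (m * j)).trace = (m : ℂ) * g z)
    (hi : 1 ≤ i) (hj : 1 ≤ j) {z : Phase n} (hz : z ∈ regDomain m n) :
    bracket f g z = 0 := by
  have h1 : bracket f g z = fderiv ℂ f z (hamField g z) := by
    rw [fderiv_eq_sum]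
    exact Finset.sum_congr rfl fun k _ => by simp only [hamField]; ring
  obtain ⟨A, hA, -⟩ := exists_lax_pair_big hg hj hz
  rw [h1, fderiv_of_trace hf hi hz, sympForm_powField hi, hA]
  change (i : ℂ) * (laxMatrix lam z ^ (m * i - 1) * (A * laxMatrix lam z
    - laxMatrix lam z * A)).trace = 0
  rw [mul_sub, Matrix.trace_sub, ← mul_assoc, ← mul_assoc, ← pow_succ, Matrix.trace_mul_comm,
    ← mul_assoc, ← pow_succ', sub_self, mul_zero]

theorem hasDerivAt_slice_curve (lam : Fin m → ℂ) {γ : ℂ → Phase n} {w : Phase n} {t : ℂ}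
    (hz : γ t ∈ regDomain m n) (hγ : HasDerivAt γ w t) :
    HasDerivAt (fun s => slice (m := m) lam (γ s)) (fderiv ℂ (slice (m := m) lam) (γ t) w) t :=
  (differentiableAt_slice lam hz).hasFDerivAt.comp_hasDerivAt t hγ

/-- The Lax matrix deforms isospectrally. -/
theorem charpoly_laxMatrix_eq {lam : Fin m → ℂ} {j : ℕ} {f : Phase n → ℂ}
    (hf : ∀ z ∈ regDomain m n, (laxMatrix lam z ^ (m * j)).trace = (m : ℂ) * f z) (hj : 1 ≤ j)
    {U : Set ℂ} {γ : ℂ → Phase n} (hU : IsOpen U) (hU' : IsPreconnected U)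
    (hγ : IsHamiltonianCurve m f U γ) {s t : ℂ} (hs : s ∈ U) (ht : t ∈ U) :
    (laxMatrix lam (γ t)).charpoly = (laxMatrix lam (γ s)).charpoly := by
  apply Polynomial.funext
  intro x
  have hd : ∀ r ∈ U, HasDerivAt (fun r => (laxMatrix lam (γ r)).charpoly.eval x) 0 r := by
    intro r hr
    obtain ⟨A, hA, -⟩ := exists_lax_pair_big hf hj (hγ r hr).1
    have := hasDerivAt_linear bigYLin (hasDerivAt_slice_curve lam (hγ r hr).1 (hγ r hr).2)
    refine hasDerivAt_eval_charpoly (A := A) ?_ x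
    rw [← hA]
    exact this
  exact hU.is_const_of_deriv_eq_zero hU' (fun r hr => (hd r hr).differentiableAt.differentiableWithinAt)
    (fun r hr => (hd r hr).deriv) ht hs

/-! ### Independence of the Hamiltonians -/

/-- The derivative of the Lax matrix in the direction of a vector of momenta. -/
def momentumMatrix (m : ℕ) [NeZero m] (w : Fin n → ℂ) :
    Matrix (Fin m × Fin n) (Fin m × Fin n) ℂ :=
  bigY fun _ => Matrix.diagonal w

theorem laxMatrix_add (lam : Fin m → ℂ) (z : Phase n) (w : Fin n → ℂ) :
    laxMatrix lam (z + (0, w)) = laxMatrix lam z + momentumMatrix m w := by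
  rw [laxMatrix, laxMatrix, momentumMatrix, ← bigY_add]
  congr 1
  funext i; ext a b
  by_cases h : a = b
  · subst h
    simp [laxBlock_diag]; ring
  · simp [laxBlock_offdiag _ _ _ h, Matrix.diagonal_apply_ne _ h]

theorem momentumMatrix_smul (c : ℂ) (w : Fin n → ℂ) :
    momentumMatrix m (c • w) = c • momentumMatrix m w := by
  rw [momentumMatrix, momentumMatrix, ← bigY_smul]
  congr 1
  funext i
  exact Matrix.diagonal_smul c w

theorem momentumMatrix_pow_apply (w : Fin n → ℂ) (k : ℕ) (i l : Fin m) (a b : Fin n) :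
    (momentumMatrix m w ^ k) (i, a) (l, b)
      = if l = i + k • (1 : Fin m) ∧ a = b then w a ^ k else 0 := by
  induction k generalizing i a with
  | zero =>
    by_cases h : l = i
    · subst h; simp [Matrix.one_apply]
    · have : ¬ i = l := fun e => h e.symm
      simp [h, this]
  | succ k ih =>
    rw [pow_succ', momentumMatrix, bigY_mul_apply]
    rw [Finset.sum_eq_single a (fun c _ hc => by rw [Matrix.diagonal_apply_ne _ hc.symm, zero_mul])
      (by simp), Matrix.diagonal_apply_eq]
    rw [← momentumMatrix, ih, succ_nsmul', add_assoc]
    split_ifs <;> simp [pow_succ']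

theorem trace_momentumMatrix_pow_mul (w u : Fin n → ℂ) (j : ℕ) :
    (momentumMatrix m w ^ (m * (j + 1) - 1) * momentumMatrix m u).trace
      = m * ∑ a, w a ^ (m * (j + 1) - 1) * u a := by
  have hk : ∀ i : Fin m, i - 1 = i + (m * (j + 1) - 1) • (1 : Fin m) := by
    intro i
    have h1 : (m * (j + 1) - 1 + 1) • (1 : Fin m) = 0 := by
      rw [Nat.sub_add_cancel (Nat.mul_pos (NeZero.pos m) j.succ_pos), nsmul_one_eq_zero_iff]
      exact dvd_mul_right _ _
    rw [succ_nsmul] at h1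
    rw [eq_neg_of_add_eq_zero_left h1, sub_eq_add_neg]
  have h : ∀ (i : Fin m) (a : Fin n),
      (momentumMatrix m w ^ (m * (j + 1) - 1) * momentumMatrix m u) (i, a) (i, a)
        = w a ^ (m * (j + 1) - 1) * u a := by
    intro i a
    rw [show momentumMatrix m u = bigY fun _ => Matrix.diagonal u from rfl, mul_bigY_apply]
    rw [Finset.sum_eq_single a (fun c _ hc => by rw [Matrix.diagonal_apply_ne _ hc, mul_zero])
      (by simp), Matrix.diagonal_apply_eq, momentumMatrix_pow_apply]
    simp [← hk i]
  simp only [Matrix.trace, Matrix.diag_apply, Fintype.sum_prod_type, h]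
  simp

theorem fderiv_momentum {lam : Fin m → ℂ} {j : ℕ} {f : Phase n → ℂ}
    (hf : ∀ z ∈ regDomain m n, (laxMatrix lam z ^ (m * j)).trace = (m : ℂ) * f z)
    (hj : 1 ≤ j) {z : Phase n} (hz : z ∈ regDomain m n) (w : Fin n → ℂ) :
    fderiv ℂ f z (0, w) = j * (laxMatrix lam z ^ (m * j - 1) * momentumMatrix m w).trace := by
  rw [fderiv_of_trace hf hj hz, sympForm_powField hj]
  have h1 : bigY (rY (fderiv ℂ (slice (m := m) lam) z (0, w))) = momentumMatrix m w := by
    refine (hasDerivAt_linear bigYLin (hasDerivAt_slice_line lam hz (0, w))).unique ?_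
    have e : (fun s : ℂ => bigYLin (slice (m := m) lam (z + s • ((0, w) : Phase n))))
        = fun s => laxMatrix lam z + s • momentumMatrix m w := by
      funext s
      change laxMatrix lam (z + s • ((0, w) : Phase n)) = _
      rw [Prod.smul_mk, smul_zero, laxMatrix_add, momentumMatrix_smul]
    rw [e]
    have := ((hasDerivAt_id (0 : ℂ)).smul_const (momentumMatrix m w)).const_add (laxMatrix lam z)
    rw [one_smul] at this
    exact this
  rw [h1]
  rfl

/-- The matrix of derivatives of the traces of powers of `A` in the directions of the momenta. -/
def jacobiMatrix (A : Matrix (Fin m × Fin n) (Fin m × Fin n) ℂ) : Matrix (Fin n) (Fin n) ℂ :=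
  Matrix.of fun j k => (A ^ (m * ((j : ℕ) + 1) - 1) * momentumMatrix m (Pi.single k 1)).trace

theorem linearIndependent_fderiv {lam : Fin m → ℂ} {f : ℕ → Phase n → ℂ}
    (hf : ∀ j, 1 ≤ j → ∀ z ∈ regDomain m n,
      (laxMatrix lam z ^ (m * j)).trace = (m : ℂ) * f j z)
    {z : Phase n} (hz : z ∈ regDomain m n) (hd : (jacobiMatrix (laxMatrix lam z)).det ≠ 0) :
    LinearIndependent ℂ (fun j : Fin n => fderiv ℂ (f ((j : ℕ) + 1)) z) := by
  let e : (Phase n →L[ℂ] ℂ) →ₗ[ℂ] (Fin n → ℂ) :=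
    { toFun := fun l k => l (0, Pi.single k 1)
      map_add' := fun _ _ => rfl
      map_smul' := fun _ _ => rfl }
  refine LinearIndependent.of_comp e ?_
  have h : (e ∘ fun j : Fin n => fderiv ℂ (f ((j : ℕ) + 1)) z)
      = (Matrix.of fun (j k : Fin n) => (((j : ℕ) : ℂ) + 1) * jacobiMatrix (laxMatrix lam z) j k).row := by
    funext j k
    have := fderiv_momentum (hf _ (Nat.le_add_left 1 j)) (Nat.le_add_left 1 j) hz (Pi.single k 1)
    simp only [Function.comp, e, LinearMap.coe_mk, AddHom.coe_mk, this, jacobiMatrix]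
    simp
  rw [h]
  refine Matrix.linearIndependent_rows_of_det_ne_zero
    (A := Matrix.of fun (j k : Fin n) => (((j : ℕ) : ℂ) + 1) * jacobiMatrix (laxMatrix lam z) j k) ?_
  rw [Matrix.det_mul_column]
  refine mul_ne_zero (Finset.prod_ne_zero_iff.2 fun j _ => ?_) hd
  exact Nat.cast_add_one_ne_zero _

theorem jacobiMatrix_smul (c : ℂ) (A : Matrix (Fin m × Fin n) (Fin m × Fin n) ℂ) :
    (jacobiMatrix (c • A)).det
      = (∏ j : Fin n, c ^ (m * ((j : ℕ) + 1) - 1)) * (jacobiMatrix A).det := by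
  rw [← Matrix.det_mul_column]
  congr 1
  ext j k
  simp [jacobiMatrix, smul_pow]

theorem det_jacobiMatrix_momentumMatrix :
    (jacobiMatrix (momentumMatrix m fun k : Fin n => ((k : ℕ) : ℂ) + 1)).det ≠ 0 := by
  have h : jacobiMatrix (momentumMatrix m fun k : Fin n => ((k : ℕ) : ℂ) + 1)
      = Matrix.of fun (j k : Fin n) => ((m : ℂ) * (((k : ℕ) : ℂ) + 1) ^ (m - 1)) *
        (Matrix.vandermonde fun k : Fin n => (((k : ℕ) : ℂ) + 1) ^ m).transpose j k := by
    ext j k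
    rw [jacobiMatrix, Matrix.of_apply, trace_momentumMatrix_pow_mul]
    have hm := NeZero.pos m
    have e : m * ((j : ℕ) + 1) - 1 = (m - 1) + m * j := by
      rw [mul_add, mul_one]; omega
    simp only [Pi.single_apply, mul_ite, mul_one, mul_zero, Finset.sum_ite_eq', Finset.mem_univ,
      if_true, Matrix.of_apply, Matrix.transpose_apply, Matrix.vandermonde_apply, e, pow_add,
      pow_mul, mul_assoc]
  have hk : ∀ k : Fin n, ((k : ℕ) : ℂ) + 1 ≠ 0 := fun k => Nat.cast_add_one_ne_zero _
  rw [h, Matrix.det_mul_row, Matrix.det_transpose]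
  refine mul_ne_zero (Finset.prod_ne_zero_iff.2 fun k _ =>
    mul_ne_zero (Nat.cast_ne_zero.2 (NeZero.ne m)) (pow_ne_zero _ (hk k))) ?_
  rw [Matrix.det_vandermonde_ne_zero_iff]
  intro k l hkl
  have h2 : ((k : ℕ) + 1) ^ m = ((l : ℕ) + 1) ^ m := by
    dsimp only at hkl
    exact_mod_cast hkl
  have := Nat.pow_left_injective (NeZero.ne m) h2
  exact Fin.ext (Nat.succ_injective this)

theorem differentiable_det_jacobiMatrix (A B : Matrix (Fin m × Fin n) (Fin m × Fin n) ℂ) :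
    Differentiable ℂ fun s : ℂ => (jacobiMatrix (A + s • B)).det := by
  intro s
  have hlin : DifferentiableAt ℂ (fun s : ℂ => A + s • B) s :=
    (differentiableAt_id.smul_const B).const_add A
  have h : DifferentiableAt ℂ (fun s : ℂ => jacobiMatrix (A + s • B)) s := by
    refine differentiableAt_pi.2 fun j => differentiableAt_pi.2 fun k => ?_
    exact differentiableAt_linear (Matrix.traceLinearMap (Fin m × Fin n) ℂ ℂ)
      (differentiableAt_matrix_mul (differentiableAt_matrix_pow hlin _)
        (differentiableAt_const (momentumMatrix m (Pi.single k 1))))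
  exact (hasDerivAt_det h.hasDerivAt).differentiableAt

/-- The differentials are independent far away in a suitable direction of momenta, where the Lax
matrix is nearly diagonal, hence, by the identity theorem, at points arbitrarily near a given
one. -/
theorem regDomain_subset_closure {lam : Fin m → ℂ} {f : ℕ → Phase n → ℂ}
    (hf : ∀ j, 1 ≤ j → ∀ z ∈ regDomain m n,
      (laxMatrix lam z ^ (m * j)).trace = (m : ℂ) * f j z) :
    regDomain m n ⊆ closure {z | z ∈ regDomain m n ∧
      LinearIndependent ℂ (fun j : Fin n => fderiv ℂ (f ((j : ℕ) + 1)) z)} := by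
  intro z hz
  set w : Fin n → ℂ := fun k => ((k : ℕ) : ℂ) + 1 with hw
  set A := laxMatrix lam z
  set Q := momentumMatrix m w with hQ
  set g : ℂ → ℂ := fun s => (jacobiMatrix (A + s • Q)).det with hg
  have hgd : Differentiable ℂ g := differentiable_det_jacobiMatrix A Q
  have hlax : ∀ s : ℂ, laxMatrix lam (z + s • ((0, w) : Phase n)) = A + s • Q := fun s => by
    rw [Prod.smul_mk, smul_zero, laxMatrix_add, momentumMatrix_smul]
  obtain ⟨s₁, hs₁⟩ : ∃ s, g s ≠ 0 := by
    have hc : ContinuousAt (fun ε : ℂ => (jacobiMatrix (Q + ε • A)).det) 0 :=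
      (differentiable_det_jacobiMatrix Q A 0).continuousAt
    have h0 : (jacobiMatrix (Q + (0 : ℂ) • A)).det ≠ 0 := by
      rw [zero_smul, add_zero]; exact det_jacobiMatrix_momentumMatrix
    have hev : ∀ᶠ ε in 𝓝[≠] (0 : ℂ), (jacobiMatrix (Q + ε • A)).det ≠ 0 :=
      (hc.eventually_ne h0).filter_mono nhdsWithin_le_nhds
    obtain ⟨ε, hε, hε0⟩ := (hev.and self_mem_nhdsWithin).exists
    refine ⟨ε⁻¹, fun h => hε ?_⟩
    have e : Q + ε • A = ε • (A + ε⁻¹ • Q) := by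
      rw [smul_add, smul_smul, mul_inv_cancel₀ hε0, one_smul, add_comm]
    rw [e, jacobiMatrix_smul]
    change _ * g ε⁻¹ = 0
    rw [h, mul_zero]
  have hfreq : ∃ᶠ s in 𝓝[≠] (0 : ℂ), g s ≠ 0 := by
    intro hcon
    have hcon' : ∀ᶠ s in 𝓝[≠] (0 : ℂ), g s = 0 := by
      filter_upwards [hcon] with s hs
      exact not_not.1 hs
    have han : AnalyticOnNhd ℂ g Set.univ :=
      hgd.differentiableOn.analyticOnNhd isOpen_univ
    exact hs₁ (han.eqOn_zero_of_preconnected_of_frequently_eq_zero isPreconnected_univ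
      (Set.mem_univ 0) hcon'.frequently (Set.mem_univ s₁))
  have htend : Filter.Tendsto (fun s : ℂ => z + s • ((0, w) : Phase n)) (𝓝 0) (𝓝 z) := by
    have : Continuous fun s : ℂ => z + s • ((0, w) : Phase n) := by fun_prop
    simpa using this.tendsto 0
  refine mem_closure_iff_frequently.2 ?_
  refine htend.frequently ((hfreq.filter_mono nhdsWithin_le_nhds).mono fun s hs => ?_)
  have hreg : z + s • ((0, w) : Phase n) ∈ regDomain m n := by
    refine ⟨fun i => ?_, fun i j hij => ?_⟩
    · simpa using hz.1 i
    · simpa using hz.2 i j hij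
  refine ⟨hreg, linearIndependent_fderiv hf hreg ?_⟩
  rw [hlax]
  exact hs

/-! ### Regular parameters: graded subspaces without invariants vanish -/

/-- `∑_{i < r} λ_i`. -/
def partialLam (lam : Fin m → ℂ) (r : ℕ) : ℂ :=
  ∑ i ∈ Finset.univ.filter (fun i : Fin m => (i : ℕ) < r), lam i

theorem partialLam_sub (lam : Fin m → ℂ) {r s : ℕ} (h : r ≤ s) :
    partialLam lam s - partialLam lam r
      = ∑ i ∈ Finset.univ.filter (fun i : Fin m => r ≤ (i : ℕ) ∧ (i : ℕ) < s), lam i := by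
  rw [sub_eq_iff_eq_add', partialLam, partialLam, ← Finset.sum_union]
  · congr 1
    ext i
    simp only [Finset.mem_filter, Finset.mem_univ, true_and, Finset.mem_union]
    omega
  · rw [Finset.disjoint_filter]
    intro i _ h1 h2
    omega

theorem partialLam_zero (lam : Fin m → ℂ) : partialLam lam 0 = 0 := by simp [partialLam]

theorem partialLam_top (lam : Fin m → ℂ) : partialLam lam m = absLam lam := by
  simp [partialLam, absLam]

theorem partialLam_succ (lam : Fin m → ℂ) {r : ℕ} (hr : r < m) :
    partialLam lam (r + 1) = partialLam lam r + lam (r • (1 : Fin m)) := by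
  rw [← sub_eq_iff_eq_add', partialLam_sub lam (Nat.le_succ r), Finset.sum_eq_single (r • 1)]
  · intro i hi hne
    exfalso
    apply hne
    apply Fin.ext
    rw [val_nsmul_one, Nat.mod_eq_of_lt hr]
    simp only [Finset.mem_filter] at hi
    omega
  · intro h
    exfalso
    apply h
    simp [val_nsmul_one, Nat.mod_eq_of_lt hr]

/-- The potential of the cyclically extended sequence `λ`: its increment at `z` is `λ_{z mod m}`. -/
def potential (lam : Fin m → ℂ) (z : ℤ) : ℂ :=
  ((z / m : ℤ) : ℂ) * absLam lam + partialLam lam (z % m).toNat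

theorem exists_int_eq (m : ℕ) [NeZero m] (z : ℤ) :
    ∃ (q : ℤ) (r : ℕ), r < m ∧ z = r + m * q := by
  have hm : (0 : ℤ) < m := by exact_mod_cast NeZero.pos m
  refine ⟨z / m, (z % m).toNat, ?_, ?_⟩
  · have h1 := Int.emod_nonneg z hm.ne'
    have h2 := Int.emod_lt_of_pos z hm
    omega
  · rw [Int.toNat_of_nonneg (Int.emod_nonneg z hm.ne')]
    exact (Int.emod_add_mul_ediv z m).symm

theorem potential_apply (lam : Fin m → ℂ) {q : ℤ} {r : ℕ} (hr : r < m) :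
    potential lam (r + m * q) = q * absLam lam + partialLam lam r := by
  have hm : (m : ℤ) ≠ 0 := by exact_mod_cast NeZero.ne m
  have h1 : ((r : ℤ) + m * q) / m = q := by
    rw [Int.add_mul_ediv_left _ _ hm, Int.ediv_eq_zero_of_lt (by omega) (by omega), zero_add]
  have h2 : ((r : ℤ) + m * q) % m = r := by
    rw [Int.add_mul_emod_self_left, Int.emod_eq_of_lt (by omega) (by omega)]
  rw [potential, h1, h2, Int.toNat_natCast]

theorem add_mul_zsmul_one (q : ℤ) (r : ℕ) :
    ((r : ℤ) + m * q) • (1 : Fin m) = r • (1 : Fin m) := by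
  rw [add_zsmul, natCast_zsmul, mul_comm, mul_zsmul, natCast_zsmul, card_nsmul_one_fin, zsmul_zero,
    add_zero]

theorem potential_succ (lam : Fin m → ℂ) (z : ℤ) :
    potential lam (z + 1) = potential lam z + lam (z • (1 : Fin m)) := by
  obtain ⟨q, r, hr, rfl⟩ := exists_int_eq m z
  rw [potential_apply lam hr, add_mul_zsmul_one, add_assoc (_ * _), ← partialLam_succ lam hr]
  by_cases h : r + 1 < m
  · rw [show (r : ℤ) + m * q + 1 = ((r + 1 : ℕ) : ℤ) + m * q by push_cast; ring,
      potential_apply lam h]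
  · have hrm : r + 1 = m := by omega
    have : (r : ℤ) + m * q + 1 = ((0 : ℕ) : ℤ) + m * (q + 1) := by
      have : (r : ℤ) + 1 = m := by exact_mod_cast hrm
      push_cast
      linear_combination this
    rw [this, potential_apply lam (NeZero.pos m), hrm, partialLam_zero, partialLam_top]
    push_cast
    ring

/-- Regularity says exactly that the potential is injective. -/
theorem potential_injective {lam : Fin m → ℂ} (hlam : IsRegular lam) :
    Function.Injective (potential lam) := by
  have key : ∀ (k : ℤ) (r s : ℕ), r < s → s < m →
      partialLam lam s - partialLam lam r ≠ k * absLam lam := by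
    intro k r s hrs hs h
    rcases Nat.eq_zero_or_pos r with rfl | hr
    · rw [partialLam_zero, sub_zero] at h
      refine hlam.2 (1 - k) s m hrs hs le_rfl ?_
      rw [← partialLam_sub lam hs.le, partialLam_top, h]
      push_cast
      ring
    · refine hlam.2 k r s hr hrs hs.le ?_
      rw [← partialLam_sub lam hrs.le, h]
  intro z z' h
  obtain ⟨q, r, hr, rfl⟩ := exists_int_eq m z
  obtain ⟨q', r', hr', rfl⟩ := exists_int_eq m z'
  rw [potential_apply lam hr, potential_apply lam hr'] at h
  rcases lt_trichotomy r r' with hlt | rfl | hlt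
  · exact absurd (by push_cast; linear_combination -h) (key (q - q') r r' hlt hr')
  · have h1 : ((q : ℂ) - q') * absLam lam = 0 := by linear_combination h
    have h2 := (mul_eq_zero.1 h1).resolve_right hlam.1
    have h3 : q = q' := by exact_mod_cast sub_eq_zero.1 h2
    rw [h3]
  · exact absurd (by push_cast; linear_combination h) (key (q' - q) r' r hlt hr)

/-- Let `F_i ⊆ V` be subspaces with `X F_i ⊆ F_{i+1}`, such that `XY F_{i+1} ⊆ X F_i` and
`YX - XY = λ_i` on `F_i`.  If `λ` is regular, then `F = 0`: an eigenvalue of `XY` on `F_i` yields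
eigenvalues of `XY` on the neighbouring subspaces which differ by `λ_i`, except where an eigenvalue
vanishes.  By regularity this happens at most once, so one obtains an infinity of eigenvalues. -/
theorem graded_subspace_eq_bot {V : Type*} [AddCommGroup V] [Module ℂ V] [FiniteDimensional ℂ V]
    {lam : Fin m → ℂ} (hlam : IsRegular lam) (x y : Fin m → Module.End ℂ V)
    (F : Fin m → Submodule ℂ V) (hx : ∀ i, ∀ u ∈ F i, x i u ∈ F (i + 1))
    (h1 : ∀ i, ∀ u ∈ F (i + 1), ∃ u' ∈ F i, x i u' = x i (y i u))
    (h2 : ∀ i, ∀ u ∈ F (i + 1),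
      y (i + 1) (x (i + 1) u) - x i (y i u) = lam (i + 1) • u) (i : Fin m) : F i = ⊥ := by
  by_contra hF
  -- the eigenvalues of `XY` on `F i`
  let spec : Fin m → Set ℂ := fun i => {a | ∃ u ∈ F (i + 1), u ≠ 0 ∧ x i (y i u) = a • u}
  have hfin : ∀ i, (spec i).Finite := by
    intro i
    refine (Module.End.finite_hasEigenvalue (x i * y i)).subset ?_
    rintro a ⟨u, -, hu0, hu⟩
    exact Module.End.hasEigenvalue_of_hasEigenvector
      ⟨Module.End.mem_eigenspace_iff.2 hu, hu0⟩
  have hmem : ∀ i, ∀ u ∈ F (i + 1), x i (y i u) ∈ F (i + 1) := by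
    intro i u hu
    obtain ⟨u', hu', h⟩ := h1 i u hu
    rw [← h]
    exact hx i u' hu'
  have fwd : ∀ i a, a ∈ spec i → a + lam (i + 1) ≠ 0 → a + lam (i + 1) ∈ spec (i + 1) := by
    rintro i a ⟨u, hu, hu0, hxy⟩ hne
    have hyx : y (i + 1) (x (i + 1) u) = (a + lam (i + 1)) • u := by
      rw [add_smul, ← hxy, ← h2 i u hu]; abel
    refine ⟨x (i + 1) u, hx _ _ hu, fun h0 => ?_, ?_⟩
    · rw [h0, map_zero] at hyx
      exact (smul_ne_zero hne hu0) hyx.symm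
    · rw [hyx, map_smul]
  have bwd : ∀ i a, a + lam (i + 1) ∈ spec (i + 1) → a + lam (i + 1) ≠ 0 → a ∈ spec i := by
    rintro i a ⟨u, hu, hu0, hxy⟩ hne
    -- the preimage of the eigenvector is invariant under `XY`
    let S : Submodule ℂ V := F (i + 1) ⊓ (Submodule.span ℂ {u}).comap (x (i + 1))
    have hcomm : ∀ s ∈ F (i + 1), x (i + 1) (x i (y i s))
        = x (i + 1) (y (i + 1) (x (i + 1) s)) - lam (i + 1) • x (i + 1) s := by
      intro s hs
      rw [← map_smul, ← h2 i s hs, map_sub]; abel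
    have hSx : ∀ s ∈ S, x (i + 1) (x i (y i s)) = a • x (i + 1) s := by
      intro s hs
      obtain ⟨c, hc⟩ := Submodule.mem_span_singleton.1 hs.2
      rw [hcomm s hs.1, ← hc, map_smul, map_smul, hxy]
      module
    have hS : ∀ s ∈ S, (x i * y i - a • 1 : Module.End ℂ V) s ∈ S := by
      intro s hs
      refine ⟨Submodule.sub_mem (F (i + 1)) (hmem i s hs.1) (Submodule.smul_mem _ a hs.1), ?_⟩
      have : x (i + 1) ((x i * y i - a • 1 : Module.End ℂ V) s) = 0 := by
        change x (i + 1) (x i (y i s) - a • s) = 0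
        rw [map_sub, hSx s hs, map_smul, sub_self]
      change x (i + 1) _ ∈ Submodule.span ℂ {u}
      rw [this]
      exact Submodule.zero_mem _
    obtain ⟨u', hu', hxu'⟩ := h1 (i + 1) u hu
    rw [hxy] at hxu'
    have hu'S : u' ∈ S := ⟨hu', by
      change x (i + 1) u' ∈ Submodule.span ℂ {u}
      rw [hxu']; exact Submodule.smul_mem _ _ (Submodule.mem_span_singleton_self u)⟩
    by_contra hnot
    let T : Module.End ℂ S := (x i * y i - a • 1 : Module.End ℂ V).restrict hS
    have hTinj : Function.Injective T := by
      refine (injective_iff_map_eq_zero T).2 fun s hs => ?_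
      by_contra hs0
      apply hnot
      refine ⟨s, s.2.1, fun h => hs0 (Subtype.ext h), ?_⟩
      have := congrArg Subtype.val hs
      exact sub_eq_zero.1 this
    obtain ⟨s, hs⟩ := LinearMap.surjective_of_injective hTinj ⟨u', hu'S⟩
    have h3 : x i (y i s) - a • (s : V) = u' := congrArg Subtype.val hs
    have h4 : x (i + 1) u' = 0 := by
      rw [← h3, map_sub, hSx s s.2, map_smul, sub_self]
    rw [hxu'] at h4
    exact (smul_ne_zero hne hu0) h4
  -- a first eigenvalue
  obtain ⟨a, ha⟩ : ∃ a, a ∈ spec (i - 1) := by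
    have hF' : F (i - 1 + 1) ≠ ⊥ := by rwa [sub_add_cancel]
    have : Nontrivial (F (i - 1 + 1)) := Submodule.nontrivial_iff_ne_bot.2 hF'
    obtain ⟨a, ha⟩ := Module.End.exists_eigenvalue
      ((x (i - 1) * y (i - 1) : Module.End ℂ V).restrict (hmem (i - 1)))
    obtain ⟨u, hu⟩ := ha.exists_hasEigenvector
    refine ⟨a, u, u.2, fun h => hu.2 (Subtype.ext h), ?_⟩
    exact congrArg Subtype.val hu.apply_eq_smul
  obtain ⟨z₀, hz₀⟩ : ∃ z₀ : ℤ, z₀ • (1 : Fin m) = i := by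
    refine ⟨((i : ℕ) : ℤ), ?_⟩
    rw [natCast_zsmul]
    apply Fin.ext; rw [val_nsmul_one, Nat.mod_eq_of_lt i.2]
  let A : ℤ → ℂ := fun z => potential lam z + (a - potential lam z₀)
  have hAinj : Function.Injective A := fun z z' h => potential_injective hlam (add_right_cancel h)
  let P : ℤ → Prop := fun z => A z ∈ spec (z • (1 : Fin m) - 1)
  have hP₀ : P z₀ := by
    change potential lam z₀ + (a - potential lam z₀) ∈ spec (z₀ • 1 - 1)
    rw [hz₀, add_sub_cancel]
    exact ha
  have hA : ∀ z : ℤ, A (z + 1) = A z + lam (z • (1 : Fin m) - 1 + 1) := fun z => by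
    simp only [A, potential_succ, sub_add_cancel]; ring
  have hz : ∀ z : ℤ, (z + 1) • (1 : Fin m) - 1 = z • (1 : Fin m) - 1 + 1 := fun z => by
    rw [add_zsmul, one_zsmul]; abel
  have hfwd : ∀ z, P z → A (z + 1) ≠ 0 → P (z + 1) := by
    intro z hPz hne
    change A (z + 1) ∈ spec ((z + 1) • (1 : Fin m) - 1)
    rw [hz, hA]
    rw [hA] at hne
    exact fwd _ _ hPz hne
  have hbwd : ∀ z, P (z + 1) → A (z + 1) ≠ 0 → P z := by
    intro z hPz hne
    change A (z + 1) ∈ spec ((z + 1) • (1 : Fin m) - 1) at hPz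
    rw [hz, hA] at hPz
    rw [hA] at hne
    exact bwd _ _ hPz hne
  -- moving by `m` steps at a time returns to the same finite set of eigenvalues
  have hinf : ∀ σ : ℤ, σ ≠ 0 → (∀ t : ℕ, P (z₀ + σ * t)) → False := by
    intro σ hσ hall
    refine Set.infinite_of_injective_forall_mem (s := spec (z₀ • (1 : Fin m) - 1))
      (f := fun t : ℕ => A (z₀ + m * (σ * t))) ?_ ?_ (hfin _)
    · intro t t' htt
      have h3 := hAinj htt
      have hm : (m : ℤ) ≠ 0 := by exact_mod_cast NeZero.ne m
      have h4 := mul_left_cancel₀ hm (add_left_cancel h3)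
      exact_mod_cast mul_left_cancel₀ hσ h4
    · intro t
      have h3 := hall (m * t)
      have e : z₀ + σ * ((m * t : ℕ) : ℤ) = z₀ + m * (σ * t) := by push_cast; ring
      rw [e] at h3
      change A _ ∈ spec _ at h3
      have e2 : (z₀ + m * (σ * (t : ℤ))) • (1 : Fin m) = z₀ • (1 : Fin m) := by
        rw [add_zsmul, mul_comm (m : ℤ), mul_zsmul, natCast_zsmul, card_nsmul_one_fin, zsmul_zero,
          add_zero]
      rwa [e2] at h3
  -- the eigenvalues `A z` vanish at most once, so one of the two directions is unobstructed
  by_cases hex : ∃ z > z₀, A z = 0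
  · obtain ⟨z₁, hz₁, hz₁0⟩ := hex
    refine hinf (-1) (by norm_num) fun t => ?_
    induction t with
    | zero => simpa using hP₀
    | succ t ih =>
      have e : z₀ + -1 * (t : ℤ) = z₀ + -1 * ((t + 1 : ℕ) : ℤ) + 1 := by push_cast; ring
      rw [e] at ih
      refine hbwd _ ih fun h0 => ?_
      have := hAinj (h0.trans hz₁0.symm)
      push_cast at this
      omega
  · push Not at hex
    refine hinf 1 one_ne_zero fun t => ?_
    induction t with
    | zero => simpa using hP₀
    | succ t ih =>
      have e : z₀ + 1 * ((t + 1 : ℕ) : ℤ) = z₀ + 1 * (t : ℤ) + 1 := by push_cast; ring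
      rw [e]
      exact hfwd _ ih (hex _ (by omega))

/-! ### Freeness of the action, and the Hausdorff property of the quotient -/

/-- The moment map equation applied to a vector. -/
theorem moment_mulVec {lam : Fin m → ℂ} {q : Rep m n}
    (hq : ∀ i, momentMap q i = lam i • (1 : Matrix (Fin n) (Fin n) ℂ)) (i : Fin m)
    (u : Fin n → ℂ) :
    (rY q i).mulVec ((rX q i).mulVec u) - (rX q (i - 1)).mulVec ((rY q (i - 1)).mulVec u)
      = lam i • u + if i = 0 then dotProduct (rw q) u • rv q else 0 := by
  have h := congrArg (fun M => M.mulVec u) (hq i)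
  simp only [momentMap, Matrix.sub_mulVec, Matrix.smul_mulVec, Matrix.one_mulVec] at h
  rw [Matrix.mulVec_mulVec, Matrix.mulVec_mulVec, ← h]
  split_ifs
  · rw [Matrix.vecMulVec_mulVec]
    simp
  · simp

/-- A graded subspace invariant under `X` and `Y` and killed by `w` vanishes. -/
theorem invariant_subspace_eq_bot {lam : Fin m → ℂ} (hlam : IsRegular lam) {q : Rep m n}
    (hq : ∀ i, momentMap q i = lam i • (1 : Matrix (Fin n) (Fin n) ℂ))
    (F : Fin m → Submodule ℂ (Fin n → ℂ)) (hX : ∀ i, ∀ u ∈ F i, (rX q i).mulVec u ∈ F (i + 1))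
    (hY : ∀ i, ∀ u ∈ F (i + 1), (rY q i).mulVec u ∈ F i)
    (hw : ∀ u ∈ F 0, dotProduct (rw q) u = 0) (i : Fin m) : F i = ⊥ := by
  refine graded_subspace_eq_bot hlam (fun i => (rX q i).mulVecLin) (fun i => (rY q i).mulVecLin) F
    hX (fun i u hu => ⟨_, hY i u hu, rfl⟩) (fun i u hu => ?_) i
  have h := moment_mulVec hq (i + 1) u
  rw [add_sub_cancel_right] at h
  simp only [Matrix.mulVecLin_apply]
  rw [h]
  split_ifs with h0
  · rw [hw u (h0 ▸ hu), zero_smul, add_zero]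
  · rw [add_zero]

/-- An intertwiner into a point of the fibre, with image killed by `w`, vanishes. -/
theorem intertwiner_eq_zero {lam : Fin m → ℂ} (hlam : IsRegular lam) {q : Rep m n}
    (hq : ∀ i, momentMap q i = lam i • (1 : Matrix (Fin n) (Fin n) ℂ))
    {X' Y' a : Fin m → Matrix (Fin n) (Fin n) ℂ} (hX : ∀ i, rX q i * a i = a (i + 1) * X' i)
    (hY : ∀ i, rY q i * a (i + 1) = a i * Y' i) (hw : Matrix.vecMul (rw q) (a 0) = 0) :
    a = 0 := by
  have h := invariant_subspace_eq_bot hlam hq (fun i => LinearMap.range (a i).mulVecLin)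
    (by
      rintro i _ ⟨u, rfl⟩
      refine ⟨(X' i).mulVec u, ?_⟩
      simp only [Matrix.mulVecLin_apply, Matrix.mulVec_mulVec, hX])
    (by
      rintro i _ ⟨u, rfl⟩
      refine ⟨(Y' i).mulVec u, ?_⟩
      simp only [Matrix.mulVecLin_apply, Matrix.mulVec_mulVec, hY])
    (by
      rintro _ ⟨u, rfl⟩
      rw [Matrix.mulVecLin_apply, Matrix.dotProduct_mulVec, hw, zero_dotProduct])
  funext i
  have h2 : (a i).mulVecLin = 0 := LinearMap.range_eq_bot.1 (h i)
  ext b c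
  have := congrFun (congrArg (fun l => l (Pi.single c 1)) h2) b
  simpa using this

theorem glAct_eq_iff {g : Fin m → GL (Fin n) ℂ} {q q' : Rep m n} :
    glAct g q = q' ↔ (∀ i, (g (i + 1)).val * rX q i = rX q' i * (g i).val) ∧
      (∀ i, (g i).val * rY q i = rY q' i * (g (i + 1)).val) ∧
      (g 0).val.mulVec (rv q) = rv q' ∧ Matrix.vecMul (rw q') (g 0).val = rw q := by
  have h1 : ∀ i, (g i)⁻¹.val * (g i).val = 1 := fun i => by
    rw [← Units.val_mul, inv_mul_cancel, Units.val_one]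
  have h2 : ∀ i, (g i).val * (g i)⁻¹.val = 1 := fun i => by
    rw [← Units.val_mul, mul_inv_cancel, Units.val_one]
  constructor
  · rintro rfl
    refine ⟨fun i => ?_, fun i => ?_, rfl, ?_⟩
    · change _ = (g (i + 1)).val * rX q i * (g i)⁻¹.val * (g i).val
      rw [mul_assoc _ _ (g i).val, h1, mul_one]
    · change _ = (g i).val * rY q i * (g (i + 1))⁻¹.val * (g (i + 1)).val
      rw [mul_assoc _ _ (g (i + 1)).val, h1, mul_one]
    · change Matrix.vecMul (Matrix.vecMul (rw q) (g 0)⁻¹.val) (g 0).val = rw q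
      rw [Matrix.vecMul_vecMul, h1, Matrix.vecMul_one]
  · rintro ⟨hX, hY, hv, hw⟩
    refine Prod.ext (funext fun i => ?_) (Prod.ext (funext fun i => ?_) (Prod.ext hv ?_))
    · dsimp only [glAct]
      rw [hX, mul_assoc, h2, mul_one]
    · dsimp only [glAct]
      rw [hY, mul_assoc, h2, mul_one]
    · dsimp only [glAct]
      rw [← hw, Matrix.vecMul_vecMul, h2, Matrix.vecMul_one]

theorem eq_one_of_glAct_eq_self {lam : Fin m → ℂ} (hlam : IsRegular lam) {q : Rep m n}
    (hq : ∀ i, momentMap q i = lam i • (1 : Matrix (Fin n) (Fin n) ℂ))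
    {g : Fin m → GL (Fin n) ℂ} (hg : glAct g q = q) : g = 1 := by
  obtain ⟨hX, hY, -, hw⟩ := glAct_eq_iff.1 hg
  have h := intertwiner_eq_zero hlam hq (X' := rX q) (Y' := rY q) (a := fun i => (g i).val - 1)
    (fun i => by rw [mul_sub, sub_mul, hX, mul_one, one_mul])
    (fun i => by rw [mul_sub, sub_mul, hY, mul_one, one_mul])
    (by rw [Matrix.vecMul_sub, hw, Matrix.vecMul_one, sub_self])
  funext i
  exact Units.ext (sub_eq_zero.1 (congrFun h i))

theorem glInf_injective {lam : Fin m → ℂ} (hlam : IsRegular lam) {q : Rep m n}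
    (hq : ∀ i, momentMap q i = lam i • (1 : Matrix (Fin n) (Fin n) ℂ)) :
    Function.Injective (glInf q) := by
  refine (injective_iff_map_eq_zero (glInfLin q)).2 fun a ha => ?_
  refine intertwiner_eq_zero hlam hq (X' := rX q) (Y' := rY q) (fun i => ?_) (fun i => ?_) ?_
  · exact (sub_eq_zero.1 (congrFun (congrArg Prod.fst ha) i)).symm
  · exact (sub_eq_zero.1 (congrFun (congrArg (fun q => q.2.1) ha) i)).symm
  · exact neg_eq_zero.1 (congrArg (fun q => q.2.2.2) ha)

theorem momentMap_glAct (g : Fin m → GL (Fin n) ℂ) (q : Rep m n) (i : Fin m) :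
    momentMap (glAct g q) i = (g i).val * momentMap q i * (g i)⁻¹.val := by
  have h : ∀ i, (g i)⁻¹.val * (g i).val = 1 := fun i => by
    rw [← Units.val_mul, inv_mul_cancel, Units.val_one]
  have h' : ∀ (i) (M : Matrix (Fin n) (Fin n) ℂ), (g i)⁻¹.val * ((g i).val * M) = M := fun i M => by
    rw [← mul_assoc, h, one_mul]
  simp only [momentMap, glAct, rX, rY, rv, rw, sub_add_cancel, mul_sub, sub_mul, mul_assoc, h']
  congr 1
  by_cases h0 : i = 0
  · subst h0
    rw [if_pos rfl, if_pos rfl, Matrix.vecMulVec_mul, Matrix.mul_vecMulVec]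
  · rw [if_neg h0, if_neg h0, zero_mul, mul_zero]

/-- The action of `∏ GL(V_i)` on the fibre. -/
def fibreAct {lam : Fin m → ℂ} (g : Fin m → GL (Fin n) ℂ) (q : Fibre n lam) : Fibre n lam :=
  ⟨glAct g q.1, fun i => by
    rw [momentMap_glAct, q.2, mul_smul_comm, mul_one, smul_mul_assoc, ← Units.val_mul,
      mul_inv_cancel, Units.val_one]⟩

theorem continuous_fibreAct {lam : Fin m → ℂ} (g : Fin m → GL (Fin n) ℂ) :
    Continuous (fibreAct (lam := lam) g) := by
  have h : Continuous (glAct (n := n) g) := by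
    unfold glAct
    fun_prop
  exact (h.comp continuous_subtype_val).subtype_mk _

theorem toCM_eq_iff {lam : Fin m → ℂ} {q q' : Fibre n lam} :
    toCM q = toCM q' ↔ ∃ g, glAct g q.1 = q'.1 :=
  Quotient.eq (r := orbitSetoid n lam)

theorem isOpenQuotientMap_toCM {lam : Fin m → ℂ} :
    IsOpenQuotientMap (toCM : Fibre n lam → CMSpace n lam) where
  surjective := Quotient.mk_surjective
  continuous := continuous_quotient_mk'
  isOpenMap U hU := by
    have h : (toCM : Fibre n lam → CMSpace n lam) ⁻¹' (toCM '' U) = ⋃ g, fibreAct g ⁻¹' U := by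
      ext q
      simp only [Set.mem_preimage, Set.mem_image, Set.mem_iUnion]
      constructor
      · rintro ⟨q', hq', h⟩
        obtain ⟨g, hg⟩ := toCM_eq_iff.1 h.symm
        exact ⟨g, by rwa [show fibreAct g q = q' from Subtype.ext hg]⟩
      · rintro ⟨g, hg⟩
        exact ⟨_, hg, (toCM_eq_iff.2 ⟨g, rfl⟩).symm⟩
    exact isOpen_coinduced.2 (h ▸ isOpen_iUnion fun g => hU.preimage (continuous_fibreAct g))

/-- Two points of the fibre lie in one orbit if and only if there is a nonzero pair `(h, c)` as
below, and by homogeneity it may be normalised. -/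
theorem exists_glAct_iff {lam : Fin m → ℂ} (hlam : IsRegular lam) (q q' : Fibre n lam) :
    (∃ g, glAct g q.1 = q'.1) ↔
      ∃ p ∈ Metric.sphere (0 : (Fin m → Matrix (Fin n) (Fin n) ℂ) × ℂ) 1,
        (∀ i, p.1 (i + 1) * rX q.1 i = rX q'.1 i * p.1 i) ∧
        (∀ i, p.1 i * rY q.1 i = rY q'.1 i * p.1 (i + 1)) ∧
        (p.1 0).mulVec (rv q.1) = p.2 • rv q'.1 ∧
        Matrix.vecMul (rw q'.1) (p.1 0) = p.2 • rw q.1 := by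
  constructor
  · rintro ⟨g, hg⟩
    obtain ⟨hX, hY, hv, hw⟩ := glAct_eq_iff.1 hg
    set p₀ : (Fin m → Matrix (Fin n) (Fin n) ℂ) × ℂ := (fun i => (g i).val, 1)
    have hp₀ : ‖p₀‖ ≠ 0 := norm_ne_zero_iff.2 fun h => one_ne_zero (congrArg Prod.snd h)
    refine ⟨((‖p₀‖⁻¹ : ℝ) : ℂ) • p₀, ?_, fun i => ?_, fun i => ?_, ?_, ?_⟩
    · rw [mem_sphere_zero_iff_norm, norm_smul]
      simp [hp₀]
    · simp only [Prod.smul_fst, Pi.smul_apply, smul_mul_assoc, mul_smul_comm, p₀, hX]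
    · simp only [Prod.smul_fst, Pi.smul_apply, smul_mul_assoc, mul_smul_comm, p₀, hY]
    · simp only [Prod.smul_fst, Prod.smul_snd, Pi.smul_apply, Matrix.smul_mulVec, p₀, hv,
        smul_eq_mul, mul_one]
    · simp only [Prod.smul_fst, Prod.smul_snd, Pi.smul_apply, Matrix.vecMul_smul, p₀, hw,
        smul_eq_mul, mul_one]
  · rintro ⟨⟨h, c⟩, hp, hX, hY, hv, hw⟩
    dsimp only at hX hY hv hw
    by_cases hc : c = 0
    · exfalso
      have h0 := intertwiner_eq_zero hlam q'.2 (fun i => (hX i).symm) (fun i => (hY i).symm)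
        (by rw [hw, hc, zero_smul])
      rw [h0, hc] at hp
      simp at hp
    · have hker := invariant_subspace_eq_bot hlam q.2 (fun i => LinearMap.ker (h i).mulVecLin)
        (fun i u hu => by
          have hu' : (h i).mulVec u = 0 := hu
          change (h (i + 1)).mulVec _ = 0
          rw [Matrix.mulVec_mulVec, hX, ← Matrix.mulVec_mulVec, hu', Matrix.mulVec_zero])
        (fun i u hu => by
          have hu' : (h (i + 1)).mulVec u = 0 := hu
          change (h i).mulVec _ = 0
          rw [Matrix.mulVec_mulVec, hY, ← Matrix.mulVec_mulVec, hu', Matrix.mulVec_zero])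
        (fun u hu => by
          have hu' : (h 0).mulVec u = 0 := hu
          have h3 := congrArg (fun l => dotProduct l u) hw
          simp only [← Matrix.dotProduct_mulVec, hu', dotProduct_zero, smul_dotProduct] at h3
          exact (mul_eq_zero.1 h3.symm).resolve_left hc)
      have hunit : ∀ i, IsUnit (c⁻¹ • h i) := fun i => by
        have : IsUnit (h i) := Matrix.mulVec_injective_iff_isUnit.1 (LinearMap.ker_eq_bot.1 (hker i))
        obtain ⟨g, hg⟩ := this
        rw [← hg]
        exact (Units.mk0 c⁻¹ (inv_ne_zero hc) • g).isUnit
      choose g hg using hunit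
      refine ⟨g, glAct_eq_iff.2 ⟨fun i => ?_, fun i => ?_, ?_, ?_⟩⟩
      · rw [hg, hg, smul_mul_assoc, mul_smul_comm, hX]
      · rw [hg, hg, smul_mul_assoc, mul_smul_comm, hY]
      · rw [hg, Matrix.smul_mulVec, hv, smul_smul, inv_mul_cancel₀ hc, one_smul]
      · rw [hg, Matrix.vecMul_smul, hw, smul_smul, inv_mul_cancel₀ hc, one_smul]

theorem t2Space_cmSpace {lam : Fin m → ℂ} (hlam : IsRegular lam) : T2Space (CMSpace n lam) := by
  rw [t2Space_iff_of_isOpenQuotientMap isOpenQuotientMap_toCM]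
  let K := Metric.sphere (0 : (Fin m → Matrix (Fin n) (Fin n) ℂ) × ℂ) 1
  have : CompactSpace K := isCompact_iff_compactSpace.1 (isCompact_sphere _ _)
  let C : Set (K × (Fibre n lam × Fibre n lam)) := {p |
        (∀ i, p.1.1.1 (i + 1) * rX p.2.1.1 i = rX p.2.2.1 i * p.1.1.1 i) ∧
        (∀ i, p.1.1.1 i * rY p.2.1.1 i = rY p.2.2.1 i * p.1.1.1 (i + 1)) ∧
        (p.1.1.1 0).mulVec (rv p.2.1.1) = p.1.1.2 • rv p.2.2.1 ∧
        Matrix.vecMul (rw p.2.2.1) (p.1.1.1 0) = p.1.1.2 • rw p.2.1.1}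
  have hp : Continuous fun p : K × (Fibre n lam × Fibre n lam) => p.1.1 :=
    continuous_subtype_val.comp continuous_fst
  have hq : Continuous fun p : K × (Fibre n lam × Fibre n lam) => p.2.1.1 :=
    continuous_subtype_val.comp (continuous_fst.comp continuous_snd)
  have hq' : Continuous fun p : K × (Fibre n lam × Fibre n lam) => p.2.2.1 :=
    continuous_subtype_val.comp (continuous_snd.comp continuous_snd)
  have hC : IsClosed C := by
    simp only [C, Set.ofPred_and, Set.ofPred_forall]
    refine IsClosed.inter (isClosed_iInter fun i => isClosed_eq ?_ ?_)
      (IsClosed.inter (isClosed_iInter fun i => isClosed_eq ?_ ?_)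
      (IsClosed.inter (isClosed_eq ?_ ?_) (isClosed_eq ?_ ?_))) <;> fun_prop
  have himg : {q : Fibre n lam × Fibre n lam | toCM q.1 = toCM q.2} = Prod.snd '' C := by
    ext ⟨q, q'⟩
    rw [Set.mem_ofPred_eq, toCM_eq_iff, exists_glAct_iff hlam]
    constructor
    · rintro ⟨p, hp, h⟩
      exact ⟨(⟨p, hp⟩, (q, q')), h, rfl⟩
    · rintro ⟨⟨p, r⟩, h, rfl⟩
      exact ⟨p.1, p.2, h⟩
  rw [himg]
  exact isClosedMap_snd_of_compactSpace _ hC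

/-! ### The linear flows -/

/-- The invertible block diagonal matrix of a gauge transformation. -/
def blockUnit (g : Fin m → GL (Fin n) ℂ) : (Matrix (Fin m × Fin n) (Fin m × Fin n) ℂ)ˣ where
  val := blockD fun i => (g i).val
  inv := blockD fun i => (g i)⁻¹.val
  val_inv := by
    rw [blockD_mul, ← blockD_one]; congr 1; funext i
    rw [← Units.val_mul, mul_inv_cancel, Units.val_one]
  inv_val := by
    rw [blockD_mul, ← blockD_one]; congr 1; funext i
    rw [← Units.val_mul, inv_mul_cancel, Units.val_one]

theorem bigY_glAct (g : Fin m → GL (Fin n) ℂ) (q : Rep m n) :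
    bigY (rY (glAct g q)) = blockUnit g * bigY (rY q) * (blockUnit g)⁻¹.val := by
  change _ = blockD _ * bigY _ * blockD _
  rw [blockD_mul_bigY, bigY_mul_blockD]
  rfl

theorem bigX_glAct (g : Fin m → GL (Fin n) ℂ) (q : Rep m n) :
    bigX (rX (glAct g q)) = blockUnit g * bigX (rX q) * (blockUnit g)⁻¹.val := by
  change _ = blockD _ * bigX _ * blockD _
  rw [blockD_mul_bigX, bigX_mul_blockD]
  rfl

theorem bigY_glAct_pow (g : Fin m → GL (Fin n) ℂ) (q : Rep m n) (k : ℕ) :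
    bigY (rY (glAct g q)) ^ k = blockUnit g * bigY (rY q) ^ k * (blockUnit g)⁻¹.val := by
  rw [bigY_glAct, Units.conj_pow]

theorem trace_units_conj {ι : Type*} [Fintype ι] [DecidableEq ι] (u : (Matrix ι ι ℂ)ˣ)
    (M : Matrix ι ι ℂ) : (u * M * u⁻¹.val).trace = M.trace := by
  rw [Matrix.trace_mul_comm, ← mul_assoc, Units.inv_mul, one_mul]

theorem flowHam_glAct (lam : Fin m → ℂ) (j : ℕ+) (g : Fin m → GL (Fin n) ℂ) (q : Rep m n) :
    flowHam lam j (glAct g q) = flowHam lam j q := by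
  rw [flowHam, flowHam, bigY_glAct_pow, trace_units_conj]

theorem bigX_blockX_flowIncrement (lam : Fin m → ℂ) (t : ℕ+ →₀ ℂ) (q : Rep m n) :
    bigX (blockX (flowIncrement lam t q)) = flowIncrement lam t q := by
  ext ⟨i, x⟩ ⟨l, y⟩
  rw [bigX_apply]
  split_ifs with h
  · simp [blockX, h]
  · rw [flowIncrement, Finsupp.sum, Matrix.smul_apply, Matrix.sum_apply, Finset.sum_eq_zero,
      smul_zero]
    intro j _
    have h1 := congrFun (congrFun (bigX_blockX_bigY_pow (rY q) j j.pos) (i, x)) (l, y)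
    rw [bigX_apply, if_neg h] at h1
    rw [Matrix.smul_apply, ← h1, smul_zero]

theorem bigX_linearFlow (lam : Fin m → ℂ) (t : ℕ+ →₀ ℂ) (q : Rep m n) :
    bigX (rX (linearFlow lam t q)) = bigX (rX q) + flowIncrement lam t q := by
  rw [← bigX_blockX_flowIncrement, ← bigX_add]
  rfl

theorem commute_flowIncrement (lam : Fin m → ℂ) (t : ℕ+ →₀ ℂ) (q : Rep m n) :
    Commute (bigY (rY q)) (flowIncrement lam t q) := by
  refine Commute.smul_right (Commute.sum_right _ _ _ fun j _ => ?_) _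
  exact Commute.smul_right (Commute.pow_right (Commute.refl _) _) _

/-- The linear flows preserve the fibre, as the increment of `X` commutes with `Y`. -/
theorem momentMap_linearFlow {lam : Fin m → ℂ} (t : ℕ+ →₀ ℂ) {q : Rep m n}
    (hq : ∀ i, momentMap q i = lam i • (1 : Matrix (Fin n) (Fin n) ℂ)) (i : Fin m) :
    momentMap (linearFlow lam t q) i = lam i • (1 : Matrix (Fin n) (Fin n) ℂ) := by
  revert i
  rw [moment_iff] at hq ⊢
  rw [bigX_linearFlow]
  change bigY (rY q) * _ - _ * bigY (rY q) = _ + Matrix.vecMulVec (vec0 (rv q)) (vec0 (rw q))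
  rw [← hq, mul_add, add_mul, (commute_flowIncrement lam t q).eq]
  abel

theorem Rep.ext_big {q q' : Rep m n} (hX : bigX (rX q) = bigX (rX q')) (hY : rY q = rY q')
    (hv : rv q = rv q') (hw : rw q = rw q') : q = q' :=
  Prod.ext (bigX_injective hX) (Prod.ext hY (Prod.ext hv hw))

theorem linearFlow_glAct (lam : Fin m → ℂ) (t : ℕ+ →₀ ℂ) (g : Fin m → GL (Fin n) ℂ)
    (q : Rep m n) : linearFlow lam t (glAct g q) = glAct g (linearFlow lam t q) := by
  refine Rep.ext_big ?_ rfl rfl rfl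
  rw [bigX_linearFlow, bigX_glAct, bigX_glAct, bigX_linearFlow, mul_add, add_mul]
  congr 1
  simp only [flowIncrement, Finsupp.sum, bigY_glAct_pow, mul_smul_comm, smul_mul_assoc,
    Finset.mul_sum, Finset.sum_mul]

theorem linearFlow_zero (lam : Fin m → ℂ) (q : Rep m n) : linearFlow lam 0 q = q := by
  refine Rep.ext_big ?_ rfl rfl rfl
  rw [bigX_linearFlow, flowIncrement, Finsupp.sum_zero_index, smul_zero, add_zero]

theorem linearFlow_add (lam : Fin m → ℂ) (s t : ℕ+ →₀ ℂ) (q : Rep m n) :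
    linearFlow lam (s + t) q = linearFlow lam s (linearFlow lam t q) := by
  refine Rep.ext_big ?_ rfl rfl rfl
  have h : flowIncrement lam s (linearFlow lam t q) = flowIncrement lam s q := rfl
  rw [bigX_linearFlow, bigX_linearFlow, bigX_linearFlow, h, add_assoc]
  congr 1
  rw [flowIncrement, Finsupp.sum_add_index', smul_add, add_comm]
  · rfl
  · intro j; rw [mul_zero, zero_smul]
  · intro j a b; rw [mul_add, add_smul]

theorem linearFlow_single (lam : Fin m → ℂ) (j : ℕ+) (τ : ℂ) (q : Rep m n) :
    linearFlow lam (Finsupp.single j τ) q = q + τ • absLam lam • powField j q := by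
  refine Rep.ext_big ?_ ?_ ?_ ?_
  · rw [bigX_linearFlow]
    change _ = bigXLin (q + τ • absLam lam • powField j q)
    rw [map_add, map_smul, map_smul]
    have : bigXLin (powField j q) = ((j : ℕ) : ℂ) • bigY (rY q) ^ (m * (j : ℕ) - 1) :=
      bigX_powField j.pos q
    rw [this, flowIncrement, Finsupp.sum_single_index (by rw [mul_zero, zero_smul]), smul_comm τ,
      smul_smul τ, mul_comm τ]
    rfl
  · simp [linearFlow, powField, rY]
  · simp [linearFlow, powField, rv]
  · simp [linearFlow, powField, rw]

/-- `M ↦ blockX M` as a linear map. -/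
def blockXLin : Matrix (Fin m × Fin n) (Fin m × Fin n) ℂ →ₗ[ℂ]
    (Fin m → Matrix (Fin n) (Fin n) ℂ) where
  toFun := blockX
  map_add' _ _ := rfl
  map_smul' _ _ := rfl

theorem continuous_powField (j : ℕ) : Continuous (powField (m := m) (n := n) j) := by
  have h : Differentiable ℂ fun q : Rep m n => blockXLin (bigYLin q ^ (m * j - 1)) := fun q =>
    differentiableAt_linear blockXLin (differentiableAt_matrix_pow
      (differentiableAt_linear bigYLin differentiableAt_id) _)
  have h' : Continuous fun q : Rep m n => (j : ℂ) • blockX (bigY (rY q) ^ (m * j - 1)) :=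
    h.continuous.const_smul (j : ℂ)
  exact h'.prodMk continuous_const

theorem hasDerivAt_line {E : Type*} [NormedAddCommGroup E] [NormedSpace ℂ E] (q ξ : E) (t : ℂ) :
    HasDerivAt (fun s : ℂ => q + s • ξ) ξ t := by
  have h := ((hasDerivAt_id t).smul_const ξ).const_add q
  rw [one_smul] at h
  exact h

theorem hasDerivAt_linearFlow (lam : Fin m → ℂ) (j : ℕ+) (q : Rep m n) (τ : ℂ) :
    HasDerivAt (fun τ' => linearFlow lam (Finsupp.single j τ') q)
      (absLam lam • powField j (linearFlow lam (Finsupp.single j τ) q)) τ := by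
  have h : powField j (linearFlow lam (Finsupp.single j τ) q) = powField j q := rfl
  rw [h]
  simp only [linearFlow_single]
  exact hasDerivAt_line q _ τ

theorem differentiableAt_flowHam (lam : Fin m → ℂ) (j : ℕ+) (q : Rep m n) :
    DifferentiableAt ℂ (flowHam lam j) q := by
  have h := differentiableAt_linear (Matrix.traceLinearMap (Fin m × Fin n) ℂ ℂ)
    (differentiableAt_matrix_pow (differentiableAt_linear (bigYLin (m := m) (n := n))
      (differentiableAt_id (x := q))) (m * (j : ℕ)))
  exact h.const_mul (absLam lam / (m : ℂ))

theorem fderiv_flowHam (lam : Fin m → ℂ) (j : ℕ+) (q ξ : Rep m n) :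
    fderiv ℂ (flowHam lam j) q ξ = sympForm ξ (absLam lam • powField j q) := by
  have hline : HasDerivAt (fun s : ℂ => q + s • ξ) ξ 0 := hasDerivAt_line q ξ 0
  have h1 : HasDerivAt (fun s : ℂ => flowHam lam j (q + s • ξ)) (fderiv ℂ (flowHam lam j) q ξ)
      0 := by
    have h2 : HasFDerivAt (flowHam lam j) (fderiv ℂ (flowHam lam j) q) (q + (0 : ℂ) • ξ) := by
      simpa using (differentiableAt_flowHam lam j q).hasFDerivAt
    exact h2.comp_hasDerivAt (0 : ℂ) hline
  have h2 := (hasDerivAt_trace_pow (hasDerivAt_linear (bigYLin (m := m) (n := n)) hline)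
    (m * (j : ℕ))).const_mul (absLam lam / (m : ℂ))
  refine h1.unique (h2.congr_deriv ?_)
  have hm : (m : ℂ) ≠ 0 := Nat.cast_ne_zero.2 (NeZero.ne m)
  rw [← sympBilin_apply, map_smul, sympBilin_apply, sympForm_powField j.pos, zero_smul, add_zero,
    smul_eq_mul]
  push_cast
  field_simp
  rfl

/-- The linear flow on the fibre. -/
def fibreFlow {lam : Fin m → ℂ} (t : ℕ+ →₀ ℂ) (q : Fibre n lam) : Fibre n lam :=
  ⟨linearFlow lam t q.1, momentMap_linearFlow t q.2⟩

/-- The flow induced on the Calogero–Moser space. -/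
def cmFlow {lam : Fin m → ℂ} (t : ℕ+ →₀ ℂ) : CMSpace n lam → CMSpace n lam :=
  Quotient.map (fibreFlow t) (by
    rintro q q' ⟨g, hg⟩
    exact ⟨g, (linearFlow_glAct lam t g q.1).symm.trans (congrArg (linearFlow lam t) hg)⟩)

theorem cmFlow_toCM {lam : Fin m → ℂ} (t : ℕ+ →₀ ℂ) (q : Fibre n lam) :
    cmFlow t (toCM q) = toCM (fibreFlow t q) := rfl

theorem cmFlow_zero {lam : Fin m → ℂ} (x : CMSpace n lam) : cmFlow 0 x = x := by
  obtain ⟨q, rfl⟩ := isOpenQuotientMap_toCM.surjective x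
  rw [cmFlow_toCM]
  congr 1
  exact Subtype.ext (linearFlow_zero lam q.1)

theorem cmFlow_add {lam : Fin m → ℂ} (s t : ℕ+ →₀ ℂ) (x : CMSpace n lam) :
    cmFlow (s + t) x = cmFlow s (cmFlow t x) := by
  obtain ⟨q, rfl⟩ := isOpenQuotientMap_toCM.surjective x
  rw [cmFlow_toCM, cmFlow_toCM, cmFlow_toCM]
  congr 1
  exact Subtype.ext (linearFlow_add lam s t q.1)

theorem continuous_cmFlow {lam : Fin m → ℂ} (j : ℕ+) :
    Continuous fun y : ℂ × CMSpace n lam => cmFlow (Finsupp.single j y.1) y.2 := by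
  have hq := (IsOpenQuotientMap.id (X := ℂ)).prodMap
    (isOpenQuotientMap_toCM (n := n) (lam := lam))
  rw [hq.isQuotientMap.continuous_iff]
  have h : Continuous fun p : ℂ × Fibre n lam => fibreFlow (Finsupp.single j p.1) p.2 := by
    refine Continuous.subtype_mk ?_ _
    simp only [linearFlow_single]
    have h0 : Continuous fun p : ℂ × Fibre n lam => p.2.1 :=
      continuous_subtype_val.comp continuous_snd
    have h1 : Continuous fun p : ℂ × Fibre n lam => powField (j : ℕ) p.2.1 :=
      (continuous_powField j).comp h0
    exact h0.add (continuous_fst.smul (h1.const_smul (absLam lam)))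
  exact isOpenQuotientMap_toCM.continuous.comp h

/-! ### The slice separates the orbits of the wreath product -/

/-- Points of `G`-orbits go to one gauge orbit: `(a, σ) ∈ G` acts as the gauge transformation
`g_i = diag(a)^i σ`. -/
theorem exists_glAct_slice_smul (lam : Fin m → ℂ) (g : WreathG m n) (z : Phase n) :
    ∃ h, glAct h (slice lam z) = slice lam (g • z) := by
  have ha : ∀ j, rootVal (g.left j) ≠ 0 := fun j => rootVal_ne_zero _
  have ham : ∀ j, rootVal (g.left j) ^ m = 1 := fun j => rootVal_pow _
  have hpow : ∀ (i : Fin m) j,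
      rootVal (g.left j) ^ ((i + 1 : Fin m) : ℕ) = rootVal (g.left j) ^ ((i : ℕ) + 1) := by
    intro i j
    rw [Fin.val_add, Fin.val_one', Nat.add_mod_mod, ← Nat.mod_add_div ((i : ℕ) + 1) m, pow_add,
      pow_mul, ham, one_pow, mul_one, Nat.mod_add_div]
  let H : Fin m → Matrix (Fin n) (Fin n) ℂ := fun i => Matrix.of fun j k =>
    if k = g.right⁻¹ j then rootVal (g.left j) ^ (i : ℕ) else 0
  let H' : Fin m → Matrix (Fin n) (Fin n) ℂ := fun i => Matrix.of fun k j =>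
    if k = g.right⁻¹ j then (rootVal (g.left j) ^ (i : ℕ))⁻¹ else 0
  have hH : ∀ i (M : Matrix (Fin n) (Fin n) ℂ) j k,
      (H i * M) j k = rootVal (g.left j) ^ (i : ℕ) * M (g.right⁻¹ j) k := fun i M j k => by
    simp [H, Matrix.mul_apply]
  have hH2 : ∀ i (M : Matrix (Fin n) (Fin n) ℂ) j k,
      (M * H i) j k = M j (g.right k) * rootVal (g.left (g.right k)) ^ (i : ℕ) := fun i M j k => by
    have : ∀ l, k = g.right⁻¹ l ↔ l = g.right k := fun l => by
      rw [Equiv.Perm.eq_inv_iff_eq, eq_comm]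
    simp only [H, Matrix.mul_apply, Matrix.of_apply, this, mul_ite, mul_zero,
      Finset.sum_ite_eq', Finset.mem_univ, if_true]
  have hunit : ∀ i, H i * H' i = 1 := fun i => by
    ext j k
    rw [hH]
    by_cases h : j = k
    · subst h
      simp [H', ha]
    · have h' : ¬ g.right.symm j = g.right.symm k := fun e => h (g.right.symm.injective e)
      simp [H', h, h']
  let u : Fin m → GL (Fin n) ℂ := fun i => ⟨H i, H' i, hunit i, mul_eq_one_comm.1 (hunit i)⟩
  refine ⟨u, glAct_eq_iff.2 ⟨fun i => ?_, fun i => ?_, ?_, ?_⟩⟩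
  · change H (i + 1) * Matrix.diagonal z.1 = Matrix.diagonal (g • z).1 * H i
    ext j k
    rw [hH, Matrix.diagonal_mul, smul_fst, hpow]
    by_cases h : k = g.right⁻¹ j
    · subst h
      simp [H, pow_succ]
      ring
    · have h' : ¬ g.right⁻¹ j = k := fun e => h e.symm
      rw [Matrix.diagonal_apply_ne _ h']
      simp only [H, Matrix.of_apply, if_neg h, mul_zero]
  · change H i * laxBlock lam z i = laxBlock lam (g • z) i * H (i + 1)
    ext j k
    rw [hH, hH2, laxBlock_smul, hpow, show g.right⁻¹ (g.right k) = k from g.right.symm_apply_apply k, mul_assoc, ← mul_pow,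
      inv_mul_cancel₀ (ha _), one_pow, mul_one]
  · change (H 0).mulVec (fun _ => 1) = fun _ => 1
    funext j
    simp [H, Matrix.mulVec, dotProduct]
  · change Matrix.vecMul (fun _ => -absLam lam) (H 0) = fun _ => -absLam lam
    funext k
    have : ∀ l, k = g.right⁻¹ l ↔ l = g.right k := fun l => by
      rw [Equiv.Perm.eq_inv_iff_eq, eq_comm]
    simp only [H, Matrix.vecMul, dotProduct, Matrix.of_apply, Fin.val_zero, pow_zero, this]
    simp

theorem bigX_slice (lam : Fin m → ℂ) (z : Phase n) :
    bigX (rX (slice lam z)) = (momentumMatrix m z.1).transpose := by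
  ext ⟨i, x⟩ ⟨j, y⟩
  rw [Matrix.transpose_apply, momentumMatrix, bigY_apply, bigX_apply]
  change (if _ then Matrix.diagonal z.1 x y else 0) = _
  by_cases h : x = y
  · subst h; rfl
  · rw [Matrix.diagonal_apply_ne _ h, Matrix.diagonal_apply_ne' _ h]

theorem bigX_slice_pow_apply (lam : Fin m → ℂ) (z : Phase n) (k : ℕ) (i l : Fin m) (a b : Fin n) :
    (bigX (rX (slice lam z)) ^ k) (i, a) (l, b)
      = if i = l + k • (1 : Fin m) ∧ b = a then z.1 b ^ k else 0 := by
  rw [bigX_slice, ← Matrix.transpose_pow, Matrix.transpose_apply, momentumMatrix_pow_apply]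

theorem mul_nsmul_one (k : ℕ) : (m * k) • (1 : Fin m) = 0 := by
  rw [nsmul_one_eq_zero_iff]; exact dvd_mul_right m k

theorem trace_bigX_slice_pow (lam : Fin m → ℂ) (z : Phase n) (k : ℕ) :
    (bigX (rX (slice lam z)) ^ (m * k)).trace = m * ∑ a, (z.1 a ^ m) ^ k := by
  simp only [Matrix.trace, Matrix.diag_apply, Fintype.sum_prod_type, bigX_slice_pow_apply,
    mul_nsmul_one, add_zero, and_self, if_true]
  simp [pow_mul]

theorem trace_bigY_mul_bigX_slice_pow (lam : Fin m → ℂ) {z : Phase n} (hz : z ∈ regDomain m n)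
    (k : ℕ) :
    (bigY (rY (slice lam z)) * bigX (rX (slice lam z)) ^ (m * k + 1)).trace
      = m * (∑ a, z.1 a * z.2 a * (z.1 a ^ m) ^ k)
        + (∑ i, diagShift lam i) * ∑ a, (z.1 a ^ m) ^ k := by
  have h : ∀ (i : Fin m) (a : Fin n),
      (bigY (rY (slice lam z)) * bigX (rX (slice lam z)) ^ (m * k + 1)) (i, a) (i, a)
        = z.1 a * z.2 a * (z.1 a ^ m) ^ k + diagShift lam i * (z.1 a ^ m) ^ k := by
    intro i a
    have h0 := hz.1 a
    rw [bigY_mul_apply, Finset.sum_eq_single a]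
    · rw [bigX_slice_pow_apply, succ_nsmul, mul_nsmul_one, zero_add, if_pos ⟨rfl, rfl⟩]
      change laxBlock lam z i a a * _ = _
      rw [laxBlock_diag, pow_succ, pow_mul]
      field_simp
    · intro c _ hc
      rw [bigX_slice_pow_apply, if_neg (fun h => hc h.2.symm), mul_zero]
    · simp
  simp only [Matrix.trace, Matrix.diag_apply, Fintype.sum_prod_type, h, Finset.sum_add_distrib,
    ← Finset.mul_sum, ← Finset.sum_mul]
  simp

/-- Weighted power sums determine the nodes and the weights. -/
theorem exists_perm_of_power_sums {t t' w w' : Fin n → ℂ} (ht : Function.Injective t)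
    (ht' : Function.Injective t') (h1 : ∀ k : ℕ, ∑ a, t a ^ k = ∑ a, t' a ^ k)
    (h2 : ∀ k : ℕ, ∑ a, w a * t a ^ k = ∑ a, w' a * t' a ^ k) :
    ∃ σ : Equiv.Perm (Fin n), ∀ a, t' (σ a) = t a ∧ w' (σ a) = w a := by
  have hpoly : ∀ (v v' : Fin n → ℂ), (∀ k : ℕ, ∑ a, v a * t a ^ k = ∑ a, v' a * t' a ^ k) →
      ∀ p : Polynomial ℂ, ∑ a, v a * p.eval (t a) = ∑ a, v' a * p.eval (t' a) := by
    intro v v' hv p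
    induction p using Polynomial.induction_on' with
    | add p q hp hq => simp only [Polynomial.eval_add, mul_add, Finset.sum_add_distrib, hp, hq]
    | monomial k c =>
      simp only [Polynomial.eval_monomial, mul_left_comm _ c, ← Finset.mul_sum, hv]
  let p : Fin n → Polynomial ℂ := fun a =>
    ∏ s ∈ (Finset.univ.image t ∪ Finset.univ.image t').erase (t a), (Polynomial.X - Polynomial.C s)
  have hp0 : ∀ a, (p a).eval (t a) ≠ 0 := fun a => by
    rw [Polynomial.eval_prod, Finset.prod_ne_zero_iff]
    intro s hs
    rw [Polynomial.eval_sub, Polynomial.eval_X, Polynomial.eval_C]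
    exact sub_ne_zero.2 (Finset.ne_of_mem_erase hs).symm
  have hpz : ∀ a, ∀ s ∈ Finset.univ.image t ∪ Finset.univ.image t', s ≠ t a →
      (p a).eval s = 0 := by
    intro a s hs hne
    rw [Polynomial.eval_prod]
    exact Finset.prod_eq_zero (Finset.mem_erase.2 ⟨hne, hs⟩) (by simp)
  have hpt : ∀ a b, b ≠ a → (p a).eval (t b) = 0 := fun a b hb =>
    hpz a _ (Finset.mem_union_left _ (Finset.mem_image_of_mem _ (Finset.mem_univ _)))
      fun h => hb (ht h)
  have hpt' : ∀ a b, t' b ≠ t a → (p a).eval (t' b) = 0 := fun a b hb =>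
    hpz a _ (Finset.mem_union_right _ (Finset.mem_image_of_mem _ (Finset.mem_univ _))) hb
  have hsum : ∀ (v : Fin n → ℂ) a, ∑ b, v b * (p a).eval (t b) = v a * (p a).eval (t a) :=
    fun v a => Finset.sum_eq_single a (fun b _ hb => by rw [hpt a b hb, mul_zero]) (by simp)
  have hex : ∀ a, ∃ b, t' b = t a := by
    intro a
    by_contra hcon
    push Not at hcon
    have h := hpoly (fun _ => 1) (fun _ => 1) (by simpa using h1) (p a)
    rw [hsum, Finset.sum_eq_zero (fun b _ => by rw [hpt' a b (hcon b), mul_zero]), one_mul] at h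
    exact hp0 a h
  choose σ hσ using hex
  have hσinj : Function.Injective σ := fun a b hab => ht (by rw [← hσ, ← hσ, hab])
  refine ⟨Equiv.ofBijective σ (Finite.injective_iff_bijective.1 hσinj), fun a => ⟨hσ a, ?_⟩⟩
  have h := hpoly w w' h2 (p a)
  rw [hsum, Finset.sum_eq_single (σ a), hσ] at h
  · exact (mul_right_cancel₀ (hp0 a) h).symm
  · intro b _ hb
    rw [hpt' a b (fun h => hb (ht' (by rw [h, hσ]))), mul_zero]
  · simp

/-- The invariants `tr X^{mk}`, `tr Y X^{mk+1}` separate the `G`-orbits on `𝔥_reg × 𝔥*`. -/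
theorem exists_smul_eq_of_traces {lam : Fin m → ℂ} {z z' : Phase n} (hz : z ∈ regDomain m n)
    (hz' : z' ∈ regDomain m n)
    (h1 : ∀ k, (bigX (rX (slice lam z)) ^ k).trace = (bigX (rX (slice lam z')) ^ k).trace)
    (h2 : ∀ k, (bigY (rY (slice lam z)) * bigX (rX (slice lam z)) ^ k).trace
      = (bigY (rY (slice lam z')) * bigX (rX (slice lam z')) ^ k).trace) :
    ∃ g : WreathG m n, g • z = z' := by
  have hm : (m : ℂ) ≠ 0 := Nat.cast_ne_zero.2 (NeZero.ne m)
  have hinj : ∀ {z : Phase n}, z ∈ regDomain m n → Function.Injective fun a => z.1 a ^ m :=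
    fun hz a b hab => by
      by_contra hne
      exact hz.2 a b hne hab
  have e1 : ∀ k : ℕ, ∑ a, (z.1 a ^ m) ^ k = ∑ a, (z'.1 a ^ m) ^ k := fun k => by
    have := h1 (m * k)
    rw [trace_bigX_slice_pow, trace_bigX_slice_pow] at this
    exact mul_left_cancel₀ hm this
  have e2 : ∀ k : ℕ, ∑ a, z.1 a * z.2 a * (z.1 a ^ m) ^ k
      = ∑ a, z'.1 a * z'.2 a * (z'.1 a ^ m) ^ k := fun k => by
    have := h2 (m * k + 1)
    rw [trace_bigY_mul_bigX_slice_pow lam hz, trace_bigY_mul_bigX_slice_pow lam hz', e1] at this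
    exact mul_left_cancel₀ hm (add_right_cancel this)
  obtain ⟨σ, hσ⟩ := exists_perm_of_power_sums (hinj hz) (hinj hz') e1 e2
  have hq : ∀ i, z'.1 i / z.1 (σ⁻¹ i) ≠ 0 := fun i => div_ne_zero (hz'.1 i) (hz.1 _)
  have hroot : ∀ i, Units.mk0 _ (hq i) ∈ rootsOfUnity m ℂ := fun i => by
    rw [mem_rootsOfUnity]
    apply Units.ext
    have := (hσ (σ⁻¹ i)).1
    rw [show σ (σ⁻¹ i) = i from σ.apply_symm_apply i] at this
    rw [Units.val_pow_eq_pow_val, Units.val_mk0, div_pow, this, Units.val_one]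
    exact div_self (pow_ne_zero _ (hz.1 _))
  refine ⟨⟨fun i => ⟨_, hroot i⟩, σ⟩, Prod.ext (funext fun i => ?_) (funext fun i => ?_)⟩
  · rw [smul_fst]
    exact div_mul_cancel₀ _ (hz.1 _)
  · rw [smul_snd]
    have := (hσ (σ⁻¹ i)).2
    rw [show σ (σ⁻¹ i) = i from σ.apply_symm_apply i] at this
    change (z'.1 i / z.1 (σ⁻¹ i))⁻¹ * z.2 (σ⁻¹ i) = z'.2 i
    rw [inv_div, div_mul_eq_mul_div, ← this]
    exact mul_div_cancel_left₀ _ (hz'.1 i)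

/-! ### The map to the Calogero–Moser space -/

/-- The slice, as a map to the fibre of the moment map. -/
def slicePoint (lam : Fin m → ℂ) (z : regDomain m n) : Fibre n lam :=
  ⟨slice lam z.1, momentMap_slice lam z.2⟩

/-- The map `ι` from `𝔥_reg × 𝔥*` to the Calogero–Moser space induced by the slice. -/
def cmPoint (lam : Fin m → ℂ) (z : regDomain m n) : CMSpace n lam := toCM (slicePoint lam z)

theorem cmPoint_eq_iff {lam : Fin m → ℂ} {z z' : regDomain m n} :
    cmPoint lam z = cmPoint lam z' ↔ ∃ g : WreathG m n, g • z.1 = z'.1 := by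
  rw [cmPoint, cmPoint, toCM_eq_iff]
  constructor
  · rintro ⟨h, hh⟩
    change glAct h (slice lam z.1) = slice lam z'.1 at hh
    refine exists_smul_eq_of_traces z.2 z'.2 (lam := lam) (fun k => ?_) (fun k => ?_)
    · rw [← hh, bigX_glAct, Units.conj_pow, trace_units_conj]
    · rw [← hh, bigX_glAct, bigY_glAct, Units.conj_pow]
      rw [show ∀ A B : Matrix (Fin m × Fin n) (Fin m × Fin n) ℂ,
        (blockUnit h * A * (blockUnit h)⁻¹.val) * (blockUnit h * B * (blockUnit h)⁻¹.val)
          = blockUnit h * (A * B) * (blockUnit h)⁻¹.val from fun A B => by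
            simp only [mul_assoc, Units.inv_mul_cancel_left], trace_units_conj]
  · rintro ⟨g, hg⟩
    change ∃ h, glAct h (slice lam z.1) = slice lam z'.1
    rw [← hg]
    exact exists_glAct_slice_smul lam g z.1

theorem continuous_slicePoint (lam : Fin m → ℂ) :
    Continuous (slicePoint (n := n) lam) := by
  refine Continuous.subtype_mk (continuous_iff_continuousAt.2 fun z => ?_) _
  exact (differentiableAt_slice lam z.2).continuousAt.comp continuousAt_subtype_val

theorem continuous_cmPoint (lam : Fin m → ℂ) : Continuous (cmPoint (n := n) lam) :=
  isOpenQuotientMap_toCM.continuous.comp (continuous_slicePoint lam)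

/-- The momenta for which a point of the fibre with `X_i = diag ν` and `v = (1, …, 1)` lies on the
slice; they are read off from the row sums of the last block of `Y`. -/
def sliceMomenta (lam : Fin m → ℂ) (ν : Fin n → ℂ) (Y : Matrix (Fin n) (Fin n) ℂ) : Fin n → ℂ :=
  Y.mulVec (fun _ => 1) - (laxBlock lam (ν, 0) (-1)).mulVec fun _ => 1

theorem laxBlock_momenta (lam : Fin m → ℂ) (ν μ : Fin n → ℂ) (i : Fin m) :
    laxBlock lam (ν, μ) i = laxBlock lam (ν, 0) i + Matrix.diagonal μ := by
  ext a b
  by_cases h : a = b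
  · subst h
    simp [laxBlock_diag, add_comm]
  · simp [laxBlock_offdiag _ _ _ h, Matrix.diagonal_apply_ne _ h]

theorem sliceMomenta_laxBlock (lam : Fin m → ℂ) (z : Phase n) :
    sliceMomenta lam z.1 (laxBlock lam z (-1)) = z.2 := by
  rw [sliceMomenta, show z = (z.1, z.2) from rfl, laxBlock_momenta, Matrix.add_mulVec,
    add_sub_cancel_left]
  funext j
  rw [Matrix.mulVec_diagonal, mul_one]

/-- A point of the fibre with `X_i = diag ν`, `ν` regular, and `v = (1, …, 1)` lies on the
slice. -/
theorem eq_slice_of_diagonal {lam : Fin m → ℂ} {q : Rep m n}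
    (hq : ∀ i, momentMap q i = lam i • (1 : Matrix (Fin n) (Fin n) ℂ)) {ν : Fin n → ℂ}
    (hν : (ν, (0 : Fin n → ℂ)) ∈ regDomain m n) (hX : ∀ i, rX q i = Matrix.diagonal ν)
    (hv : rv q = fun _ => 1) :
    q = slice lam (ν, sliceMomenta lam ν (rY q (-1))) := by
  set z : Phase n := (ν, sliceMomenta lam ν (rY q (-1))) with hz
  have hzreg : z ∈ regDomain m n := hν
  have hw : rw q = fun _ => -absLam lam := by
    funext j
    have h : ∀ i, ν j * (rY q i j j - rY q (i - 1) j j) - (if i = 0 then rw q j else 0)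
        = lam i := fun i => by
      have := congrFun (congrFun (hq i) j) j
      simp only [momentMap, hX, hv, Matrix.sub_apply, Matrix.mul_diagonal, Matrix.diagonal_mul,
        Matrix.smul_apply, Matrix.one_apply_eq, smul_eq_mul, mul_one] at this
      rw [← this]
      by_cases h0 : i = 0
      · simp only [if_pos h0, Matrix.vecMulVec_apply]; ring
      · simp only [if_neg h0, Matrix.zero_apply]; ring
    have hs := Finset.sum_congr (rfl : (Finset.univ : Finset (Fin m)) = Finset.univ)
      (fun i _ => h i)
    rw [Finset.sum_sub_distrib, ← Finset.mul_sum, Finset.sum_sub_distrib,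
      show ∑ i, rY q (i - 1) j j = ∑ i, rY q i j j from
        Equiv.sum_comp (Equiv.subRight (1 : Fin m)) (fun i => rY q i j j)] at hs
    simp only [sub_self, mul_zero, Finset.sum_ite_eq', Finset.mem_univ, if_true, zero_sub] at hs
    rw [absLam, ← hs, neg_neg]
  have hdiff := slice_rigid (u := 0) hzreg
    (a := fun i => rY q (i - 1) - laxBlock lam z (i - 1)) (fun i => by
      have h1 := (hq i).trans (momentMap_slice lam hzreg i).symm
      simp only [momentMap, hX, hv, hw] at h1
      have h2 := sub_left_injective h1
      change _ = laxBlock lam z i * Matrix.diagonal ν - Matrix.diagonal ν * laxBlock lam z (i - 1)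
        at h2
      change (rY q (i + 1 - 1) - laxBlock lam z (i + 1 - 1)) * Matrix.diagonal ν
        - Matrix.diagonal ν * (rY q (i - 1) - laxBlock lam z (i - 1)) = Matrix.diagonal 0
      rw [add_sub_cancel_right, show Matrix.diagonal (0 : Fin n → ℂ) = 0 from Matrix.diagonal_zero,
        sub_mul, mul_sub]
      rw [← sub_eq_zero] at h2
      rw [← h2]
      abel) (by
      rw [zero_sub, Matrix.sub_mulVec, hz, laxBlock_momenta, Matrix.add_mulVec]
      funext j
      simp only [Pi.sub_apply, Pi.add_apply, Matrix.mulVec_diagonal, mul_one, Pi.zero_apply,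
        sliceMomenta]
      ring)
  have hY : rY q = laxBlock lam z := by
    funext i
    have := congrFun hdiff.1 (i + 1)
    simp only [add_sub_cancel_right] at this
    exact sub_eq_zero.1 this
  exact Prod.ext (funext hX) (Prod.ext hY (Prod.ext hv hw))

/-! ### The map to the Calogero–Moser space is open -/

/-- Pairs `(X, v)`, and likewise pairs `(g, ν)`. -/
abbrev GaugeSpace (m n : ℕ) : Type := (Fin m → Matrix (Fin n) (Fin n) ℂ) × (Fin n → ℂ)

/-- The bilinear form underlying `((X, v), (g, ν)) ↦ X_i g_i - g_{i+1} diag ν`. -/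
def gaugeBilin : (GaugeSpace m n × GaugeSpace m n) →ₗ[ℂ] (GaugeSpace m n × GaugeSpace m n) →ₗ[ℂ]
    GaugeSpace m n :=
  LinearMap.mk₂ ℂ (fun p p' =>
      (fun i => p.1.1 i * p'.2.1 i - p.2.1 (i + 1) * Matrix.diagonal p'.2.2, 0))
    (by
      intro a b c
      refine Prod.ext (funext fun i => ?_) (by simp)
      simp [add_mul]; abel)
    (by
      intro a b c
      refine Prod.ext (funext fun i => ?_) (by simp)
      simp [smul_sub])
    (by
      intro a b c
      refine Prod.ext (funext fun i => ?_) (by simp)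
      change a.1.1 i * (b.2.1 i + c.2.1 i) - a.2.1 (i + 1) * Matrix.diagonal (fun k =>
        b.2.2 k + c.2.2 k) = (a.1.1 i * b.2.1 i - a.2.1 (i + 1) * Matrix.diagonal b.2.2)
          + (a.1.1 i * c.2.1 i - a.2.1 (i + 1) * Matrix.diagonal c.2.2)
      rw [← Matrix.diagonal_add]
      noncomm_ring)
    (by
      intro a b c
      refine Prod.ext (funext fun i => ?_) (by simp)
      have : Matrix.diagonal (a • c.2.2) = a • Matrix.diagonal c.2.2 := Matrix.diagonal_smul _ _
      simp [this, smul_sub])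

/-- The linear map `((X, v), (g, ν)) ↦ g_0 (1, …, 1) - v`. -/
def gaugeLin : (GaugeSpace m n × GaugeSpace m n) →ₗ[ℂ] GaugeSpace m n where
  toFun p := (0, (p.2.1 0).mulVec (fun _ => 1) - p.1.2)
  map_add' a b := by
    refine Prod.ext (by simp) ?_
    simp [Matrix.add_mulVec]; abel
  map_smul' c a := by
    refine Prod.ext (by simp) ?_
    simp [Matrix.smul_mulVec, smul_sub]

/-- The equations `X_i g_i = g_{i+1} diag ν`, `g_0 (1, …, 1) = v` for a gauge transformation `g`
diagonalising `X` and normalising `v`. -/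
def gaugeEq (p : GaugeSpace m n × GaugeSpace m n) : GaugeSpace m n :=
  gaugeBilin p p + gaugeLin p

theorem gaugeEq_apply (p : GaugeSpace m n × GaugeSpace m n) :
    gaugeEq p = (fun i => p.1.1 i * p.2.1 i - p.2.1 (i + 1) * Matrix.diagonal p.2.2,
      (p.2.1 0).mulVec (fun _ => 1) - p.1.2) := by
  refine Prod.ext ?_ ?_
  · exact add_zero _
  · exact zero_add _

theorem hasStrictFDerivAt_gaugeEq (p : GaugeSpace m n × GaugeSpace m n) :
    HasStrictFDerivAt gaugeEq
      (LinearMap.toContinuousLinearMap (gaugeBilin p + gaugeBilin.flip p)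
        + LinearMap.toContinuousLinearMap gaugeLin) p :=
  (hasStrictFDerivAt_quadratic gaugeBilin p).add
    (LinearMap.toContinuousLinearMap gaugeLin).hasStrictFDerivAt

/-- By the implicit function theorem, near a point of the slice `X` can be diagonalised and `v`
normalised by a gauge transformation near the identity. -/
theorem exists_local_gauge {z : Phase n} (hz : z ∈ regDomain m n) :
    ∃ φ : GaugeSpace m n → GaugeSpace m n,
      Filter.Tendsto φ (𝓝 (fun _ => Matrix.diagonal z.1, fun _ => 1)) (𝓝 (fun _ => 1, z.1)) ∧
      ∀ᶠ p in 𝓝 ((fun _ => Matrix.diagonal z.1, fun _ => 1) : GaugeSpace m n),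
        (∀ i, p.1 i * (φ p).1 i = (φ p).1 (i + 1) * Matrix.diagonal (φ p).2) ∧
        ((φ p).1 0).mulVec (fun _ => 1) = p.2 := by
  set p₀ : GaugeSpace m n × GaugeSpace m n :=
    ((fun _ => Matrix.diagonal z.1, fun _ => 1), (fun _ => 1, z.1)) with hp₀
  have hd := hasStrictFDerivAt_gaugeEq p₀
  set f' := LinearMap.toContinuousLinearMap (gaugeBilin p₀ + gaugeBilin.flip p₀)
        + LinearMap.toContinuousLinearMap gaugeLin with hf'
  have hpart : ∀ x : GaugeSpace m n, (f' ∘L .inr ℂ _ _) x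
      = (fun i => Matrix.diagonal z.1 * x.1 i - Matrix.diagonal x.2
          - x.1 (i + 1) * Matrix.diagonal z.1, (x.1 0).mulVec fun _ => 1) := by
    intro x
    have h1 : (f' ∘L .inr ℂ _ _) x
        = gaugeBilin p₀ (0, x) + gaugeBilin (0, x) p₀ + gaugeLin (0, x) := rfl
    rw [h1]
    refine Prod.ext (funext fun i => ?_) ?_
    · simp [gaugeBilin, gaugeLin, hp₀]
      abel
    · simp [gaugeBilin, gaugeLin]
  have hinj : Function.Injective (f' ∘L .inr ℂ (GaugeSpace m n) (GaugeSpace m n)) := by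
    refine (injective_iff_map_eq_zero _).2 fun x hx => ?_
    rw [hpart] at hx
    have hv := congrArg Prod.snd hx
    have hX : ∀ i, x.1 (i + 1) * Matrix.diagonal z.1 - Matrix.diagonal z.1 * x.1 i
        = Matrix.diagonal (-x.2) := fun i => by
      have := congrFun (congrArg Prod.fst hx) i
      simp only [Prod.fst_zero, Pi.zero_apply] at this
      rw [show Matrix.diagonal (-x.2) = -Matrix.diagonal x.2 from (Matrix.diagonal_neg _).symm,
        ← sub_eq_zero, ← neg_eq_zero, ← this]
      abel
    obtain ⟨h1, h2⟩ := slice_rigid hz hX hv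
    exact Prod.ext h1 (neg_eq_zero.1 h2)
  have hinv : (f' ∘L .inr ℂ (GaugeSpace m n) (GaugeSpace m n)).IsInvertible := by
    refine ⟨(LinearEquiv.ofInjectiveEndo
      (f' ∘L .inr ℂ (GaugeSpace m n) (GaugeSpace m n)).toLinearMap hinj).toContinuousLinearEquiv, ?_⟩
    rfl
  refine ⟨hd.implicitFunctionOfProdDomain hinv, hd.tendsto_implicitFunctionOfProdDomain hinv, ?_⟩
  have h0 : gaugeEq p₀ = 0 := by
    rw [gaugeEq_apply]
    refine Prod.ext (funext fun i => ?_) ?_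
    · simp [hp₀]
    · simp [hp₀]
  filter_upwards [hd.eventually_apply_implicitFunctionOfProdDomain hinv] with p hp
  rw [h0, gaugeEq_apply] at hp
  exact ⟨fun i => sub_eq_zero.1 (congrFun (congrArg Prod.fst hp) i),
    sub_eq_zero.1 (congrArg Prod.snd hp)⟩

theorem continuousAt_matrix_inv {A : Matrix (Fin n) (Fin n) ℂ} (h : A.det ≠ 0) :
    ContinuousAt (fun A : Matrix (Fin n) (Fin n) ℂ => A⁻¹) A := by
  have : (fun A : Matrix (Fin n) (Fin n) ℂ => A⁻¹) = fun A => (A.det)⁻¹ • A.adjugate := by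
    funext A
    rw [Matrix.inv_def, Ring.inverse_eq_inv']
  rw [this]
  have h1 : Continuous fun A : Matrix (Fin n) (Fin n) ℂ => A.det := by fun_prop
  have h2 : Continuous fun A : Matrix (Fin n) (Fin n) ℂ => A.adjugate := by fun_prop
  exact (h1.continuousAt.inv₀ h).smul h2.continuousAt

/-- A point of the fibre for which `X` is diagonalised and `v` normalised by a gauge transformation
`g` is gauge equivalent to an explicit point of the slice. -/
theorem toCM_eq_of_gauge {lam : Fin m → ℂ} (q : Fibre n lam)
    {g : Fin m → Matrix (Fin n) (Fin n) ℂ} {ν : Fin n → ℂ} (hg : ∀ i, (g i).det ≠ 0)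
    (hX : ∀ i, rX q.1 i * g i = g (i + 1) * Matrix.diagonal ν)
    (hv : (g 0).mulVec (fun _ => 1) = rv q.1)
    (hν : (ν, (0 : Fin n → ℂ)) ∈ regDomain m n)
    (hz : (ν, sliceMomenta lam ν ((g (-1))⁻¹ * rY q.1 (-1) * g 0)) ∈ regDomain m n) :
    toCM q = cmPoint lam ⟨_, hz⟩ := by
  let u : Fin m → GL (Fin n) ℂ := fun i => Matrix.GeneralLinearGroup.mkOfDetNeZero (g i) (hg i)
  have hu : ∀ i, (u i).val = g i := fun i => rfl
  have hui : ∀ i, (u i)⁻¹.val = (g i)⁻¹ := fun i => by rw [Matrix.coe_units_inv, hu]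
  have hinv : ∀ i, (g i)⁻¹ * g i = 1 := fun i =>
    Matrix.nonsing_inv_mul _ (isUnit_iff_ne_zero.2 (hg i))
  set q' := fibreAct (u⁻¹) q with hq'
  have e : toCM q = toCM q' := toCM_eq_iff.2 ⟨u⁻¹, rfl⟩
  have hinv' : ∀ i, ((u i)⁻¹)⁻¹.val = g i := fun i => by rw [inv_inv, hu]
  have hX' : ∀ i, rX q'.1 i = Matrix.diagonal ν := fun i => by
    change (u (i + 1))⁻¹.val * rX q.1 i * ((u i)⁻¹)⁻¹.val = _
    rw [hui, hinv', mul_assoc, hX, ← mul_assoc, hinv, one_mul]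
  have hY' : rY q'.1 (-1) = (g (-1))⁻¹ * rY q.1 (-1) * g 0 := by
    change (u (-1))⁻¹.val * rY q.1 (-1) * ((u (-1 + 1))⁻¹)⁻¹.val = _
    rw [hui, hinv', neg_add_cancel]
  have hv' : rv q'.1 = fun _ => 1 := by
    change (u 0)⁻¹.val.mulVec (rv q.1) = _
    rw [hui, ← hv, Matrix.mulVec_mulVec, hinv, Matrix.one_mulVec]
  have h := eq_slice_of_diagonal q'.2 hν hX' hv'
  rw [hY'] at h
  rw [e]
  exact congrArg toCM (Subtype.ext h)

theorem isOpenMap_cmPoint (lam : Fin m → ℂ) : IsOpenMap (cmPoint (n := n) lam) := by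
  rw [isOpenMap_iff_nhds_le]
  intro z N hN
  obtain ⟨φ, hφ, hev⟩ := exists_local_gauge z.2
  set p₀ : GaugeSpace m n := (fun _ => Matrix.diagonal z.1.1, fun _ => 1) with hp₀
  set q₀ := slicePoint lam z with hq₀
  have hp : Filter.Tendsto (fun q : Fibre n lam => ((rX q.1, rv q.1) : GaugeSpace m n)) (𝓝 q₀)
      (𝓝 p₀) := by
    have hc : Continuous fun q : Fibre n lam => ((rX q.1, rv q.1) : GaugeSpace m n) := by
      have h0 : Continuous fun q : Fibre n lam => q.1 := continuous_subtype_val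
      fun_prop
    exact hc.tendsto q₀
  have hψ := hφ.comp hp
  have hg : ∀ i, Filter.Tendsto (fun q : Fibre n lam => (φ (rX q.1, rv q.1)).1 i) (𝓝 q₀)
      (𝓝 (1 : Matrix (Fin n) (Fin n) ℂ)) := fun i =>
    (((continuous_apply i).comp continuous_fst).tendsto
      (((fun _ => 1, z.1.1) : GaugeSpace m n))).comp hψ
  have hν : Filter.Tendsto (fun q : Fibre n lam => (φ (rX q.1, rv q.1)).2) (𝓝 q₀) (𝓝 z.1.1) :=
    (continuous_snd.tendsto (((fun _ => 1, z.1.1) : GaugeSpace m n))).comp hψ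
  have hdet : ∀ᶠ q : Fibre n lam in 𝓝 q₀, ∀ i, ((φ (rX q.1, rv q.1)).1 i).det ≠ 0 := by
    rw [Filter.eventually_all]
    intro i
    have hc : Continuous fun A : Matrix (Fin n) (Fin n) ℂ => A.det := by fun_prop
    refine ((hc.tendsto 1).comp (hg i)).eventually_ne ?_
    rw [Matrix.det_one]; exact one_ne_zero
  have hreg0 : (z.1.1, (0 : Fin n → ℂ)) ∈ regDomain m n := z.2
  have hνreg : ∀ᶠ q : Fibre n lam in 𝓝 q₀,
      ((φ (rX q.1, rv q.1)).2, (0 : Fin n → ℂ)) ∈ regDomain m n :=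
    (hν.prodMk_nhds tendsto_const_nhds).eventually ((isOpen_regDomain m n).mem_nhds hreg0)
  have hY : Filter.Tendsto (fun q : Fibre n lam => ((φ (rX q.1, rv q.1)).1 (-1))⁻¹
      * rY q.1 (-1) * (φ (rX q.1, rv q.1)).1 0) (𝓝 q₀) (𝓝 (laxBlock lam z.1 (-1))) := by
    have h1 : Filter.Tendsto (fun q : Fibre n lam => ((φ (rX q.1, rv q.1)).1 (-1))⁻¹) (𝓝 q₀)
        (𝓝 (1 : Matrix (Fin n) (Fin n) ℂ)⁻¹) :=
      (continuousAt_matrix_inv (by rw [Matrix.det_one]; exact one_ne_zero)).tendsto.comp (hg (-1))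
    have h2 : Filter.Tendsto (fun q : Fibre n lam => rY q.1 (-1)) (𝓝 q₀)
        (𝓝 (laxBlock lam z.1 (-1))) := by
      have hc : Continuous fun q : Fibre n lam => rY q.1 (-1) := by
        have h0 : Continuous fun q : Fibre n lam => q.1 := continuous_subtype_val
        fun_prop
      exact hc.tendsto q₀
    have hmul : Continuous fun P : Matrix (Fin n) (Fin n) ℂ × Matrix (Fin n) (Fin n) ℂ ×
        Matrix (Fin n) (Fin n) ℂ => P.1 * P.2.1 * P.2.2 := by fun_prop
    have h3 := (hmul.tendsto (1⁻¹, laxBlock lam z.1 (-1), 1)).comp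
      (h1.prodMk_nhds (h2.prodMk_nhds (hg 0)))
    simp only [inv_one, one_mul, mul_one] at h3
    exact h3
  have hμ : Filter.Tendsto (fun q : Fibre n lam => sliceMomenta lam (φ (rX q.1, rv q.1)).2
      (((φ (rX q.1, rv q.1)).1 (-1))⁻¹ * rY q.1 (-1) * (φ (rX q.1, rv q.1)).1 0)) (𝓝 q₀)
      (𝓝 z.1.2) := by
    rw [← sliceMomenta_laxBlock lam z.1]
    have hmv : Continuous fun A : Matrix (Fin n) (Fin n) ℂ => A.mulVec fun _ => (1 : ℂ) := by
      fun_prop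
    have h1 := (hmv.tendsto _).comp hY
    have h2 : ContinuousAt (fun ν : Fin n → ℂ => laxBlock lam (ν, 0) (-1)) z.1.1 :=
      ContinuousAt.comp (f := fun ν : Fin n → ℂ => ((ν, 0) : Phase n))
        (g := fun z : Phase n => laxBlock lam z (-1))
        (differentiableAt_laxBlock lam hreg0 (-1)).continuousAt (by fun_prop)
    have h3 := (hmv.tendsto _).comp (h2.tendsto.comp hν)
    exact h1.sub h3
  have hzt : Filter.Tendsto (fun q : Fibre n lam => (((φ (rX q.1, rv q.1)).2,
      sliceMomenta lam (φ (rX q.1, rv q.1)).2 (((φ (rX q.1, rv q.1)).1 (-1))⁻¹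
        * rY q.1 (-1) * (φ (rX q.1, rv q.1)).1 0)) : Phase n)) (𝓝 q₀) (𝓝 z.1) :=
    hν.prodMk_nhds hμ
  -- a neighbourhood of `z` in the phase space whose regular points go to `N`
  obtain ⟨W, hW, hWN⟩ := mem_nhds_subtype _ _ _ |>.1 hN
  have hfin : ∀ᶠ q : Fibre n lam in 𝓝 q₀, toCM q ∈ N := by
    filter_upwards [hp.eventually hev, hdet, hνreg, hzt.eventually hW] with q h1 h2 h3 h4
    have hzr : ((φ (rX q.1, rv q.1)).2,
      sliceMomenta lam (φ (rX q.1, rv q.1)).2 (((φ (rX q.1, rv q.1)).1 (-1))⁻¹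
        * rY q.1 (-1) * (φ (rX q.1, rv q.1)).1 0)) ∈ regDomain m n := h3
    rw [toCM_eq_of_gauge q h2 h1.1 h1.2 h3 hzr]
    exact hWN h4
  have := isOpenQuotientMap_toCM.isOpenMap.image_mem_nhds hfin
  refine Filter.mem_of_superset this ?_
  rintro _ ⟨q, hq, rfl⟩
  exact hq

/-! ### The linear flows extend the Calogero–Moser flows -/

/-- Along an integral curve, the point of `Rep` obtained by undoing the linear flow moves by
infinitesimal gauge transformations. -/
theorem hasDerivAt_flow_back {lam : Fin m → ℂ} {j : ℕ} {f : Phase n → ℂ}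
    (hf : ∀ z ∈ regDomain m n, (laxMatrix lam z ^ (m * j)).trace = (m : ℂ) * f z)
    (hj : 1 ≤ j) {γ : ℂ → Phase n} {t : ℂ} (t₀ : ℂ) (hz : γ t ∈ regDomain m n)
    (hγ : HasDerivAt γ (hamField f (γ t)) t) :
    ∃ A, HasDerivAt (fun s => laxMatrix lam (γ s))
        (A * laxMatrix lam (γ t) - laxMatrix lam (γ t) * A) t ∧
      HasDerivAt (fun s => bigX (rX (slice lam (γ s)))
          - (s - t₀) • (((m : ℂ) * j) • laxMatrix lam (γ s) ^ (m * j - 1)))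
        (A * (bigX (rX (slice lam (γ t)))
            - (t - t₀) • (((m : ℂ) * j) • laxMatrix lam (γ t) ^ (m * j - 1)))
          - (bigX (rX (slice lam (γ t)))
            - (t - t₀) • (((m : ℂ) * j) • laxMatrix lam (γ t) ^ (m * j - 1))) * A) t := by
  obtain ⟨A, hY, hX⟩ := exists_lax_pair_big hf hj hz
  have hs := hasDerivAt_slice_curve lam hz hγ
  have h1 : HasDerivAt (fun s => laxMatrix lam (γ s))
      (A * laxMatrix lam (γ t) - laxMatrix lam (γ t) * A) t := by
    rw [← hY]
    exact hasDerivAt_linear bigYLin hs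
  refine ⟨A, h1, ?_⟩
  have h2 : HasDerivAt (fun s => bigX (rX (slice (m := m) lam (γ s)))) _ t :=
    hasDerivAt_linear bigXLin hs
  have h3 := hasDerivAt_matrix_pow_commutator h1 (m * j - 1)
  have h4 : HasDerivAt (fun s => (s - t₀) • (((m : ℂ) * j) • laxMatrix lam (γ s) ^ (m * j - 1)))
      _ t := ((hasDerivAt_id t).sub_const t₀).smul (h3.const_smul ((m : ℂ) * j))
  refine (h2.sub h4).congr_deriv ?_
  change bigX (rX (fderiv ℂ (slice (m := m) lam) (γ t) (hamField f (γ t)))) - _ = _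
  rw [hX]
  simp only [id, one_smul, mul_sub, sub_mul, mul_smul_comm, smul_mul_assoc, smul_sub]
  abel

theorem trace_bigX_pow_glAct (g : Fin m → GL (Fin n) ℂ) (q : Rep m n) (k : ℕ) :
    (bigX (rX (glAct g q)) ^ k).trace = (bigX (rX q) ^ k).trace := by
  rw [bigX_glAct, Units.conj_pow, trace_units_conj]

theorem trace_bigY_mul_bigX_pow_glAct (g : Fin m → GL (Fin n) ℂ) (q : Rep m n) (k : ℕ) :
    (bigY (rY (glAct g q)) * bigX (rX (glAct g q)) ^ k).trace
      = (bigY (rY q) * bigX (rX q) ^ k).trace := by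
  have h : ∀ A B : Matrix (Fin m × Fin n) (Fin m × Fin n) ℂ,
      (blockUnit g * A * (blockUnit g)⁻¹.val) * (blockUnit g * B * (blockUnit g)⁻¹.val)
        = blockUnit g * (A * B) * (blockUnit g)⁻¹.val := fun A B => by
    simp only [mul_assoc, Units.inv_mul_cancel_left]
  rw [bigX_glAct, bigY_glAct, Units.conj_pow, h, trace_units_conj]

theorem bigX_linearFlow_slice {lam : Fin m → ℂ} (h0 : absLam lam ≠ 0) (j : ℕ+) (z : Phase n)
    (s t : ℂ) :
    bigX (rX (linearFlow lam (Finsupp.single j ((m : ℂ) / absLam lam * (s - t))) (slice lam z)))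
      = bigX (rX (slice lam z))
        - (t - s) • (((m : ℂ) * ((j : ℕ) : ℂ)) • laxMatrix lam z ^ (m * (j : ℕ) - 1)) := by
  rw [bigX_linearFlow, flowIncrement, Finsupp.sum_single_index (by rw [mul_zero, zero_smul]),
    smul_smul, smul_smul, sub_eq_add_neg (bigX _), ← neg_smul]
  congr 2
  field_simp
  ring

/-- The traces `tr Y X^k` and `tr X^k` are constant along the curve in `Rep` obtained by undoing
the linear flow along an integral curve. -/
theorem trace_flow_back_eq {lam : Fin m → ℂ} (h0 : absLam lam ≠ 0) {j : ℕ+} {f : Phase n → ℂ}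
    (hf : ∀ z ∈ regDomain m n, (laxMatrix lam z ^ (m * (j : ℕ))).trace = (m : ℂ) * f z)
    {U : Set ℂ} {γ : ℂ → Phase n} (hU : IsOpen U) (hU' : IsPreconnected U)
    (hγ : IsHamiltonianCurve m f U γ) {r t₀ : ℂ} (hr : r ∈ U) (ht₀ : t₀ ∈ U) (k : ℕ) :
    (bigX (rX (linearFlow lam (Finsupp.single j ((m : ℂ) / absLam lam * (t₀ - r)))
        (slice lam (γ r)))) ^ k).trace = (bigX (rX (slice lam (γ t₀))) ^ k).trace ∧
      (laxMatrix lam (γ r) * bigX (rX (linearFlow lam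
        (Finsupp.single j ((m : ℂ) / absLam lam * (t₀ - r))) (slice lam (γ r)))) ^ k).trace
      = (laxMatrix lam (γ t₀) * bigX (rX (slice lam (γ t₀))) ^ k).trace := by
  have hself : linearFlow lam (Finsupp.single j ((m : ℂ) / absLam lam * (t₀ - t₀)))
      (slice lam (γ t₀)) = slice lam (γ t₀) := by
    rw [sub_self, mul_zero, Finsupp.single_zero, linearFlow_zero]
  rw [← hself, bigX_linearFlow_slice h0, bigX_linearFlow_slice h0]
  constructor
  · have hd : ∀ x ∈ U, HasDerivAt (fun x => ((bigX (rX (slice lam (γ x)))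
        - (x - t₀) • (((m : ℂ) * ((j : ℕ) : ℂ))
          • laxMatrix lam (γ x) ^ (m * (j : ℕ) - 1))) ^ k).trace) 0 x := by
      intro x hx
      obtain ⟨A, -, hA⟩ := hasDerivAt_flow_back hf j.pos t₀ (hγ x hx).1 (hγ x hx).2
      have h1 : HasDerivAt (fun _ : ℂ => (1 : Matrix (Fin m × Fin n) (Fin m × Fin n) ℂ))
          (A * 1 - 1 * A) x := by
        rw [mul_one, one_mul, sub_self]
        exact hasDerivAt_const x _
      have h2 := hasDerivAt_trace_mul_pow hA h1 k
      simp only [one_mul] at h2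
      exact h2
    exact hU.is_const_of_deriv_eq_zero hU'
      (fun x hx => (hd x hx).differentiableAt.differentiableWithinAt)
      (fun x hx => (hd x hx).deriv) hr ht₀
  · have hd : ∀ x ∈ U, HasDerivAt (fun x => (laxMatrix lam (γ x) * (bigX (rX (slice lam (γ x)))
        - (x - t₀) • (((m : ℂ) * ((j : ℕ) : ℂ))
          • laxMatrix lam (γ x) ^ (m * (j : ℕ) - 1))) ^ k).trace) 0 x := by
      intro x hx
      obtain ⟨A, hY, hA⟩ := hasDerivAt_flow_back hf j.pos t₀ (hγ x hx).1 (hγ x hx).2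
      exact hasDerivAt_trace_mul_pow hA hY k
    exact hU.is_const_of_deriv_eq_zero hU'
      (fun x hx => (hd x hx).differentiableAt.differentiableWithinAt)
      (fun x hx => (hd x hx).deriv) hr ht₀

/-- If undoing the linear flow at a point of an integral curve leads into the image of the slice,
it leads to the expected point. -/
theorem cmFlow_cmPoint_eq {lam : Fin m → ℂ} (h0 : absLam lam ≠ 0) {j : ℕ+} {f : Phase n → ℂ}
    (hf : ∀ z ∈ regDomain m n, (laxMatrix lam z ^ (m * (j : ℕ))).trace = (m : ℂ) * f z)
    {U : Set ℂ} {γ : ℂ → Phase n} (hU : IsOpen U) (hU' : IsPreconnected U)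
    (hγ : IsHamiltonianCurve m f U γ) {r t₀ : ℂ} (hr : r ∈ U) (ht₀ : t₀ ∈ U)
    (hr' : γ r ∈ regDomain m n) (ht₀' : γ t₀ ∈ regDomain m n)
    (hrange : cmFlow (Finsupp.single j ((m : ℂ) / absLam lam * (t₀ - r)))
      (cmPoint lam ⟨γ r, hr'⟩) ∈ Set.range (cmPoint lam)) :
    cmFlow (Finsupp.single j ((m : ℂ) / absLam lam * (t₀ - r))) (cmPoint lam ⟨γ r, hr'⟩)
      = cmPoint lam ⟨γ t₀, ht₀'⟩ := by
  obtain ⟨z, hz⟩ := hrange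
  rw [← hz, cmPoint_eq_iff]
  obtain ⟨h, hh⟩ := toCM_eq_iff.1 hz
  generalize hτ : Finsupp.single j ((m : ℂ) / absLam lam * (t₀ - r)) = τ at hh
  change glAct h (slice lam z.1) = linearFlow lam τ (slice lam (γ r)) at hh
  have hY : bigY (rY (linearFlow lam τ (slice lam (γ r)))) = laxMatrix lam (γ r) := rfl
  have hY' : bigY (rY (slice lam (γ t₀))) = laxMatrix lam (γ t₀) := rfl
  refine exists_smul_eq_of_traces z.2 ht₀' (lam := lam) (fun k => ?_) (fun k => ?_)
  · rw [← trace_bigX_pow_glAct h, hh, ← hτ]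
    exact (trace_flow_back_eq h0 hf hU hU' hγ hr ht₀ k).1
  · rw [← trace_bigY_mul_bigX_pow_glAct h, hh, hY, hY', ← hτ]
    exact (trace_flow_back_eq h0 hf hU hU' hγ hr ht₀ k).2

theorem continuous_cmFlow_comp {S : Type*} [TopologicalSpace S] {lam : Fin m → ℂ} (j : ℕ+)
    {τ : S → ℂ} {x : S → CMSpace n lam} (hτ : Continuous τ) (hx : Continuous x) :
    Continuous fun s => cmFlow (Finsupp.single j (τ s)) (x s) := by
  have h := (continuous_cmFlow (n := n) (lam := lam) j).comp (hτ.prodMk hx)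
  simpa only [Function.comp_def] using h

/-- The linear flows extend the Calogero–Moser flows.  Locally this holds because the invariants
`tr X^k`, `tr Y X^k` are constant along the curve obtained by undoing the linear flow, and, the
image of the slice being open, separate its points; globally by connectedness. -/
theorem cmPoint_eq_cmFlow {lam : Fin m → ℂ} (h0 : absLam lam ≠ 0) {j : ℕ+} {f : Phase n → ℂ}
    (hf : ∀ z ∈ regDomain m n, (laxMatrix lam z ^ (m * (j : ℕ))).trace = (m : ℂ) * f z)
    {U : Set ℂ} {γ : ℂ → Phase n} (hU : IsOpen U) (hU' : IsPreconnected U)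
    (hγ : IsHamiltonianCurve m f U γ) {s t : ℂ} (hsU : s ∈ U) (htU : t ∈ U)
    (hs : γ s ∈ regDomain m n) (ht : γ t ∈ regDomain m n) :
    cmPoint lam ⟨γ t, ht⟩
      = cmFlow (Finsupp.single j ((m : ℂ) / absLam lam * (t - s))) (cmPoint lam ⟨γ s, hs⟩) := by
  set c : ℂ := (m : ℂ) / absLam lam with hc
  let Γ : U → regDomain m n := fun r => ⟨γ r, (hγ r r.2).1⟩
  have hΓ : Continuous Γ := by
    refine Continuous.subtype_mk (continuous_iff_continuousAt.2 fun r => ?_) _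
    exact ((hγ r r.2).2.continuousAt).comp continuousAt_subtype_val
  have hlocal : ∀ t₀ : U, ∀ᶠ r : U in 𝓝 t₀,
      cmFlow (Finsupp.single j (c * (t₀ - r))) (cmPoint lam (Γ r)) = cmPoint lam (Γ t₀) := by
    intro t₀
    have hcont : Continuous fun r : U =>
        cmFlow (Finsupp.single j (c * ((t₀ : ℂ) - r))) (cmPoint lam (Γ r)) := by
      have h1 : Continuous fun r : U => c * ((t₀ : ℂ) - r) := by fun_prop
      exact continuous_cmFlow_comp j h1 ((continuous_cmPoint lam).comp hΓ)
    have hzero : Finsupp.single j (c * ((t₀ : ℂ) - t₀)) = 0 := by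
      rw [sub_self, mul_zero, Finsupp.single_zero]
    have hval : cmFlow (Finsupp.single j (c * ((t₀ : ℂ) - t₀))) (cmPoint lam (Γ t₀))
        = cmPoint lam (Γ t₀) := by
      generalize cmPoint lam (Γ t₀) = x
      rw [hzero, cmFlow_zero]
    have hnhds : Set.range (cmPoint (n := n) lam)
        ∈ 𝓝 (cmFlow (Finsupp.single j (c * ((t₀ : ℂ) - t₀))) (cmPoint lam (Γ t₀))) := by
      exact (isOpenMap_cmPoint lam).isOpen_range.mem_nhds ⟨Γ t₀, hval.symm⟩
    filter_upwards [hcont.continuousAt.preimage_mem_nhds hnhds] with r hr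
    exact cmFlow_cmPoint_eq h0 hf hU hU' hγ r.2 t₀.2 _ _ hr
  have hconst : IsLocallyConstant fun r : U =>
      cmFlow (Finsupp.single j (c * (0 - (r : ℂ)))) (cmPoint lam (Γ r)) := by
    rw [IsLocallyConstant.iff_eventually_eq]
    intro t₀
    filter_upwards [hlocal t₀] with r hr
    rw [← hr, ← cmFlow_add, ← Finsupp.single_add]
    congr 2
    ring
  have : PreconnectedSpace U := Subtype.preconnectedSpace hU'
  have h1 := hconst.apply_eq_of_preconnectedSpace ⟨t, htU⟩ ⟨s, hsU⟩
  have h2 := congrArg (cmFlow (Finsupp.single j (c * t))) h1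
  simp only [← cmFlow_add, ← Finsupp.single_add] at h2
  rw [show c * t + c * (0 - t) = 0 by ring, show c * t + c * (0 - s) = c * (t - s) by ring,
    Finsupp.single_zero, cmFlow_zero] at h2
  exact h2

/-! ### Density of the points with invertible `X_i` -/

section RankVariation

variable {ι : Type*} [Fintype ι] [DecidableEq ι]

/-- Along a curve of matrices whose rank is maximal at time `0`, the derivative pairs to zero with
the kernel and the cokernel. -/
theorem dotProduct_deriv_mulVec_eq_zero {A : ℂ → Matrix ι ι ℂ} {A' : Matrix ι ι ℂ}
    (hA : HasDerivAt A A' 0) (hrank : ∀ᶠ s in 𝓝 (0 : ℂ), (A s).rank ≤ (A 0).rank)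
    {u η : ι → ℂ} (hu : (A 0).mulVec u = 0) (hη : Matrix.vecMul η (A 0) = 0) :
    dotProduct η (A'.mulVec u) = 0 := by
  by_contra hne
  set r := (A 0).rank with hr
  let b := Module.finBasisOfFinrankEq ℂ (LinearMap.range (A 0).mulVecLin) hr.symm
  have hb : ∀ j : Fin r, ∃ e, (A 0).mulVec e = (b j : ι → ℂ) := fun j => (b j).2
  choose e he using hb
  have hdv : ∀ u : ι → ℂ, HasDerivAt (fun s => (A s).mulVec u) (A'.mulVec u) 0 := fun u =>
    hasDerivAt_linear ((Matrix.mulVecBilin ℂ ℂ).flip u) hA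
  -- the vectors `A(0) e_j` span the range of `A(0)`, which `η` kills, but `η` does not kill `A' u`
  have hli : LinearIndependent ℂ
      (Fin.snoc (fun j => (A 0).mulVec (e j)) (A'.mulVec u) : Fin (r + 1) → ι → ℂ) := by
    rw [linearIndependent_finSnoc]
    constructor
    · simp only [he]
      exact b.linearIndependent.map' (LinearMap.range (A 0).mulVecLin).subtype
        (Submodule.ker_subtype _)
    · intro hmem
      apply hne
      have hle : Submodule.span ℂ (Set.range fun j => (A 0).mulVec (e j))
          ≤ LinearMap.ker (dotProductBilin ℂ ℂ η) := by
        rw [Submodule.span_le]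
        rintro _ ⟨j, rfl⟩
        change dotProduct η ((A 0).mulVec (e j)) = 0
        rw [Matrix.dotProduct_mulVec, hη, zero_dotProduct]
      exact hle hmem
  have htend : Filter.Tendsto
      (fun s : ℂ => (Fin.snoc (fun j => (A s).mulVec (e j)) (s⁻¹ • (A s).mulVec u) :
        Fin (r + 1) → ι → ℂ)) (𝓝[≠] 0)
      (𝓝 (Fin.snoc (fun j => (A 0).mulVec (e j)) (A'.mulVec u) : Fin (r + 1) → ι → ℂ)) := by
    rw [tendsto_pi_nhds]
    intro k
    refine Fin.lastCases ?_ (fun j => ?_) k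
    · simp only [Fin.snoc_last]
      have h := (hasDerivAt_iff_tendsto_slope.1 (hdv u))
      refine h.congr fun s => ?_
      simp [slope, hu]
    · simp only [Fin.snoc_castSucc]
      exact (hdv (e j)).continuousAt.tendsto.mono_left nhdsWithin_le_nhds
  obtain ⟨s, hs, hs'⟩ := ((htend.eventually hli.eventually).and
    (hrank.filter_mono nhdsWithin_le_nhds)).exists
  have hmem : ∀ k, (Fin.snoc (fun j => (A s).mulVec (e j)) (s⁻¹ • (A s).mulVec u) :
      Fin (r + 1) → ι → ℂ) k ∈ LinearMap.range (A s).mulVecLin := by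
    intro k
    refine Fin.lastCases ?_ (fun j => ?_) k
    · simp only [Fin.snoc_last]
      exact Submodule.smul_mem _ _ ⟨u, rfl⟩
    · simp only [Fin.snoc_castSucc]
      exact ⟨e j, rfl⟩
  have hli' : LinearIndependent ℂ (fun k => (⟨_, hmem k⟩ : LinearMap.range (A s).mulVecLin)) :=
    LinearIndependent.of_comp (LinearMap.range (A s).mulVecLin).subtype hs
  have hcard := hli'.fintype_card_le_finrank
  rw [Fintype.card_fin] at hcard
  change r + 1 ≤ (A s).rank at hcard
  omega

end RankVariation

/-- The moment map is a submersion where the action is infinitesimally free, by comparison of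
dimensions. -/
theorem momentDeriv_surjective {q : Rep m n} (hq : Function.Injective (glInf q)) :
    LinearMap.range (momentDeriv q) = ⊤ := by
  apply Submodule.eq_top_of_finrank_eq
  have h := LinearMap.finrank_range_add_finrank_ker (momentDeriv q)
  have hker : LinearMap.ker (momentDeriv q) = fibreTangent q := by
    ext ξ
    rw [mem_fibreTangent, LinearMap.mem_ker]
  rw [hker, finrank_fibreTangent hq, finrank_orbitTangent hq] at h
  simp only [Module.finrank_prod, Module.finrank_pi_fintype, Module.finrank_matrix,
    Module.finrank_self, Finset.sum_const, Finset.card_univ, Fintype.card_fin, smul_eq_mul,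
    mul_one] at h ⊢
  omega

/-- Every vector in the kernel of the differential of the moment map is the velocity of a curve in
the fibre. -/
theorem exists_fibre_curve {lam : Fin m → ℂ} (hlam : IsRegular lam) (q : Fibre n lam) {ξ : Rep m n}
    (hξ : ξ ∈ fibreTangent q.1) : ∃ γ : ℂ → Rep m n, γ 0 = q.1 ∧ HasDerivAt γ ξ 0 ∧
      ∀ᶠ s in 𝓝 (0 : ℂ), ∀ i, momentMap (γ s) i = lam i • (1 : Matrix (Fin n) (Fin n) ℂ) := by
  have hf := hasStrictFDerivAt_momentMap q.1
  have hsurj : (LinearMap.toContinuousLinearMap (momentDeriv q.1)).range = ⊤ :=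
    momentDeriv_surjective (glInf_injective hlam q.2)
  let k : (LinearMap.toContinuousLinearMap (momentDeriv q.1)).ker :=
    ⟨ξ, mem_fibreTangent.1 hξ⟩
  have hline : HasDerivAt (fun s : ℂ => s • k) k 0 := by
    have h := (hasDerivAt_id (0 : ℂ)).smul_const k
    simp only [one_smul, id] at h
    exact h
  refine ⟨fun s => hf.implicitFunction _ _ hsurj (momentMap q.1) (s • k), ?_, ?_, ?_⟩
  · simp only [zero_smul]
    exact hf.implicitFunction_apply_image hsurj
  · exact (hf.to_implicitFunction hsurj).hasFDerivAt.comp_hasDerivAt_of_eq 0 hline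
      (zero_smul ℂ k).symm
  · have ht : Filter.Tendsto (fun s : ℂ => (momentMap q.1, s • k)) (𝓝 0)
        (𝓝 (momentMap q.1, 0)) := by
      have h := hline.continuousAt.tendsto
      rw [zero_smul] at h
      exact tendsto_const_nhds.prodMk_nhds h
    filter_upwards [ht.eventually (hf.map_implicitFunction_eq hsurj)] with s hs i
    rw [hs, q.2]

/-- The points of the fibre with `X_i` invertible are dense.  At a point of an open set without
such points, where moreover the rank of `X_i` is maximal, a rank one matrix `b` with
`X_i b = b X_i = 0` would be tangent, as a variation of `Y_i`, to the orbit; but the infinitesimal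
gauge transformation producing it has a graded image on which `w` vanishes. -/
theorem dense_det_ne_zero {lam : Fin m → ℂ} (hlam : IsRegular lam) (i₀ : Fin m) :
    Dense {q : Fibre n lam | (rX q.1 i₀).det ≠ 0} := by
  rw [dense_iff_inter_open]
  intro O hO hne
  by_contra hcon
  have hzero : ∀ q ∈ O, (rX q.1 i₀).det = 0 := by
    intro q hq
    by_contra h
    exact hcon ⟨q, hq, h⟩
  -- a point of `O` at which the rank is maximal
  obtain ⟨r, ⟨q, hqO, hqr⟩, hmax⟩ : ∃ r, (∃ q ∈ O, (rX q.1 i₀).rank = r) ∧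
      ∀ q ∈ O, (rX q.1 i₀).rank ≤ r := by
    have hfin : Set.Finite ((fun q : Fibre n lam => (rX q.1 i₀).rank) '' O) := by
      refine (Set.finite_Iic n).subset ?_
      rintro _ ⟨q, -, rfl⟩
      have h := (rX q.1 i₀).rank_le_card_width
      rwa [Fintype.card_fin] at h
    obtain ⟨r, hr, hmax⟩ := Set.exists_max_image _ id hfin (hne.image _)
    exact ⟨r, hr, fun q hq => hmax _ ⟨q, hq, rfl⟩⟩
  obtain ⟨u, hu0, hu⟩ := Matrix.exists_mulVec_eq_zero_iff.2 (hzero q hqO)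
  obtain ⟨η, hη0, hη⟩ := Matrix.exists_vecMul_eq_zero_iff.2 (hzero q hqO)
  let b : Matrix (Fin n) (Fin n) ℂ := Matrix.vecMulVec u η
  have horb : ((0, Pi.single i₀ b, 0, 0) : Rep m n) ∈ orbitTangent q.1 := by
    rw [mem_orbitTangent_iff]
    intro ξ hξ
    obtain ⟨γ, hγ0, hγ, hγm⟩ := exists_fibre_curve hlam q hξ
    have hO' : ∀ᶠ s in 𝓝 (0 : ℂ), (rX (γ s) i₀).rank ≤ r := by
      obtain ⟨W, hW, hWO⟩ := isOpen_induced_iff.1 hO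
      have hqW : γ 0 ∈ W := by
        rw [hγ0]
        have : q ∈ Subtype.val ⁻¹' W := hWO ▸ hqO
        exact this
      filter_upwards [hγ.continuousAt.eventually (hW.mem_nhds hqW), hγm] with s hs hsm
      exact hmax ⟨γ s, hsm⟩ (hWO.subset hs)
    have hder : HasDerivAt (fun s => rX (γ s) i₀) (rX ξ i₀) 0 :=
      hasDerivAt_linear ((LinearMap.proj i₀).comp (LinearMap.fst ℂ _ _)) hγ
    have h0 : rX (γ 0) i₀ = rX q.1 i₀ := by rw [hγ0]
    have key : dotProduct η ((rX ξ i₀).mulVec u) = 0 :=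
      dotProduct_deriv_mulVec_eq_zero hder (by simp only [h0, hqr]; exact hO')
        (by simp only [h0]; exact hu) (by simp only [h0]; exact hη)
    have htr : (b * rX ξ i₀).trace = 0 := by
      rw [Matrix.vecMulVec_mul, Matrix.trace_vecMulVec, dotProduct_comm, ← Matrix.dotProduct_mulVec]
      exact key
    change ∑ i, (((Pi.single i₀ b : Fin m → Matrix (Fin n) (Fin n) ℂ) i * rX ξ i).trace
      - (rY ξ i * (0 : Matrix (Fin n) (Fin n) ℂ)).trace)
      + (dotProduct 0 (rv ξ) - dotProduct (rw ξ) 0) = 0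
    rw [Finset.sum_eq_single i₀]
    · simp [htr]
    · intro i _ hi
      simp [Pi.single_eq_of_ne hi]
    · simp
  obtain ⟨c, hc⟩ := mem_orbitTangent.1 horb
  have hcX : ∀ i, c (i + 1) * rX q.1 i = rX q.1 i * c i := fun i =>
    sub_eq_zero.1 (congrFun (congrArg (fun q : Rep m n => q.1) hc) i)
  have hcY : ∀ i, c i * rY q.1 i - rY q.1 i * c (i + 1)
      = (Pi.single i₀ b : Fin m → Matrix (Fin n) (Fin n) ℂ) i := fun i =>
    congrFun (congrArg (fun q : Rep m n => q.2.1) hc) i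
  have hcw : Matrix.vecMul (rw q.1) (c 0) = 0 :=
    neg_eq_zero.1 (congrArg (fun q : Rep m n => q.2.2.2) hc)
  have hXb : ∀ i, rX q.1 i * (Pi.single i₀ b : Fin m → Matrix (Fin n) (Fin n) ℂ) i = 0 := by
    intro i
    by_cases hi : i = i₀
    · subst hi
      rw [Pi.single_eq_same, Matrix.mul_vecMulVec, hu, Matrix.zero_vecMulVec]
    · rw [Pi.single_eq_of_ne hi, mul_zero]
  have hbot := graded_subspace_eq_bot hlam (fun i => (rX q.1 i).mulVecLin)
    (fun i => (rY q.1 i).mulVecLin) (fun i => LinearMap.range (c i).mulVecLin)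
    (by
      rintro i _ ⟨u, rfl⟩
      refine ⟨(rX q.1 i).mulVec u, ?_⟩
      simp only [Matrix.mulVecLin_apply, Matrix.mulVec_mulVec, hcX])
    (by
      rintro i _ ⟨u, rfl⟩
      refine ⟨_, ⟨(rY q.1 i).mulVec u, rfl⟩, ?_⟩
      simp only [Matrix.mulVecLin_apply, Matrix.mulVec_mulVec]
      rw [eq_add_of_sub_eq (hcY i), mul_add, hXb, zero_add])
    (by
      rintro i _ ⟨u, rfl⟩
      have h := moment_mulVec q.2 (i + 1) ((c (i + 1)).mulVec u)
      rw [add_sub_cancel_right] at h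
      simp only [Matrix.mulVecLin_apply]
      rw [h]
      split_ifs with h0
      · rw [h0, Matrix.dotProduct_mulVec, hcw, zero_dotProduct, zero_smul, add_zero]
      · rw [add_zero])
  have hc0 : ∀ i, c i = 0 := by
    intro i
    have h : (c i).mulVecLin = 0 := LinearMap.range_eq_bot.1 (hbot i)
    ext j k
    have := congrFun (congrArg (fun l => l (Pi.single k 1)) h) j
    simpa using this
  have hb : b = 0 := by
    have h := hcY i₀
    rw [hc0, hc0, Pi.single_eq_same, zero_mul, mul_zero, sub_zero] at h
    exact h.symm
  obtain ⟨j, hj⟩ := Function.ne_iff.1 hu0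
  obtain ⟨k, hk⟩ := Function.ne_iff.1 hη0
  have := congrFun (congrFun hb j) k
  exact mul_ne_zero hj hk this

/-- The points of the fibre with all `X_i` invertible are dense. -/
theorem dense_forall_det_ne_zero {lam : Fin m → ℂ} (hlam : IsRegular lam) :
    Dense {q : Fibre n lam | ∀ i, (rX q.1 i).det ≠ 0} := by
  have hopen : ∀ i, IsOpen {q : Fibre n lam | (rX q.1 i).det ≠ 0} := by
    intro i
    have h1 : Continuous fun q : Fibre n lam => rX q.1 i :=
      (continuous_apply i).comp (continuous_fst.comp continuous_subtype_val)
    have hc : Continuous fun q : Fibre n lam => (rX q.1 i).det := by fun_prop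
    exact isOpen_ne.preimage hc
  have h : ∀ s : Finset (Fin m), Dense (⋂ i ∈ s, {q : Fibre n lam | (rX q.1 i).det ≠ 0}) ∧
      IsOpen (⋂ i ∈ s, {q : Fibre n lam | (rX q.1 i).det ≠ 0}) := by
    intro s
    induction s using Finset.induction_on with
    | empty => simp
    | insert i s _ ih =>
      rw [Finset.set_biInter_insert]
      exact ⟨(dense_det_ne_zero hlam i).inter_of_isOpen_left ih.1 (hopen i),
        (hopen i).inter ih.2⟩
  refine (h Finset.univ).1.mono fun q hq i => ?_
  exact Set.mem_iInter₂.1 hq i (Finset.mem_univ i)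

/-! ### The discriminant of `P + y Q + t Q²` when `[Q, P]` is a rank one perturbation of a scalar -/

section Derivations

variable {ι : Type*} [Fintype ι] [DecidableEq ι] {S : Type*} [CommRing S] [Algebra ℂ S]

theorem map_mul_derivation (D : Derivation ℂ S S) (M N : Matrix ι ι S) :
    (M * N).map D = M.map D * N + M * N.map D := by
  ext i j
  simp only [Matrix.map_apply, Matrix.mul_apply, Matrix.add_apply, map_sum, Derivation.leibniz,
    smul_eq_mul, ← Finset.sum_add_distrib]
  refine Finset.sum_congr rfl fun l _ => ?_
  ring

theorem derivation_trace (D : Derivation ℂ S S) (M : Matrix ι ι S) :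
    D M.trace = (M.map D).trace := by
  simp [Matrix.trace]

theorem derivation_prod (D : Derivation ℂ S S) (s : Finset ι) (f : ι → S) :
    D (∏ i ∈ s, f i) = ∑ i ∈ s, (∏ j ∈ s.erase i, f j) * D (f i) := by
  induction s using Finset.induction_on with
  | empty => simp
  | insert a s ha ih =>
    rw [Finset.prod_insert ha, Derivation.leibniz, ih, Finset.sum_insert ha,
      Finset.erase_insert ha, smul_eq_mul, smul_eq_mul, add_comm, Finset.mul_sum]
    congr 1
    refine Finset.sum_congr rfl fun i hi => ?_
    have hai : a ≠ i := fun h => ha (h ▸ hi)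
    rw [Finset.erase_insert_of_ne hai, Finset.prod_insert (fun h => ha (Finset.mem_of_mem_erase h)),
      mul_assoc]

/-- Jacobi's formula. -/
theorem derivation_det (D : Derivation ℂ S S) (M : Matrix ι ι S) :
    D M.det = (M.adjugate * M.map D).trace := by
  rw [← sum_perm_eq_trace_adjugate, Matrix.det_apply', map_sum]
  refine Finset.sum_congr rfl fun σ _ => ?_
  rw [Derivation.leibniz, derivation_prod]
  have h : D ((Equiv.Perm.sign σ : ℤ) : S) = 0 := D.map_intCast _
  rw [h, smul_zero, add_zero, smul_eq_mul]
  rfl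

/-- The derivative of the adjugate, obtained by differentiating `adj M · M = det M`. -/
theorem det_smul_map_adjugate (D : Derivation ℂ S S) (M : Matrix ι ι S) :
    M.det • M.adjugate.map D
      = D M.det • M.adjugate - M.adjugate * M.map D * M.adjugate := by
  have h := congrArg (fun N => N.map D) (Matrix.adjugate_mul M)
  simp only [map_mul_derivation] at h
  have h1 : (M.det • (1 : Matrix ι ι S)).map D = D M.det • 1 := by
    ext i j
    by_cases hij : i = j
    · subst hij; simp
    · simp [Matrix.one_apply_ne hij]
  rw [h1] at h
  have h2 := congrArg (fun N => N * M.adjugate) h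
  simp only [add_mul, Matrix.smul_mul, one_mul, mul_assoc, Matrix.mul_adjugate, Matrix.mul_smul,
    mul_one] at h2
  rw [mul_assoc, ← h2]
  abel

/-- Powers of `A = adj M` when `∂M = 1`: the identity `τ ∂A = (∂τ) A - A²` turns the traces of
`A`, `A²`, `A³`, `A⁴` into differential polynomials of `τ = det M`. -/
theorem trace_adjugate_pow_recursion (D : Derivation ℂ S S) {M : Matrix ι ι S}
    (hM : M.map D = 1) :
    M.adjugate.trace = D M.det ∧
    (M.adjugate * M.adjugate).trace = D M.det * M.adjugate.trace - M.det * D M.adjugate.trace ∧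
    2 * (M.adjugate * M.adjugate * M.adjugate).trace
      = 2 * D M.det * (M.adjugate * M.adjugate).trace
        - M.det * D (M.adjugate * M.adjugate).trace ∧
    3 * (M.adjugate * M.adjugate * (M.adjugate * M.adjugate)).trace
      = 3 * D M.det * (M.adjugate * M.adjugate * M.adjugate).trace
        - M.det * D (M.adjugate * M.adjugate * M.adjugate).trace := by
  have hA := det_smul_map_adjugate D M
  rw [hM, mul_one] at hA
  set A := M.adjugate with hAdef
  set τ := M.det
  have hdet : ∀ B C : Matrix ι ι S, τ * (B * C).trace = ((τ • B) * C).trace := by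
    intro B C
    rw [Matrix.smul_mul, Matrix.trace_smul, smul_eq_mul]
  have hdet' : ∀ B C : Matrix ι ι S, τ * (B * C).trace = (B * (τ • C)).trace := by
    intro B C
    rw [Matrix.mul_smul, Matrix.trace_smul, smul_eq_mul]
  have e2 : A * A * (A * A) = A * A * A * A := by noncomm_ring
  refine ⟨?_, ?_, ?_, ?_⟩
  · rw [derivation_det, hM, mul_one]
  · rw [derivation_trace, ← smul_eq_mul τ, ← Matrix.trace_smul, hA, Matrix.trace_sub,
      Matrix.trace_smul, smul_eq_mul]
    ring
  · have h : τ * D (A * A).trace = 2 * (D τ * (A * A).trace - (A * A * A).trace) := by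
      rw [derivation_trace, map_mul_derivation, Matrix.trace_add, mul_add, hdet, hdet', hA,
        sub_mul, mul_sub, Matrix.trace_sub, Matrix.trace_sub, Matrix.smul_mul, Matrix.mul_smul,
        Matrix.trace_smul, smul_eq_mul, ← mul_assoc]
      ring
    rw [h]
    ring
  · have h : τ * D (A * A * A).trace
        = 3 * (D τ * (A * A * A).trace - (A * A * (A * A)).trace) := by
      have k1 : (A * A.map D * A).trace = (A.map D * (A * A)).trace := by
        rw [mul_assoc, Matrix.trace_mul_comm A, mul_assoc]
      have k2 : (A * A * A.map D).trace = (A.map D * (A * A)).trace := Matrix.trace_mul_comm _ _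
      rw [derivation_trace, map_mul_derivation, map_mul_derivation, add_mul, Matrix.trace_add,
        Matrix.trace_add, k1, k2, mul_assoc (A.map D), mul_add, mul_add, hdet, hA, sub_mul,
        Matrix.trace_sub, Matrix.smul_mul, Matrix.trace_smul, smul_eq_mul, ← mul_assoc A A A]
      ring
    rw [h]
    ring

/-- If `QM - MQ` is the sum of a scalar `c` and a rank one matrix, then `[adj M, Q]` is governed by
`A²`, `A = adj M`, up to rank one, which determines the trace of its square. -/
theorem trace_commutator_sq {M Q : Matrix ι ι S} {c : S} {v w : ι → S}
    (h : Q * M - M * Q = -(c • 1 + Matrix.vecMulVec v w)) :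
    M.det ^ 2 * ((M.adjugate * Q - Q * M.adjugate) * (M.adjugate * Q - Q * M.adjugate)).trace
      = c ^ 2 * ((M.adjugate * M.adjugate).trace ^ 2
        - (M.adjugate * M.adjugate * (M.adjugate * M.adjugate)).trace) := by
  set A := M.adjugate with hA
  set τ := M.det with hτ
  have hAM : A * M = τ • 1 := Matrix.adjugate_mul M
  have hMA : M * A = τ • 1 := Matrix.mul_adjugate M
  set a := A.mulVec v with ha
  set b := Matrix.vecMul w A with hb
  have hK : τ • (A * Q - Q * A) = -(c • (A * A) + Matrix.vecMulVec a b) := by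
    have h1 : A * (Q * M - M * Q) * A = τ • (A * Q - Q * A) := by
      calc A * (Q * M - M * Q) * A = A * Q * (M * A) - A * M * (Q * A) := by noncomm_ring
        _ = _ := by
          rw [hAM, hMA, Matrix.mul_smul, Matrix.smul_mul, mul_one, one_mul, smul_sub]
    rw [← h1, h, ha, hb, ← Matrix.vecMulVec_mul, ← Matrix.mul_vecMulVec]
    simp only [mul_neg, neg_mul, mul_add, add_mul, Matrix.mul_smul, Matrix.smul_mul, mul_one]
  have t1 : c * (A * A).trace + dotProduct b a = 0 := by
    have h2 := congrArg Matrix.trace hK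
    rw [Matrix.trace_smul, Matrix.trace_sub, Matrix.trace_mul_comm A Q, sub_self, smul_zero,
      Matrix.trace_neg, Matrix.trace_add, Matrix.trace_smul, Matrix.trace_vecMulVec,
      smul_eq_mul, dotProduct_comm a b] at h2
    linear_combination h2
  have t2 : c * (A * A * (A * A)).trace + dotProduct b ((A * A).mulVec a) = 0 := by
    have h2 := congrArg (fun N => (A * A * N).trace) hK
    simp only [Matrix.mul_smul, Matrix.trace_smul, mul_sub, Matrix.trace_sub, mul_neg,
      Matrix.trace_neg, mul_add, Matrix.trace_add, Matrix.mul_vecMulVec, Matrix.trace_vecMulVec,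
      smul_eq_mul] at h2
    have h3 : (A * A * (A * Q)).trace = (A * A * (Q * A)).trace := by
      rw [← mul_assoc, ← mul_assoc, Matrix.trace_mul_comm (A * A * Q) A]
      simp only [mul_assoc]
    rw [h3, sub_self, dotProduct_comm _ b] at h2
    linear_combination h2
  have t3 : M.det ^ 2 * ((A * Q - Q * A) * (A * Q - Q * A)).trace
      = ((c • (A * A) + Matrix.vecMulVec a b) * (c • (A * A) + Matrix.vecMulVec a b)).trace := by
    have h2 : (τ • (A * Q - Q * A)) * (τ • (A * Q - Q * A))
        = (c • (A * A) + Matrix.vecMulVec a b) * (c • (A * A) + Matrix.vecMulVec a b) := by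
      rw [hK, neg_mul_neg]
    rw [← h2, Matrix.smul_mul, Matrix.mul_smul, Matrix.trace_smul, Matrix.trace_smul, smul_eq_mul,
      smul_eq_mul]
    ring
  rw [t3]
  have h4 : (A * A * Matrix.vecMulVec a b).trace = dotProduct b ((A * A).mulVec a) := by
    rw [Matrix.mul_vecMulVec, Matrix.trace_vecMulVec, dotProduct_comm]
  have h5 : (Matrix.vecMulVec a b * (A * A)).trace = dotProduct b ((A * A).mulVec a) := by
    rw [Matrix.trace_mul_comm, h4]
  have h6 : (Matrix.vecMulVec a b * Matrix.vecMulVec a b).trace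
      = dotProduct b a * dotProduct b a := by
    rw [Matrix.vecMulVec_mul_vecMulVec, Matrix.trace_vecMulVec, dotProduct_comm a, smul_dotProduct,
      smul_eq_mul]
  simp only [mul_add, add_mul, Matrix.trace_add, Matrix.smul_mul, Matrix.mul_smul,
    Matrix.trace_smul, smul_eq_mul, h4, h5, h6]
  linear_combination (2 * c) * t2 + (dotProduct b a - c * (A * A).trace) * t1

/-- The bilinear identity for `τ = det M` when `∂_x M = 1`, `∂_y M = -Q`, `∂_t M = -Q²`. -/
theorem trace_commutator_sq_eq_bilinear {Dx Dy Dt : Derivation ℂ S S} {M Q : Matrix ι ι S}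
    (hx : M.map Dx = 1) (hy : M.map Dy = -Q) (ht : M.map Dt = -(Q * Q))
    (hQx : Q.map Dx = 0) (hQy : Q.map Dy = 0) :
    ((M.adjugate * Q - Q * M.adjugate) * (M.adjugate * Q - Q * M.adjugate)).trace
      = 2 * (Dy M.det ^ 2 - M.det * Dy (Dy M.det))
        + 2 * (Dx M.det * Dt M.det - M.det * Dx (Dt M.det)) := by
  have hAx := det_smul_map_adjugate Dx M
  have hAy := det_smul_map_adjugate Dy M
  have τy := derivation_det Dy M
  have τt := derivation_det Dt M
  rw [hx, mul_one] at hAx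
  rw [hy] at hAy τy
  rw [ht] at τt
  set A := M.adjugate with hA
  set τ := M.det with hτ
  have e1 : τ * Dy (Dy τ) = Dy τ ^ 2 - (A * Q * (A * Q)).trace := by
    have h1 : Dy (Dy τ) = -(A.map Dy * Q).trace := by
      conv_lhs => rw [τy]
      rw [mul_neg, Matrix.trace_neg, map_neg, derivation_trace, map_mul_derivation, hQy, mul_zero,
        add_zero]
    rw [h1, mul_neg, ← smul_eq_mul τ, ← Matrix.trace_smul, ← Matrix.smul_mul, hAy, sub_mul,
      Matrix.smul_mul, Matrix.trace_sub, Matrix.trace_smul, smul_eq_mul]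
    have h2 : (A * Q).trace = -Dy τ := by rw [τy, mul_neg, Matrix.trace_neg, neg_neg]
    have h3 : A * -Q * A * Q = -(A * Q * (A * Q)) := by noncomm_ring
    rw [h2, h3, Matrix.trace_neg]
    ring
  have e2 : τ * Dx (Dt τ) = Dx τ * Dt τ + (A * A * (Q * Q)).trace := by
    have h1 : Dx (Dt τ) = -(A.map Dx * (Q * Q)).trace := by
      conv_lhs => rw [τt]
      rw [mul_neg, Matrix.trace_neg, map_neg, derivation_trace, map_mul_derivation,
        map_mul_derivation, hQx, mul_zero, zero_mul, add_zero, mul_zero, add_zero]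
    rw [h1, mul_neg, ← smul_eq_mul τ, ← Matrix.trace_smul, ← Matrix.smul_mul, hAx, sub_mul,
      Matrix.smul_mul, Matrix.trace_sub, Matrix.trace_smul, smul_eq_mul]
    have h2 : (A * (Q * Q)).trace = -Dt τ := by rw [τt, mul_neg, Matrix.trace_neg, neg_neg]
    rw [h2]
    ring
  have e3 : ((A * Q - Q * A) * (A * Q - Q * A)).trace
      = 2 * (A * Q * (A * Q)).trace - 2 * (A * A * (Q * Q)).trace := by
    have h1 : (A * Q - Q * A) * (A * Q - Q * A)
        = A * Q * (A * Q) - A * (Q * Q * A) - Q * (A * A * Q) + Q * (A * Q * A) := by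
      noncomm_ring
    rw [h1, Matrix.trace_add, Matrix.trace_sub, Matrix.trace_sub,
      Matrix.trace_mul_comm A (Q * Q * A), Matrix.trace_mul_comm Q (A * A * Q),
      Matrix.trace_mul_comm Q (A * Q * A), mul_assoc (Q * Q), Matrix.trace_mul_comm (Q * Q),
      mul_assoc (A * A), mul_assoc (A * Q)]
    ring
  rw [e3]
  linear_combination 2 * e1 + 2 * e2

/-- A prime whose square divides `τ = det M` divides its own derivative: comparing orders of
vanishing along `f` in the bilinear identity for `τ` leaves `(e² - e) (g ∂f)⁴` modulo `f`, where
`e` is the multiplicity of `f` in `τ = f^e g`. -/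
theorem dvd_derivation_of_sq_dvd_det [IsDomain S] {Dx Dy Dt : Derivation ℂ S S} {M Q : Matrix ι ι S}
    (hx : M.map Dx = 1) (hy : M.map Dy = -Q) (ht : M.map Dt = -(Q * Q))
    (hQx : Q.map Dx = 0) (hQy : Q.map Dy = 0) {c : ℂ} (hc : c ≠ 0) {v w : ι → S}
    (hcomm : Q * M - M * Q = -(algebraMap ℂ S c • 1 + Matrix.vecMulVec v w))
    {f g : S} {k : ℕ} (hf : Prime f) (hτ : M.det = f ^ (k + 2) * g) (hg : ¬ f ∣ g) : f ∣ Dx f := by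
  obtain ⟨r1, r2, r3, r4⟩ := trace_adjugate_pow_recursion Dx hx
  have hmain := trace_commutator_sq hcomm
  rw [trace_commutator_sq_eq_bilinear hx hy ht hQx hQy] at hmain
  generalize (M.adjugate * M.adjugate * (M.adjugate * M.adjugate)).trace = s4 at *
  generalize (M.adjugate * M.adjugate * M.adjugate).trace = s3 at *
  generalize (M.adjugate * M.adjugate).trace = s2 at *
  generalize M.adjugate.trace = s1 at *
  generalize M.det = τ at *
  subst hτ
  -- the powers of `f` in the iterated derivatives
  have hD : ∀ (D : Derivation ℂ S S) (l : ℕ) (a : S),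
      D (f ^ (l + 1) * a) = f ^ l * ((l + 1 : ℕ) * D f * a + f * D a) := by
    intro D l a
    rw [Derivation.leibniz, Derivation.leibniz_pow]
    simp only [smul_eq_mul, nsmul_eq_mul, Nat.add_sub_cancel]
    ring
  have hD' : ∀ (l : ℕ) (a : S), f ^ (k + 2) * g * Dx (f ^ (l + 1) * a)
      = f ^ (k + 1 + (l + 1)) * ((l + 1 : ℕ) * (Dx f * g) * a + f * (g * Dx a)) := by
    intro l a
    rw [hD]
    ring
  obtain ⟨σ1, hσ1⟩ : ∃ σ, σ = ((k + 2 : ℕ) : S) * Dx f * g + f * Dx g := ⟨_, rfl⟩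
  have q1 : s1 = f ^ (k + 1) * σ1 := by rw [r1, hD, ← hσ1]
  obtain ⟨σ2, hσ2⟩ : ∃ σ, σ = σ1 * σ1 - (((k + 1 : ℕ) : S) * (Dx f * g) * σ1 + f * (g * Dx σ1)) :=
    ⟨_, rfl⟩
  have q2 : s2 = f ^ (2 * k + 1 + 1) * σ2 := by
    rw [r2, ← r1, q1, hD', hσ2]
    ring
  obtain ⟨σ3, hσ3⟩ : ∃ σ, σ = 2 * σ1 * σ2
      - (((2 * k + 1 + 1 : ℕ) : S) * (Dx f * g) * σ2 + f * (g * Dx σ2)) := ⟨_, rfl⟩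
  have q3 : 2 * s3 = f ^ (3 * k + 2 + 1) * σ3 := by
    rw [r3, ← r1, q2, hD', hσ3, q1]
    ring
  obtain ⟨σ4, hσ4⟩ : ∃ σ, σ = 3 * σ1 * σ3
      - (((3 * k + 2 + 1 : ℕ) : S) * (Dx f * g) * σ3 + f * (g * Dx σ3)) := ⟨_, rfl⟩
  have q4 : 6 * s4 = f ^ (4 * (k + 1)) * σ4 := by
    have h : 2 * Dx s3 = Dx (f ^ (3 * k + 2 + 1) * σ3) := by
      rw [← q3, two_mul, two_mul, map_add]
    calc 6 * s4 = 3 * Dx (f ^ (k + 2) * g) * (2 * s3) - f ^ (k + 2) * g * (2 * Dx s3) := by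
          linear_combination 2 * r4
      _ = _ := by
          rw [h, hD', q3, ← r1, q1, hσ4]
          ring
  -- the values modulo `f`
  obtain ⟨h, hh⟩ : ∃ h, h = Dx f * g := ⟨_, rfl⟩
  have m1 : f ∣ σ1 - (k + 2 : ℕ) * h := ⟨Dx g, by rw [hσ1, hh]; ring⟩
  obtain ⟨b1, hb1⟩ := m1
  have m2 : f ∣ σ2 - (k + 2 : ℕ) * h ^ 2 := by
    refine ⟨b1 * (σ1 + h) - g * Dx σ1, ?_⟩
    rw [hσ2, ← hh]
    push_cast at hb1 ⊢
    linear_combination (σ1 + h) * hb1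
  obtain ⟨b2, hb2⟩ := m2
  have m3 : f ∣ σ3 - 2 * (k + 2 : ℕ) * h ^ 3 := by
    refine ⟨2 * b1 * σ2 + 2 * h * b2 - g * Dx σ2, ?_⟩
    rw [hσ3, ← hh]
    push_cast at hb1 hb2 ⊢
    linear_combination 2 * σ2 * hb1 + 2 * h * hb2
  obtain ⟨b3, hb3⟩ := m3
  have m4 : f ∣ σ4 - 6 * (k + 2 : ℕ) * h ^ 4 := by
    refine ⟨3 * b1 * σ3 + 3 * h * b3 - g * Dx σ3, ?_⟩
    rw [hσ4, ← hh]
    push_cast at hb1 hb3 ⊢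
    linear_combination 3 * σ3 * hb1 + 3 * h * hb3
  obtain ⟨b4, hb4⟩ := m4
  -- the left side of the bilinear identity vanishes to higher order
  have hT : ∃ T, 2 * (Dy (f ^ (k + 2) * g) ^ 2 - f ^ (k + 2) * g * Dy (Dy (f ^ (k + 2) * g)))
        + 2 * (Dx (f ^ (k + 2) * g) * Dt (f ^ (k + 2) * g)
          - f ^ (k + 2) * g * Dx (Dt (f ^ (k + 2) * g))) = f ^ (2 * (k + 1)) * T := by
    simp only [hD _ (k + 1) g, hD _ k]
    refine ⟨2 * (((k + 1 + 1 : ℕ) * Dy f * g + f * Dy g) ^ 2 - g * ((k + 1 : ℕ) * Dy f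
        * ((k + 1 + 1 : ℕ) * Dy f * g + f * Dy g) + f * Dy ((k + 1 + 1 : ℕ) * Dy f * g + f * Dy g)))
      + 2 * (((k + 1 + 1 : ℕ) * Dx f * g + f * Dx g) * ((k + 1 + 1 : ℕ) * Dt f * g + f * Dt g)
        - g * ((k + 1 : ℕ) * Dx f * ((k + 1 + 1 : ℕ) * Dt f * g + f * Dt g)
          + f * Dx ((k + 1 + 1 : ℕ) * Dt f * g + f * Dt g))), ?_⟩
    ring
  obtain ⟨T, hT⟩ := hT
  rw [hT, q2] at hmain
  have hcancel : f ^ (4 * (k + 1)) * (6 * (f ^ 2 * g ^ 2 * T))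
      = f ^ (4 * (k + 1)) * (algebraMap ℂ S c ^ 2 * (6 * σ2 ^ 2 - σ4)) := by
    linear_combination 6 * hmain - algebraMap ℂ S c ^ 2 * q4
  have hcancel := mul_left_cancel₀ (pow_ne_zero _ hf.ne_zero) hcancel
  have hdvd : f ∣ algebraMap ℂ S (6 * c ^ 2 * ((k + 2 : ℕ) * (k + 1 : ℕ))) * h ^ 4 := by
    refine ⟨6 * f * g ^ 2 * T - algebraMap ℂ S c ^ 2 * (6 * b2 * (σ2 + (k + 2 : ℕ) * h ^ 2) - b4), ?_⟩
    simp only [map_mul, map_pow, map_natCast, map_ofNat]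
    push_cast at hb2 hb4 hcancel ⊢
    linear_combination -hcancel - algebraMap ℂ S c ^ 2 * (6 * (σ2 + (k + 2) * h ^ 2) * hb2 - hb4)
  rcases hf.dvd_or_dvd hdvd with h1 | h1
  · exfalso
    refine hf.not_isUnit (isUnit_of_dvd_unit h1 ?_)
    have h2 : ((k + 2 : ℕ) * (k + 1 : ℕ) : ℂ) ≠ 0 :=
      mul_ne_zero (Nat.cast_ne_zero.2 (by omega)) (Nat.cast_ne_zero.2 (by omega))
    exact (IsUnit.mk0 _ (mul_ne_zero (mul_ne_zero (by norm_num) (pow_ne_zero 2 hc)) h2)).map _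
  · have h2 := hf.dvd_of_dvd_pow h1
    rw [hh] at h2
    exact (hf.dvd_or_dvd h2).resolve_right hg

end Derivations

section Generic

variable {ι : Type*} [Fintype ι] [DecidableEq ι]

open Polynomial in
/-- A derivation of the coefficients, extended to polynomials. -/
def coeffDerivation {R : Type*} [CommRing R] [Algebra ℂ R] (d : Derivation ℂ R R) :
    Derivation ℂ R[X] R[X] :=
  PolynomialModule.equivPolynomialSelf.toLinearMap.compDer d.mapCoeffs

open Polynomial in
theorem coeffDerivation_coeff {R : Type*} [CommRing R] [Algebra ℂ R] (d : Derivation ℂ R R)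
    (p : R[X]) (i : ℕ) : (coeffDerivation d p).coeff i = d (p.coeff i) := rfl

theorem coeffDerivation_C {R : Type*} [CommRing R] [Algebra ℂ R] (d : Derivation ℂ R R) (a : R) :
    coeffDerivation d (Polynomial.C a) = Polynomial.C (d a) := by
  ext i
  rw [coeffDerivation_coeff, Polynomial.coeff_C, Polynomial.coeff_C]
  split_ifs <;> simp

theorem coeffDerivation_X {R : Type*} [CommRing R] [Algebra ℂ R] (d : Derivation ℂ R R) :
    coeffDerivation d Polynomial.X = 0 := by
  ext i
  rw [coeffDerivation_coeff, Polynomial.coeff_X]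
  split_ifs <;> simp

/-- The two-parameter family `P + y Q + t Q²` over `ℂ[y, t]`. -/
def pencil (P Q : Matrix ι ι ℂ) : Matrix ι ι (MvPolynomial (Fin 2) ℂ) :=
  P.map MvPolynomial.C + (MvPolynomial.X 0 : MvPolynomial (Fin 2) ℂ) • Q.map MvPolynomial.C
    + (MvPolynomial.X 1 : MvPolynomial (Fin 2) ℂ) • (Q * Q).map MvPolynomial.C

theorem pencil_apply (P Q : Matrix ι ι ℂ) (i j : ι) :
    pencil P Q i j = MvPolynomial.C (P i j) + MvPolynomial.X 0 * MvPolynomial.C (Q i j)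
      + MvPolynomial.X 1 * MvPolynomial.C ((Q * Q) i j) := rfl

theorem pencil_eval (P Q : Matrix ι ι ℂ) (x : Fin 2 → ℂ) :
    (pencil P Q).map (MvPolynomial.eval x) = P + x 0 • Q + x 1 • (Q * Q) := by
  ext i j
  simp [pencil_apply, Matrix.map_apply]

open Polynomial in
theorem charmatrix_pencil_x (P Q : Matrix ι ι ℂ) :
    (pencil P Q).charmatrix.map (Polynomial.derivative'.restrictScalars ℂ) = 1 := by
  ext1 i j
  rw [Matrix.map_apply, Matrix.charmatrix_apply]
  by_cases h : i = j
  · subst h; simp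
  · simp [h, Matrix.one_apply_ne h]

theorem charmatrix_pencil_coeff (P Q : Matrix ι ι ℂ) (k : Fin 2) :
    (pencil P Q).charmatrix.map (coeffDerivation (MvPolynomial.pderiv k))
      = -((if k = 0 then Q else Q * Q).map fun a => Polynomial.C (MvPolynomial.C a)) := by
  ext1 i j
  rw [Matrix.map_apply, Matrix.charmatrix_apply, map_sub, coeffDerivation_C]
  have h1 : coeffDerivation (MvPolynomial.pderiv k)
      (Matrix.diagonal (fun _ : ι => (Polynomial.X : Polynomial (MvPolynomial (Fin 2) ℂ))) i j) = 0 := by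
    by_cases h : i = j
    · subst h; simp [coeffDerivation_X]
    · simp [Matrix.diagonal_apply_ne _ h]
  rw [h1, zero_sub]
  simp only [pencil, Matrix.add_apply, Matrix.smul_apply, Matrix.map_apply, smul_eq_mul, map_add,
    MvPolynomial.pderiv_C, Derivation.leibniz, Matrix.neg_apply, mul_zero, zero_add]
  fin_cases k <;> simp [MvPolynomial.pderiv_X]

theorem charmatrix_pencil_commutator {P Q : Matrix ι ι ℂ} {c : ℂ} {v w : ι → ℂ}
    (h : Q * P - P * Q = c • 1 + Matrix.vecMulVec v w) :
    (Q.map fun a => Polynomial.C (MvPolynomial.C a)) * (pencil P Q).charmatrix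
      - (pencil P Q).charmatrix * (Q.map fun a => Polynomial.C (MvPolynomial.C a))
      = -(algebraMap ℂ (Polynomial (MvPolynomial (Fin 2) ℂ)) c • 1
        + Matrix.vecMulVec (fun i => Polynomial.C (MvPolynomial.C (v i)))
          (fun i => Polynomial.C (MvPolynomial.C (w i)))) := by
  let φ : ℂ →+* Polynomial (MvPolynomial (Fin 2) ℂ) := Polynomial.C.comp MvPolynomial.C
  have hφ : ∀ B : Matrix ι ι ℂ, (B.map fun a => Polynomial.C (MvPolynomial.C a))
      = φ.mapMatrix B := fun B => rfl
  have hN : (pencil P Q).charmatrix = Matrix.scalar ι Polynomial.X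
      - (φ.mapMatrix P + Matrix.scalar ι (Polynomial.C (MvPolynomial.X 0)) * φ.mapMatrix Q
        + Matrix.scalar ι (Polynomial.C (MvPolynomial.X 1)) * φ.mapMatrix (Q * Q)) := by
    ext1 i j
    rw [Matrix.charmatrix_apply, pencil_apply]
    simp [-map_mul, -Matrix.map_mul, φ, Matrix.scalar_apply, Matrix.diagonal_mul]
    simp only [Polynomial.C_mul]
  have hs : ∀ a, φ.mapMatrix Q * Matrix.scalar ι a = Matrix.scalar ι a * φ.mapMatrix Q := fun a =>
    ((Matrix.scalar_commute a (fun r => mul_comm _ _) _).eq).symm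
  have h' := congrArg φ.mapMatrix h
  rw [map_sub, map_mul, map_mul] at h'
  rw [hφ, hN]
  have e1 : φ.mapMatrix (c • 1 + Matrix.vecMulVec v w)
      = algebraMap ℂ (Polynomial (MvPolynomial (Fin 2) ℂ)) c • 1
        + Matrix.vecMulVec (fun i => Polynomial.C (MvPolynomial.C (v i)))
          (fun i => Polynomial.C (MvPolynomial.C (w i))) := by
    have hc : φ c = algebraMap ℂ (Polynomial (MvPolynomial (Fin 2) ℂ)) c := rfl
    ext1 i j
    by_cases hij : i = j
    · subst hij
      simp [φ, Matrix.vecMulVec_apply, ← hc]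
    · simp [φ, Matrix.vecMulVec_apply, Matrix.one_apply_ne hij]
  rw [← e1, ← h', map_mul]
  simp only [mul_sub, sub_mul, mul_add, add_mul]
  rw [hs]
  have e2 : ∀ a, φ.mapMatrix Q * (Matrix.scalar ι a * φ.mapMatrix Q)
      = Matrix.scalar ι a * φ.mapMatrix Q * φ.mapMatrix Q := by
    intro a
    rw [← mul_assoc, hs]
  have e3 : ∀ a, φ.mapMatrix Q * (Matrix.scalar ι a * (φ.mapMatrix Q * φ.mapMatrix Q))
      = Matrix.scalar ι a * (φ.mapMatrix Q * φ.mapMatrix Q) * φ.mapMatrix Q := by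
    intro a
    rw [← mul_assoc, hs]
    simp only [mul_assoc]
  rw [e2, e3]
  abel

open Polynomial in
/-- The generic member of the family `P + y Q + t Q²` has distinct eigenvalues. -/
theorem separable_charpoly_pencil {P Q : Matrix ι ι ℂ} {c : ℂ} (hc : c ≠ 0) {v w : ι → ℂ}
    (h : Q * P - P * Q = c • 1 + Matrix.vecMulVec v w) (K : Type*) [Field K]
    [Algebra (MvPolynomial (Fin 2) ℂ) K] [IsFractionRing (MvPolynomial (Fin 2) ℂ) K] :
    ((pencil P Q).charpoly.map (algebraMap (MvPolynomial (Fin 2) ℂ) K)).Separable := by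
  have hinj := IsFractionRing.injective (MvPolynomial (Fin 2) ℂ) K
  have : CharZero K := charZero_of_injective_algebraMap hinj
  set τ := (pencil P Q).charpoly with hτ
  have hmon : τ.Monic := Matrix.charpoly_monic _
  have hmonK : (τ.map (algebraMap (MvPolynomial (Fin 2) ℂ) K)).Monic := hmon.map _
  rw [PerfectField.separable_iff_squarefree,
    squarefree_iff_irreducible_sq_not_dvd_of_ne_zero hmonK.ne_zero]
  intro p hp hpp
  -- by Gauss's lemma a repeated factor over the fraction field comes from `ℂ[y, t][x]`
  obtain ⟨f, hf⟩ := IsIntegrallyClosed.eq_map_mul_C_of_dvd K hmon (dvd_of_mul_right_dvd hpp)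
  have hlc : p.leadingCoeff ≠ 0 := leadingCoeff_ne_zero.2 hp.ne_zero
  have hassoc : Associated (f.map (algebraMap (MvPolynomial (Fin 2) ℂ) K)) p :=
    ⟨(isUnit_C.2 (IsUnit.mk0 _ hlc)).unit, hf⟩
  have hfmon : f.Monic := by
    refine monic_of_injective hinj ?_
    have h1 := congrArg leadingCoeff hf
    rw [leadingCoeff_mul, leadingCoeff_C] at h1
    exact (mul_eq_right₀ hlc).1 h1
  have hfK : Prime (f.map (algebraMap (MvPolynomial (Fin 2) ℂ) K)) :=
    (hassoc.irreducible_iff.2 hp).prime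
  have hdvd : ∀ a : (MvPolynomial (Fin 2) ℂ)[X],
      f.map (algebraMap (MvPolynomial (Fin 2) ℂ) K) ∣ a.map (algebraMap _ K) ↔ f ∣ a := fun a =>
    map_dvd_map _ hinj hfmon
  have hfprime : Prime f := by
    refine ⟨hfmon.ne_zero, fun hu => hfK.not_isUnit ?_, fun a b hab => ?_⟩
    · exact hu.map (mapRingHom (algebraMap (MvPolynomial (Fin 2) ℂ) K))
    · rw [← hdvd, ← hdvd]
      refine hfK.dvd_or_dvd ?_
      rw [← Polynomial.map_mul, hdvd]
      exact hab
  have hdeg : 0 < f.natDegree := by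
    rw [Nat.pos_iff_ne_zero]
    intro h0
    exact hfprime.not_isUnit (by rw [hfmon.natDegree_eq_zero.1 h0]; exact isUnit_one)
  have hsq : f ^ 2 ∣ τ := by
    rw [← map_dvd_map _ hinj (hfmon.pow 2), Polynomial.map_pow]
    refine dvd_trans ?_ hpp
    rw [← pow_two]
    exact pow_dvd_pow_of_dvd hassoc.dvd 2
  have hmult : FiniteMultiplicity f τ :=
    finiteMultiplicity_of_degree_pos_of_monic (natDegree_pos_iff_degree_pos.1 hdeg) hfmon
      hmon.ne_zero
  obtain ⟨g, hg, hfg⟩ := hmult.exists_eq_pow_mul_and_not_dvd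
  obtain ⟨k, hk⟩ := Nat.exists_eq_add_of_le (hmult.le_multiplicity_of_pow_dvd hsq)
  rw [hk, add_comm 2 k] at hg
  have hcoeff : ∀ k : Fin 2, (Q.map fun a => C (MvPolynomial.C a)).map
      (coeffDerivation (MvPolynomial.pderiv k)) = 0 := by
    intro k
    ext1 i j
    simp [coeffDerivation_C]
  have hx0 : (Q.map fun a => C (MvPolynomial.C a)).map
      ((derivative' : Derivation (MvPolynomial (Fin 2) ℂ) _ _).restrictScalars ℂ) = 0 := by
    ext1 i j
    simp
  have hmain : f ∣ derivative f := dvd_derivation_of_sq_dvd_det (charmatrix_pencil_x P Q)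
    (charmatrix_pencil_coeff P Q 0)
    (by rw [charmatrix_pencil_coeff P Q 1]
        congr 1
        exact Matrix.map_mul (f := (C : _ →+* (MvPolynomial (Fin 2) ℂ)[X]).comp MvPolynomial.C))
    hx0 (hcoeff 0) hc (charmatrix_pencil_commutator h) hfprime hg hfg
  refine hfmon.not_dvd_of_degree_lt ?_ ?_ hmain
  · intro h0
    have := Polynomial.derivative_eq_zero.1 h0
    omega
  · exact degree_derivative_lt hfmon.ne_zero

open Polynomial in
/-- Arbitrarily small deformations `P + y Q + t Q²` have distinct eigenvalues. -/
theorem exists_separable_charpoly {P Q : Matrix ι ι ℂ} {c : ℂ} (hc : c ≠ 0) {v w : ι → ℂ}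
    (h : Q * P - P * Q = c • 1 + Matrix.vecMulVec v w) {ε : ℝ} (hε : 0 < ε) :
    ∃ y t : ℂ, ‖y‖ < ε ∧ ‖t‖ < ε ∧ (P + y • Q + t • (Q * Q)).charpoly.Separable := by
  set τ := (pencil P Q).charpoly with hτ
  let K := FractionRing (MvPolynomial (Fin 2) ℂ)
  obtain ⟨a, b, hab⟩ := separable_charpoly_pencil hc h K
  rw [← hτ] at hab
  obtain ⟨r, hr, ha⟩ := IsLocalization.integerNormalization_spec
    (nonZeroDivisors (MvPolynomial (Fin 2) ℂ)) a
  obtain ⟨s, hs, hb⟩ := IsLocalization.integerNormalization_spec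
    (nonZeroDivisors (MvPolynomial (Fin 2) ℂ)) b
  set a' := IsLocalization.integerNormalization (nonZeroDivisors (MvPolynomial (Fin 2) ℂ)) a
  set b' := IsLocalization.integerNormalization (nonZeroDivisors (MvPolynomial (Fin 2) ℂ)) b
  -- a Bézout identity with denominators cleared
  have hbez : C s * a' * τ + C r * b' * derivative τ = C (r * s) := by
    apply map_injective _ (IsFractionRing.injective (MvPolynomial (Fin 2) ℂ) K)
    simp only [Polynomial.map_add, Polynomial.map_mul, map_C, ← derivative_map, ha, hb,
      Algebra.smul_def, Polynomial.algebraMap_apply, map_mul]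
    linear_combination (C (algebraMap _ K r) * C (algebraMap _ K s)) * hab
  have hrs : r * s ≠ 0 := mul_ne_zero (nonZeroDivisors.ne_zero hr) (nonZeroDivisors.ne_zero hs)
  obtain ⟨x, hx, hxne⟩ : ∃ x : Fin 2 → ℂ, (∀ i, ‖x i‖ < ε) ∧ MvPolynomial.eval x (r * s) ≠ 0 := by
    by_contra hcon
    push Not at hcon
    refine hrs (MvPolynomial.funext_set (fun _ => Metric.ball (0 : ℂ) ε) (fun _ => ?_) ?_)
    · exact infinite_of_mem_nhds (0 : ℂ) (Metric.ball_mem_nhds 0 hε)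
    · intro x hx
      rw [map_zero]
      exact hcon x fun i => mem_ball_zero_iff.1 (hx i (Set.mem_univ i))
  refine ⟨x 0, x 1, hx 0, hx 1, ?_⟩
  rw [← pencil_eval, Matrix.charpoly_map, separable_def]
  have h1 := congrArg (Polynomial.map (MvPolynomial.eval x)) hbez
  simp only [Polynomial.map_add, Polynomial.map_mul _, map_C, ← derivative_map] at h1
  refine ⟨C (MvPolynomial.eval x (r * s))⁻¹ * ((C s * a').map (MvPolynomial.eval x)),
    C (MvPolynomial.eval x (r * s))⁻¹ * ((C r * b').map (MvPolynomial.eval x)), ?_⟩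
  have h2 : C (MvPolynomial.eval x (r * s))⁻¹ * C (MvPolynomial.eval x (r * s)) = 1 := by
    rw [← C_mul, inv_mul_cancel₀ hxne, C_1]
  rw [← h2, ← h1, Polynomial.map_mul, Polynomial.map_mul, map_C, map_C]
  ring

end Generic

/-! ### Density of the slice -/

theorem exists_eigenbasis {P : Matrix (Fin n) (Fin n) ℂ} (hP : P.charpoly.Separable) :
    ∃ (g : Matrix (Fin n) (Fin n) ℂ) (d : Fin n → ℂ), g.det ≠ 0 ∧ Function.Injective d ∧
      P * g = g * Matrix.diagonal d := by
  have hcard : P.charpoly.roots.toFinset.card = n := by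
    rw [Multiset.toFinset_card_of_nodup (Polynomial.nodup_roots hP),
      ← (IsAlgClosed.splits P.charpoly).natDegree_eq_card_roots, Matrix.charpoly_natDegree_eq_dim,
      Fintype.card_fin]
  let e := P.charpoly.roots.toFinset.equivFinOfCardEq hcard
  let d : Fin n → ℂ := fun j => (e.symm j : ℂ)
  have hd : Function.Injective d := fun i j hij => e.symm.injective (Subtype.ext hij)
  have hvec : ∀ j, ∃ u, u ≠ 0 ∧ P.mulVec u = d j • u := by
    intro j
    have h1 : (d j) ∈ P.charpoly.roots := Multiset.mem_toFinset.1 (e.symm j).2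
    have h2 : P.charpoly.eval (d j) = 0 := (Polynomial.mem_roots'.1 h1).2
    rw [Matrix.eval_charpoly] at h2
    obtain ⟨u, hu0, hu⟩ := Matrix.exists_mulVec_eq_zero_iff.2 h2
    refine ⟨u, hu0, ?_⟩
    rw [Matrix.sub_mulVec, sub_eq_zero] at hu
    rw [← hu]
    ext a
    simp [Matrix.scalar_apply, Matrix.mulVec_diagonal]
  choose u hu0 hu using hvec
  have hli : LinearIndependent ℂ u :=
    Module.End.eigenvectors_linearIndependent' P.mulVecLin d hd u fun j =>
      ⟨Module.End.mem_eigenspace_iff.2 (hu j), hu0 j⟩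
  refine ⟨Matrix.of fun a j => u j a, d, ?_, hd, ?_⟩
  · have h1 : IsUnit (Matrix.of fun a j => u j a : Matrix (Fin n) (Fin n) ℂ) :=
      Matrix.linearIndependent_cols_iff_isUnit.1 hli
    exact ((Matrix.isUnit_iff_isUnit_det _).1 h1).ne_zero
  · ext a j
    rw [Matrix.mul_diagonal]
    have := congrFun (hu j) a
    simp only [Pi.smul_apply, smul_eq_mul] at this
    rw [Matrix.of_apply, mul_comm, ← this]
    rfl

/-- If `X_i = 1` for `i ≠ -1`, then `X_{-1}` and `Y_{-1}` are a Calogero-Moser pair. -/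
theorem commutator_of_fibre {lam : Fin m → ℂ} (q : Fibre n lam)
    (hX : ∀ i, i ≠ -1 → rX q.1 i = 1) :
    rY q.1 (-1) * rX q.1 (-1) - rX q.1 (-1) * rY q.1 (-1)
      = absLam lam • 1 + Matrix.vecMulVec (rv q.1) (rw q.1) := by
  have h : ∑ i, (rY q.1 i * rX q.1 i - rX q.1 (i - 1) * rY q.1 (i - 1)
      - (if i = 0 then Matrix.vecMulVec (rv q.1) (rw q.1) else 0))
      = ∑ i, lam i • (1 : Matrix (Fin n) (Fin n) ℂ) := Finset.sum_congr rfl fun i _ => q.2 i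
  rw [Finset.sum_sub_distrib, Finset.sum_sub_distrib, Finset.sum_ite_eq', if_pos (Finset.mem_univ _),
    ← Finset.sum_smul,
    show ∑ i, rX q.1 (i - 1) * rY q.1 (i - 1) = ∑ i, rX q.1 i * rY q.1 i from
      Equiv.sum_comp (Equiv.subRight (1 : Fin m)) fun i => rX q.1 i * rY q.1 i,
    ← Finset.sum_sub_distrib, Finset.sum_eq_single (-1 : Fin m)] at h
  · exact eq_add_of_sub_eq h
  · intro i _ hi
    rw [hX i hi, mul_one, one_mul, sub_self]
  · intro h
    exact absurd (Finset.mem_univ _) h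

/-- A point of the fibre with `X_i = 1` for `i ≠ -1` and with `X_{-1}` invertible with distinct
eigenvalues is gauge equivalent to a point of the slice. -/
theorem toCM_mem_range_cmPoint {lam : Fin m → ℂ} (h0 : absLam lam ≠ 0) (q : Fibre n lam)
    (hX : ∀ i, i ≠ -1 → rX q.1 i = 1) (hdet : (rX q.1 (-1)).det ≠ 0)
    (hsep : (rX q.1 (-1)).charpoly.Separable) : toCM q ∈ Set.range (cmPoint (n := n) lam) := by
  have hcomm := commutator_of_fibre q hX
  set P := rX q.1 (-1) with hP
  set Q := rY q.1 (-1) with hQ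
  obtain ⟨g, d, hg, hd, hPg⟩ := exists_eigenbasis hsep
  have hgu : IsUnit g.det := isUnit_iff_ne_zero.2 hg
  have hgg : g⁻¹ * g = 1 := Matrix.nonsing_inv_mul g hgu
  have hgg' : g * g⁻¹ = 1 := Matrix.mul_nonsing_inv g hgu
  -- in the eigenbasis the diagonal entries of `[Q, P]` vanish, so `v` has no zero coordinate
  set a : Fin n → ℂ := g⁻¹.mulVec (rv q.1) with ha
  have hP' : g⁻¹ * P * g = Matrix.diagonal d := by
    rw [mul_assoc, hPg, ← mul_assoc, hgg, one_mul]
  have hdiag : g⁻¹ * Q * g * Matrix.diagonal d - Matrix.diagonal d * (g⁻¹ * Q * g)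
      = absLam lam • 1 + Matrix.vecMulVec a (Matrix.vecMul (rw q.1) g) := by
    rw [← hP', ha, ← Matrix.vecMulVec_mul, ← Matrix.mul_vecMulVec]
    have h1 : g⁻¹ * Q * g * (g⁻¹ * P * g) - g⁻¹ * P * g * (g⁻¹ * Q * g)
        = g⁻¹ * (Q * P - P * Q) * g := by
      calc _ = g⁻¹ * Q * (g * g⁻¹) * P * g - g⁻¹ * P * (g * g⁻¹) * Q * g := by noncomm_ring
        _ = _ := by rw [hgg']; noncomm_ring
    rw [h1, hcomm, mul_add, add_mul, Matrix.mul_smul, Matrix.smul_mul, mul_one, hgg]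
  have ha0 : ∀ j, a j ≠ 0 := by
    intro j hj
    have h1 := congrFun (congrFun hdiag j) j
    rw [Matrix.sub_apply, Matrix.mul_diagonal, Matrix.diagonal_mul, mul_comm, sub_self,
      Matrix.add_apply, Matrix.smul_apply, Matrix.one_apply_eq, Matrix.vecMulVec_apply, hj,
      zero_mul, add_zero, smul_eq_mul, mul_one] at h1
    exact h0 h1.symm
  have hd0 : ∀ j, d j ≠ 0 := by
    have h1 : (Matrix.diagonal d).det ≠ 0 := by
      rw [← hP', Matrix.det_mul, Matrix.det_mul, mul_right_comm, ← Matrix.det_mul, hgg,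
        Matrix.det_one, one_mul]
      exact hdet
    rw [Matrix.det_diagonal] at h1
    exact fun j => Finset.prod_ne_zero_iff.1 h1 j (Finset.mem_univ j)
  have hroot : ∀ j, ∃ z : ℂ, z ^ m = d j := fun j =>
    IsAlgClosed.exists_pow_nat_eq (d j) (Nat.pos_of_ne_zero (NeZero.ne m))
  choose ν hν using hroot
  have hν0 : ∀ j, ν j ≠ 0 := by
    intro j hj
    apply hd0 j
    rw [← hν, hj, zero_pow (NeZero.ne m)]
  have hreg : (ν, (0 : Fin n → ℂ)) ∈ regDomain m n :=
    ⟨hν0, fun i j hij h => hij (hd (by rw [← hν, ← hν]; exact h))⟩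
  let G : Fin m → Matrix (Fin n) (Fin n) ℂ := fun i =>
    g * Matrix.diagonal fun j => a j * (ν j)⁻¹ ^ (i : ℕ)
  refine ⟨_, (toCM_eq_of_gauge q (g := G) (ν := ν) ?_ ?_ ?_ hreg hreg).symm⟩
  · intro i
    rw [Matrix.det_mul, Matrix.det_diagonal]
    exact mul_ne_zero hg (Finset.prod_ne_zero_iff.2 fun j _ =>
      mul_ne_zero (ha0 j) (pow_ne_zero _ (inv_ne_zero (hν0 j))))
  · intro i
    by_cases hi : i = -1
    · subst hi
      change P * (g * _) = g * _ * _
      rw [← mul_assoc, hPg, mul_assoc, mul_assoc, Matrix.diagonal_mul_diagonal,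
        Matrix.diagonal_mul_diagonal]
      congr 2
      funext j
      rw [neg_add_cancel, val_neg_one, Fin.val_zero, pow_zero, mul_one, ← hν]
      obtain ⟨k, hk⟩ := Nat.exists_eq_succ_of_ne_zero (NeZero.ne m)
      have h1 : (ν j)⁻¹ ^ k * ν j ^ k = 1 := by
        rw [← mul_pow, inv_mul_cancel₀ (hν0 j), one_pow]
      rw [hk, Nat.succ_sub_one, pow_succ]
      linear_combination (a j * ν j) * h1
    · rw [hX i hi, one_mul]
      change g * _ = g * _ * _
      rw [mul_assoc, Matrix.diagonal_mul_diagonal]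
      congr 2
      funext j
      have h1 := val_sub_one_of_ne (m := m) (i := i + 1) (fun h => hi (eq_neg_of_add_eq_zero_left h))
      rw [add_sub_cancel_right] at h1
      rw [← h1, pow_succ, mul_assoc, mul_assoc, inv_mul_cancel₀ (hν0 j), mul_one]
  · have h1 : G 0 = g * Matrix.diagonal a := by
      simp [G]
    rw [h1, ← Matrix.mulVec_mulVec]
    have h2 : (Matrix.diagonal a).mulVec (fun _ => 1) = a := by
      funext j
      simp [Matrix.mulVec_diagonal]
    rw [h2, ha, Matrix.mulVec_mulVec, hgg', Matrix.one_mulVec]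

/-- The deformation `X_{-1} + Δ` of a point with `X_i = 1` for `i ≠ -1`.  The `Y_i` with `i ≠ -1` are
shifted by `Y_{-1} Δ`, which leaves the moment map unchanged when `Δ` commutes with `Y_{-1}`. -/
def deform (q : Rep m n) (Δ : Matrix (Fin n) (Fin n) ℂ) : Rep m n :=
  (fun i => if i = -1 then rX q i + Δ else rX q i,
   fun i => if i = -1 then rY q i else rY q i + rY q (-1) * Δ, rv q, rw q)

theorem rX_deform (q : Rep m n) (Δ : Matrix (Fin n) (Fin n) ℂ) (i : Fin m) :
    rX (deform q Δ) i = if i = -1 then rX q i + Δ else rX q i := rfl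

theorem rY_deform (q : Rep m n) (Δ : Matrix (Fin n) (Fin n) ℂ) (i : Fin m) :
    rY (deform q Δ) i = if i = -1 then rY q i else rY q i + rY q (-1) * Δ := rfl

theorem momentMap_deform {q : Rep m n} (hX : ∀ i, i ≠ -1 → rX q i = 1)
    {Δ : Matrix (Fin n) (Fin n) ℂ} (hΔ : rY q (-1) * Δ = Δ * rY q (-1)) (i : Fin m) :
    momentMap (deform q Δ) i = momentMap q i := by
  have h1 : rY (deform q Δ) i * rX (deform q Δ) i = rY q i * rX q i + rY q (-1) * Δ := by
    by_cases hi : i = -1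
    · subst hi
      rw [rX_deform, rY_deform, if_pos rfl, if_pos rfl, mul_add]
    · rw [rX_deform, rY_deform, if_neg hi, if_neg hi, hX i hi, mul_one, mul_one]
  have h2 : rX (deform q Δ) (i - 1) * rY (deform q Δ) (i - 1)
      = rX q (i - 1) * rY q (i - 1) + rY q (-1) * Δ := by
    by_cases hi : i - 1 = -1
    · rw [hi]
      rw [rX_deform, rY_deform, if_pos rfl, if_pos rfl, add_mul, hΔ]
    · rw [rX_deform, rY_deform, if_neg hi, if_neg hi, hX _ hi, one_mul, one_mul]
  simp only [momentMap]
  rw [h1, h2]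
  change _ - _ - (if i = 0 then Matrix.vecMulVec (rv q) (rw q) else 0) = _
  abel

/-- Invertible `X_i` can be gauged to `1` for `i ≠ -1`, by `h_0 = 1`, `h_{i+1} = h_i X_i⁻¹`. -/
theorem exists_gauge_eq_one {q : Rep m n} (hq : ∀ i, (rX q i).det ≠ 0) :
    ∃ h : Fin m → GL (Fin n) ℂ, ∀ i, i ≠ -1 → rX (glAct h q) i = 1 := by
  let X : Fin m → GL (Fin n) ℂ := fun i => Matrix.GeneralLinearGroup.mkOfDetNeZero _ (hq i)
  let H : ℕ → GL (Fin n) ℂ := fun k => Nat.rec 1 (fun k A => A * (X (k • (1 : Fin m)))⁻¹) k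
  refine ⟨fun i => H i, fun i hi => ?_⟩
  have h1 := val_sub_one_of_ne (m := m) (i := i + 1) (fun h => hi (eq_neg_of_add_eq_zero_left h))
  rw [add_sub_cancel_right] at h1
  have h2 : H ((i + 1 : Fin m) : ℕ) = H (i : ℕ) * (X i)⁻¹ := by
    rw [← h1]
    change H (i : ℕ) * (X ((i : ℕ) • (1 : Fin m)))⁻¹ = _
    congr 3
    apply Fin.ext
    rw [val_nsmul_one, Nat.mod_eq_of_lt i.2]
  change (H ((i + 1 : Fin m) : ℕ)).val * (X i).val * (H (i : ℕ))⁻¹.val = 1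
  rw [h2, ← Units.val_mul, ← Units.val_mul, inv_mul_cancel_right, mul_inv_cancel, Units.val_one]

/-- The image of the slice is dense. -/
theorem denseRange_cmPoint {lam : Fin m → ℂ} (hlam : IsRegular lam) :
    DenseRange (cmPoint (n := n) lam) := by
  have hdense : Dense (toCM ⁻¹' Set.range (cmPoint (n := n) lam) : Set (Fibre n lam)) := by
    rw [dense_iff_inter_open]
    intro O hO hne
    obtain ⟨q, hqO, hq⟩ := (dense_forall_det_ne_zero hlam).inter_open_nonempty O hO hne
    obtain ⟨h, hh⟩ := exists_gauge_eq_one hq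
    set q₁ := fibreAct h q with hq₁
    have hX : ∀ i, i ≠ -1 → rX q₁.1 i = 1 := hh
    set P := rX q₁.1 (-1) with hP
    set Q := rY q₁.1 (-1) with hQ
    have hdetP : P.det ≠ 0 := by
      change ((h (-1 + 1)).val * rX q.1 (-1) * (h (-1))⁻¹.val).det ≠ 0
      rw [Matrix.det_mul, Matrix.det_mul]
      exact mul_ne_zero (mul_ne_zero (Matrix.GeneralLinearGroup.det_ne_zero _) (hq _))
        (Matrix.GeneralLinearGroup.det_ne_zero _)
    have hΔ : ∀ y t : ℂ, Q * (y • Q + t • (Q * Q)) = (y • Q + t • (Q * Q)) * Q := by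
      intro y t
      simp only [mul_add, add_mul, Matrix.mul_smul, Matrix.smul_mul, mul_assoc]
    let D : ℂ × ℂ → Fibre n lam := fun p =>
      ⟨deform q₁.1 (p.1 • Q + p.2 • (Q * Q)), fun i => by
        rw [momentMap_deform hX (hΔ p.1 p.2), q₁.2]⟩
    have hDc : Continuous D := by
      refine Continuous.subtype_mk ?_ _
      have hc : Continuous fun p : ℂ × ℂ => p.1 • Q + p.2 • (Q * Q) :=
        (continuous_fst.smul continuous_const).add (continuous_snd.smul continuous_const)
      refine (continuous_pi fun i => ?_).prodMk ((continuous_pi fun i => ?_).prodMk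
        continuous_const)
      · split_ifs
        · exact continuous_const.add hc
        · exact continuous_const
      · split_ifs
        · exact continuous_const
        · exact continuous_const.add (continuous_const.mul hc)
    have hD0 : D (0, 0) = q₁ := by
      apply Subtype.ext
      change deform q₁.1 ((0 : ℂ) • Q + (0 : ℂ) • (Q * Q)) = q₁.1
      rw [zero_smul, zero_smul, add_zero]
      refine Prod.ext (funext fun i => ?_) (Prod.ext (funext fun i => ?_) rfl)
      · simp [deform]
      · simp [deform]
    have hback : fibreAct h⁻¹ q₁ = q := by
      apply Subtype.ext
      change glAct h⁻¹ (glAct h q.1) = q.1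
      rw [← glAct_mul, inv_mul_cancel, glAct_one]
    have hev1 : ∀ᶠ p in 𝓝 ((0 : ℂ), (0 : ℂ)), fibreAct h⁻¹ (D p) ∈ O := by
      have hc := ((continuous_fibreAct (lam := lam) h⁻¹).comp hDc).continuousAt (x := ((0 : ℂ), (0 : ℂ)))
      refine hc.eventually (hO.mem_nhds ?_)
      change fibreAct h⁻¹ (D (0, 0)) ∈ O
      rw [hD0, hback]
      exact hqO
    have hev2 : ∀ᶠ p in 𝓝 ((0 : ℂ), (0 : ℂ)), (rX (D p).1 (-1)).det ≠ 0 := by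
      have hc1 : Continuous fun p => rX (D p).1 (-1) :=
        (continuous_apply _).comp (continuous_fst.comp (continuous_subtype_val.comp hDc))
      have hc : Continuous fun p => (rX (D p).1 (-1)).det := by fun_prop
      refine hc.continuousAt.eventually (isOpen_ne.mem_nhds ?_)
      change (rX (D (0, 0)).1 (-1)).det ≠ 0
      rw [hD0]
      exact hdetP
    obtain ⟨ε, hε, hball⟩ := Metric.eventually_nhds_iff.1 (hev1.and hev2)
    obtain ⟨y, t, hy, ht, hsep⟩ := exists_separable_charpoly hlam.1 (commutator_of_fibre q₁ hX) hε
    obtain ⟨hO', hdet⟩ := hball (y := (y, t)) (by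
      rw [dist_eq_norm, Prod.norm_def]
      simpa using ⟨hy, ht⟩)
    refine ⟨fibreAct h⁻¹ (D (y, t)), hO', ?_⟩
    have heq : toCM (fibreAct h⁻¹ (D (y, t))) = toCM (D (y, t)) := by
      rw [eq_comm, toCM_eq_iff]
      exact ⟨h⁻¹, rfl⟩
    rw [Set.mem_preimage, heq]
    have hlast : rX (D (y, t)).1 (-1) = P + y • Q + t • (Q * Q) := by
      change (if (-1 : Fin m) = -1 then P + (y • Q + t • (Q * Q)) else P) = _
      rw [if_pos rfl, add_assoc]
    refine toCM_mem_range_cmPoint hlam.1 _ (fun i hi => ?_) hdet (by rw [hlast]; exact hsep)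
    change (if i = -1 then _ else rX q₁.1 i) = 1
    rw [if_neg hi, hX i hi]
  exact (isOpenQuotientMap_toCM.dense_preimage_iff).1 hdense

end WreathCM

end

theorem mainTheorem5 (m n : ℕ) [NeZero m] (ζ : rootsOfUnity m ℂ) (hζ : IsPrimitiveRoot ζ m)
    (c₀₀ : ℂ) (c κ : Fin m → ℂ) (hκ : WreathCM.IsKappa ζ c₀₀ c κ)
    (lam : Fin m → ℂ) (hlam : lam = WreathCM.lamOf ζ c₀₀ c)
    (L : ℕ → WreathCM.Phase n → ℂ) (hL : L = WreathCM.calogeroHam n ζ c₀₀ κ) :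
    -- the traces of powers of `Y` are, up to the factor `m`, the Hamiltonians `L_j`, or zero
    (∀ z ∈ WreathCM.regDomain m n,
      (∀ j : ℕ, 1 ≤ j → (WreathCM.laxMatrix lam z ^ (m * j)).trace = (m : ℂ) * L j z) ∧
      (∀ k : ℕ, ¬ m ∣ k → (WreathCM.laxMatrix lam z ^ k).trace = 0)) ∧
    -- they are in involution, and form a full set: `L_1, …, L_n` are independent
    (∀ j : ℕ, 1 ≤ j → DifferentiableOn ℂ (L j) (WreathCM.regDomain m n)) ∧
    (∀ i j : ℕ, 1 ≤ i → 1 ≤ j → ∀ z ∈ WreathCM.regDomain m n,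
      WreathCM.bracket (L i) (L j) z = 0) ∧
    (WreathCM.regDomain m n ⊆ closure {z | z ∈ WreathCM.regDomain m n ∧
      LinearIndependent ℂ (fun j : Fin n => fderiv ℂ (L ((j : ℕ) + 1)) z)}) ∧
    -- `Y` deforms isospectrally under the flow of every `L_j`
    (∀ j : ℕ, 1 ≤ j → ∀ (U : Set ℂ) (γ : ℂ → WreathCM.Phase n), IsOpen U → IsPreconnected U →
      WreathCM.IsHamiltonianCurve m (L j) U γ → ∀ s ∈ U, ∀ t ∈ U,
        (WreathCM.laxMatrix lam (γ t)).charpoly = (WreathCM.laxMatrix lam (γ s)).charpoly) ∧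
    -- for regular `λ`, the symplectic quotient is a completed phase space
    (WreathCM.IsRegular lam →
      -- the action on the fibre is free, the quotient is Hausdorff, and the symplectic form
      -- induces a nondegenerate form on the `2n`-dimensional reduced tangent spaces
      (∀ (q : WreathCM.Fibre n lam) (g : Fin m → GL (Fin n) ℂ),
        WreathCM.glAct g q.1 = q.1 → g = 1) ∧
      T2Space (WreathCM.CMSpace n lam) ∧
      (∀ q : WreathCM.Fibre n lam,
        WreathCM.orbitTangent q.1 ≤ WreathCM.fibreTangent q.1 ∧
        (∀ ξ ∈ WreathCM.fibreTangent q.1,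
          (∀ η ∈ WreathCM.fibreTangent q.1, WreathCM.sympForm ξ η = 0) ↔
            ξ ∈ WreathCM.orbitTangent q.1) ∧
        Module.finrank ℂ (WreathCM.fibreTangent q.1)
          = Module.finrank ℂ (WreathCM.orbitTangent q.1) + 2 * n) ∧
      -- the linear flows are the flows, on all of `Rep`, of the invariant Hamiltonians
      -- `(|λ|/m) tr Y^{mj}`
      (∀ (t : ℕ+ →₀ ℂ) (q : WreathCM.Rep m n),
        WreathCM.bigX (WreathCM.rX (WreathCM.linearFlow lam t q))
          = WreathCM.bigX (WreathCM.rX q) + WreathCM.flowIncrement lam t q) ∧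
      (∀ (j : ℕ+) (g : Fin m → GL (Fin n) ℂ) (q : WreathCM.Rep m n),
        WreathCM.flowHam lam j (WreathCM.glAct g q) = WreathCM.flowHam lam j q) ∧
      (∀ j : ℕ+, ∃ V : WreathCM.Rep m n → WreathCM.Rep m n,
        (∀ (q : WreathCM.Rep m n) (τ : ℂ), HasDerivAt (fun τ' => WreathCM.linearFlow lam (Finsupp.single j τ') q)
          (V (WreathCM.linearFlow lam (Finsupp.single j τ) q)) τ) ∧
        ∀ q' : WreathCM.Rep m n, DifferentiableAt ℂ (WreathCM.flowHam lam j) q' ∧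
          ∀ ξ, fderiv ℂ (WreathCM.flowHam lam j) q' ξ = WreathCM.sympForm ξ (V q')) ∧
      ∃ (ι : WreathCM.regDomain m n → WreathCM.CMSpace n lam)
        (Φ : (ℕ+ →₀ ℂ) → WreathCM.CMSpace n lam → WreathCM.CMSpace n lam),
        -- the slice induces a symplectic embedding of `(𝔥_reg × 𝔥*)/G` onto an open dense subset
        (∀ z, ∃ q : WreathCM.Fibre n lam,
          q.1 = WreathCM.slice lam z.1 ∧ ι z = WreathCM.toCM q) ∧
        Continuous ι ∧ IsOpenMap ι ∧ DenseRange ι ∧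
        (∀ z z', ι z = ι z' ↔ ∃ g : WreathCM.WreathG m n, g • z.1 = z'.1) ∧
        (∀ z ∈ WreathCM.regDomain m n,
          DifferentiableAt ℂ (WreathCM.slice (m := m) (n := n) lam) z ∧
          ∀ u u' : WreathCM.Phase n,
            WreathCM.sympForm (fderiv ℂ (WreathCM.slice (m := m) lam) z u)
                (fderiv ℂ (WreathCM.slice (m := m) lam) z u')
              = (m : ℂ) * ∑ i, (u.2 i * u'.1 i - u'.2 i * u.1 i)) ∧
        -- the linear flows preserve the fibre and descend to complete flows on the quotient
        (∀ (t : ℕ+ →₀ ℂ) (q : WreathCM.Fibre n lam), ∃ q' : WreathCM.Fibre n lam,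
          q'.1 = WreathCM.linearFlow lam t q.1 ∧
          Φ t (WreathCM.toCM q) = WreathCM.toCM q') ∧
        (∀ x, Φ 0 x = x) ∧ (∀ s t x, Φ (s + t) x = Φ s (Φ t x)) ∧
        (∀ j : ℕ+, Continuous fun y : ℂ × WreathCM.CMSpace n lam =>
          Φ (Finsupp.single j y.1) y.2) ∧
        -- which extend the flows of the `L_j`
        (∀ (j : ℕ+) (U : Set ℂ) (γ : ℂ → WreathCM.Phase n), IsOpen U → IsPreconnected U →
          WreathCM.IsHamiltonianCurve m (L j) U γ → ∀ s ∈ U, ∀ t ∈ U,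
          ∀ (hs : γ s ∈ WreathCM.regDomain m n) (ht : γ t ∈ WreathCM.regDomain m n),
            ι ⟨γ t, ht⟩ = Φ (Finsupp.single j ((m : ℂ) / WreathCM.absLam lam * (t - s)))
              (ι ⟨γ s, hs⟩))) := by
  subst hlam hL
  have hf : ∀ j : ℕ, 1 ≤ j → ∀ z ∈ WreathCM.regDomain m n,
      (WreathCM.laxMatrix (WreathCM.lamOf ζ c₀₀ c) z ^ (m * j)).trace
        = (m : ℂ) * WreathCM.calogeroHam n ζ c₀₀ κ j z := by
    intro j _ z hz
    rw [WreathCM.calogeroHam_eq_sum_laxVec hζ hκ j hz, WreathCM.sum_laxVec,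
      WreathCM.trace_laxMatrix_pow _ hz]
  refine ⟨fun z hz => ⟨fun j hj => hf j hj z hz, fun k hk =>
      WreathCM.trace_bigY_pow_eq_zero _ k hk⟩, fun j hj z hz =>
      (WreathCM.differentiableAt_of_trace (hf j hj) hz).differentiableWithinAt,
    fun i j hi hj z hz => WreathCM.bracket_eq_zero_of_trace (hf i hi) (hf j hj) hi hj hz,
    WreathCM.regDomain_subset_closure hf,
    fun j hj U γ hU hU' hγ s hs t ht =>
      WreathCM.charpoly_laxMatrix_eq (hf j hj) hj hU hU' hγ hs ht, fun hreg => ?_⟩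
  refine ⟨fun q g hg => WreathCM.eq_one_of_glAct_eq_self hreg q.2 hg,
    WreathCM.t2Space_cmSpace hreg,
    fun q => ⟨WreathCM.orbitTangent_le_fibreTangent q.2,
      fun ξ _ => WreathCM.mem_orbitTangent_iff.symm,
      WreathCM.finrank_fibreTangent (WreathCM.glInf_injective hreg q.2)⟩,
    fun t q => WreathCM.bigX_linearFlow _ t q, fun j g q => WreathCM.flowHam_glAct _ j g q,
    fun j => ⟨fun q => WreathCM.absLam _ • WreathCM.powField j q,
      fun q τ => WreathCM.hasDerivAt_linearFlow _ j q τ,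
      fun q' => ⟨WreathCM.differentiableAt_flowHam _ j q',
        fun ξ => WreathCM.fderiv_flowHam _ j q' ξ⟩⟩,
    WreathCM.cmPoint _, WreathCM.cmFlow, ?_⟩
  exact ⟨fun z => ⟨WreathCM.slicePoint _ z, rfl, rfl⟩, WreathCM.continuous_cmPoint _,
    WreathCM.isOpenMap_cmPoint _, WreathCM.denseRange_cmPoint hreg,
    fun z z' => WreathCM.cmPoint_eq_iff,
    fun z hz => ⟨WreathCM.differentiableAt_slice _ hz, fun u u' =>
      WreathCM.sympForm_fderiv_slice _ hz u u'⟩,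
    fun t q => ⟨WreathCM.fibreFlow t q, rfl, rfl⟩, WreathCM.cmFlow_zero, WreathCM.cmFlow_add,
    WreathCM.continuous_cmFlow,
    fun j U γ hU hU' hγ s hs t ht hs' ht' =>
      WreathCM.cmPoint_eq_cmFlow hreg.1 (hf j j.2) hU hU' hγ hs ht hs' ht'⟩
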